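/- Let $p$ be a prime, let $X$ be a finite connected multigraph (loops and multiple edges allowed) with an orientation $S$ of its edges, and let $\alpha\colon S\to\mathbb{Z}_p^2$ be a voltage assignment such that, for every $m\ge 0$, the derived graph $X_m$ of $\alpha \bmod p^m$ (vertices $(v,g)$ with $v\in V(X)$, $g\in(\mathbb{Z}/p^m)^2$, and for each edge $e\in S$ from $v$ to $w$ and each $g$ one edge from $(v,g)$ to $(w,g+\alpha(e))$) is connected. Write $X_\infty$ for the resulting $\mathbb{Z}_p^2$-cover of $X$. A $\mathbb{Z}_p$-subcover of $X_\infty$ is a $\mathbb{Z}_p$-cover $Y$ of $X$ given by a voltage assignment $\pi\circ\alpha$, where $\pi\colon\mathbb{Z}_p^2\to\mathbb{Z}_p$ is a surjective homomorphism (i.e. $Y$ is the quotient of $X_\infty$ by $\ker\pi$); let $\mathcal{E}^{\subseteq X_\infty}(X)$ be the set of these subcovers. For a $\mathbb{Z}_p^l$-cover $Z$ of $X$ with layers $Z_m$ put $J_\infty(Z)=\varprojlim_m J(Z_m)$, where $J(Z_m)=\mathrm{Div}^0(Z_m)/\mathrm{Pr}(Z_m)$ is the Jacobian with $\mathbb{Z}_p$-coefficients,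 viewed as a module over $\Lambda_l=\mathbb{Z}_p[[\Gamma]]=\varprojlim_m\mathbb{Z}_p[\Gamma/\Gamma^{p^m}]$, $\Gamma=\mathbb{Z}_p^l$ (written multiplicatively). If a finitely generated torsion $\Lambda_l$-module $A$ is pseudo-isomorphic to $\bigoplus_i\Lambda_l/(p^{e_i})\oplus\bigoplus_j\Lambda_l/(g_j)$ with all $g_j$ coprime to $p$, let $m_0(A)=\sum_i e_i$, $G_A=\prod_j g_j$, $F_A=p^{m_0(A)}G_A$, and $l_0(A)=\sum_{\mathcal{P}}v_{\mathcal{P}}(\overline{G_A})$, where $\overline{G_A}$ is the class of $G_A$ in $\Lambda_l/(p)$, the sum is over all prime ideals of $\Lambda_l/(p)$ of the form $\mathcal{P}=(\overline{\sigma-1})$ with $\sigma\in\Gamma\setminus\Gamma^p$, and $v_{\mathcal{P}}$ is the $\mathcal{P}$-adic valuation. For $l=1$ let $\mu(A)=m_0(A)$, and let $\lambda(A)$ be the degree of the distinguished polynomial $P\in\mathbb{Z}_p[T]$ such that $F_A$ is associated with $p^{\mu(A)}P(T)$ in $\Lambda_1=\mathbb{Z}_p[[T]]$, $T=\gamma-1$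 for a topological generator $\gamma$ of $\Gamma$. For a $\mathbb{Z}_p$-cover $Y$ write $\mu(Y)=\mu(J_\infty(Y))$ and $\lambda(Y)=\lambda(J_\infty(Y))$. Suppose that $X_\infty$ contains $\mathbb{Z}_p$-subcovers $Y_1,Y_2$ of $X$ with $\mu(Y_1)=0$ and $\mu(Y_2)>0$. Then $\lambda$ is unbounded on $\mathcal{E}^{\subseteq X_\infty}(X)$, and $l_0(J_\infty(X_\infty))>0$. -/

import Mathlib

/-- A multigraph with vertex set `W` and set of undirected edges `E`, each edge being given one of
its two orientations.  Multiple edges and loops are allowed.  The directed edges of the graph are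
the elements of `E` and their inverses, so that a loop contributes two directed edges. -/
structure Multigraph (W E : Type*) where
  src : E → W
  tgt : E → W

namespace Multigraph

section Basic

variable {W E : Type*} (Y : Multigraph W E)

/-- Non-empty, and any two vertices are joined by a path of (arbitrarily oriented) edges. -/
def Connected : Prop :=
  Nonempty W ∧
    ∀ v w : W, Relation.EqvGen (fun a b => ∃ e : E, Y.src e = a ∧ Y.tgt e = b) v w

/-- The derived graph of a voltage assignment `a : E → G`: the edge `e` from `v` to `w` gives,
for each `g`, an edge from `(v, g)` to `(w, g + a e)`.  The group is written additively. -/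
def derived {G : Type*} [AddCommGroup G] (a : E → G) : Multigraph (W × G) (E × G) where
  src e := (Y.src e.1, e.2)
  tgt e := (Y.tgt e.1, e.2 + a e.1)

variable (k : Type*) [CommRing k]

/-- `Div(Y)`: divisors on the vertices, i.e. finite formal sums of vertices with coefficients in
`k`. (Below, `k` is always `ℤ_p`.) -/
def Divisor (W : Type*) : Type _ := W →₀ k

noncomputable instance (W : Type*) : AddCommGroup (Divisor k W) :=
  inferInstanceAs (AddCommGroup (W →₀ k))

noncomputable instance (W : Type*) : Module k (Divisor k W) :=
  inferInstanceAs (Module k (W →₀ k))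

/-- The divisor of a vertex. -/
noncomputable def point (w : W) : Divisor k W := Finsupp.single w (1 : k)

/-- The degree of a divisor. -/
noncomputable def degree (W : Type*) : Divisor k W →ₗ[k] k :=
  Finsupp.linearCombination k (fun _ : W => (1 : k))

/-- Push-forward of divisors along a map of vertices. -/
noncomputable def push {W' : Type*} (f : W → W') : Divisor k W →ₗ[k] Divisor k W' :=
  Finsupp.lmapDomain k k f

theorem push_point {W' : Type*} (f : W → W') (w : W) : push k f (point k w) = point k (f w) :=
  Finsupp.mapDomain_single

theorem degree_push {W' : Type*} (f : W → W') (d : Divisor k W) :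
    degree k W' (push k f d) = degree k W d :=
  Finsupp.linearCombination_mapDomain k f d

theorem push_push {W' W'' : Type*} (f : W → W') (g : W' → W'') (d : Divisor k W) :
    push k g (push k f d) = push k (g ∘ f) d :=
  (Finsupp.mapDomain_comp (M := k) (f := f) (g := g) (v := d)).symm

theorem push_id (d : Divisor k W) : push k (id : W → W) d = d :=
  Finsupp.mapDomain_id (M := k)

/-- `Div⁰`: divisors of degree zero. -/
noncomputable def div0 (W : Type*) : Submodule k (Divisor k W) := LinearMap.ker (degree k W)

open Classical in
/-- The divisor `p_v = - ∑ (t(e) - v)`, the sum being over the directed edges `e` with origin `v`,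
i.e. over the edges starting in `v` and the inverses of the edges ending in `v`. -/
noncomputable def firing [Fintype E] (v : W) : Divisor k W :=
  ∑ e : E, ((if Y.src e = v then point k v - point k (Y.tgt e) else 0) +
    (if Y.tgt e = v then point k v - point k (Y.src e) else 0))

/-- `Pr(Y)`: the `k`-module of principal divisors, spanned by the `p_v`. -/
noncomputable def principal [Fintype E] : Submodule k (Divisor k W) :=
  Submodule.span k (Set.range (Y.firing k))

/-- `J(Y) = Div⁰(Y) / Pr(Y)`, the Jacobian with coefficients in `k`. For `k = ℤ_p` and a finite
connected graph `Y` this is the `p`-Sylow subgroup of the usual Jacobian.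
(`Pr(Y)` is contained in `Div⁰(Y)`, see `principal_le_div0`.) -/
abbrev Jac [Fintype E] : Type _ := div0 k W ⧸ (Y.principal k).submoduleOf (div0 k W)

theorem principal_le_div0 [Fintype E] : Y.principal k ≤ div0 k W := by
  have hpt : ∀ w : W, degree k W (point k w) = 1 := fun w =>
    (Finsupp.linearCombination_single k (1 : k) w).trans (one_smul k 1)
  rw [principal, Submodule.span_le]
  rintro _ ⟨v, rfl⟩
  simp only [div0, SetLike.mem_coe, LinearMap.mem_ker, firing, map_sum]
  refine Finset.sum_eq_zero fun e _ => ?_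
  split_ifs <;> simp [hpt]

/-- Push-forward of divisors of degree zero along a map of vertices. -/
noncomputable def pushDiv0 {W' : Type*} (f : W → W') : div0 k W →ₗ[k] div0 k W' :=
  (push k f).restrict (by
    intro d hd
    simp only [div0, LinearMap.mem_ker] at hd ⊢
    rw [degree_push, hd])

/-- The map on Jacobians induced by a map of vertices which respects the divisors `p_v`. -/
noncomputable def jacMap [Fintype E] {W' E' : Type*} [Fintype E'] (Y' : Multigraph W' E')
    (f : W → W') (hf : ∀ v, push k f (Y.firing k v) = Y'.firing k (f v)) :
    Y.Jac k →ₗ[k] Y'.Jac k :=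
  Submodule.mapQ _ _ (pushDiv0 k f) (by
    intro d hd
    have h : (Y.principal k) ≤ (Y'.principal k).comap (push k f) := by
      rw [principal, Submodule.span_le]
      rintro _ ⟨v, rfl⟩
      simp only [Submodule.comap_coe, Set.mem_preimage, SetLike.mem_coe]
      rw [hf]
      exact Submodule.subset_span ⟨_, rfl⟩
    exact h hd)

theorem firing_derived [Fintype E] {G : Type*} [AddCommGroup G] [Fintype G] (a : E → G)
    (v : W) (g : G) [DecidableEq W] :
    (Y.derived a).firing k (v, g) =
      ∑ e : E, ((if Y.src e = v then
          point k (v, g) - point k (Y.tgt e, g + a e) else 0) +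
        (if Y.tgt e = v then
          point k (v, g) - point k (Y.src e, g - a e) else 0)) := by
  classical
  rw [firing, Fintype.sum_prod_type]
  refine Finset.sum_congr rfl fun e _ => ?_
  rw [Finset.sum_add_distrib]
  congr 1
  · rw [Finset.sum_eq_single g]
    · simp [derived]
    · intro b _ hb
      simp [derived, hb]
    · simp
  · rw [Finset.sum_eq_single (g - a e)]
    · simp [derived]
    · intro b _ hb
      have : ¬ (b + a e = g) := fun h => hb (by rw [← h]; abel)
      simp [derived, this]
    · simp

theorem push_firing [Fintype E] {G G' : Type*} [AddCommGroup G] [Fintype G]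
    [AddCommGroup G'] [Fintype G'] (a : E → G) (a' : E → G') (φ : G → G')
    (hφ : ∀ g e, φ (g + a e) = φ g + a' e) (v : W × G) :
    push k (Prod.map id φ) ((Y.derived a).firing k v) =
      (Y.derived a').firing k (Prod.map id φ v) := by
  classical
  obtain ⟨v, g⟩ := v
  have hφ' : ∀ e, φ (g - a e) = φ g - a' e := fun e => by
    rw [eq_sub_iff_add_eq, ← hφ, sub_add_cancel]
  rw [Prod.map_apply, firing_derived, firing_derived, map_sum]
  refine Finset.sum_congr rfl fun e _ => ?_
  rw [map_add]
  simp only [id]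
  congr 1
  · split_ifs
    · rw [map_sub]
      simp [push_point, hφ]
    · exact map_zero _
  · split_ifs
    · rw [map_sub]
      simp [push_point, hφ']
    · exact map_zero _

end Basic

end Multigraph

namespace Iwasawa

section Algebra

variable (p : ℕ) [Fact p.Prime] (l : ℕ)

/-- The quotient `Γ / Γ^(p^m) = (ℤ/p^m)^l` of `Γ = ℤ_p^l`. -/
abbrev Level (m : ℕ) : Type := Fin l → ZMod (p ^ m)

/-- The transition map `(ℤ/p^(m+1))^l → (ℤ/p^m)^l`. -/
def proj (m : ℕ) : Level p l (m + 1) →+ Level p l m :=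
  (ZMod.castHom (pow_dvd_pow p (Nat.le_succ m)) (ZMod (p ^ m))).toAddMonoidHom.compLeft (Fin l)

variable {p l} in
/-- The reduction `ℤ_p^l → (ℤ/p^m)^l`. -/
noncomputable def red (m : ℕ) : (Fin l → ℤ_[p]) →+ Level p l m :=
  (PadicInt.toZModPow m).toAddMonoidHom.compLeft (Fin l)

theorem proj_red (m : ℕ) (x : Fin l → ℤ_[p]) : proj p l m (red (m + 1) x) = red m x := by
  funext i
  have := PadicInt.zmod_cast_comp_toZModPow (p := p) m (m + 1) (Nat.le_succ m)
  exact RingHom.congr_fun this (x i)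

/-- The compatible families in the product over `m` of the group rings `ℤ_p[Γ / Γ^(p^m)]`. -/
noncomputable def lamSubalgebra :
    Subalgebra ℤ_[p] (∀ m : ℕ, AddMonoidAlgebra ℤ_[p] (Level p l m)) where
  carrier := {a | ∀ m, AddMonoidAlgebra.mapDomainAlgHom ℤ_[p] ℤ_[p] (proj p l m) (a (m + 1)) = a m}
  mul_mem' := by
    intro a b ha hb m
    rw [Pi.mul_apply, map_mul, ha, hb, Pi.mul_apply]
  add_mem' := by
    intro a b ha hb m
    rw [Pi.add_apply, map_add, ha, hb, Pi.add_apply]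
  algebraMap_mem' := by
    intro r m
    rw [Pi.algebraMap_apply, AlgHom.commutes, Pi.algebraMap_apply]

/-- The Iwasawa algebra `Λ_l = ℤ_p⟦Γ⟧`, `Γ = ℤ_p^l`: the completed group ring, i.e. the inverse
limit over `m` of the group rings `ℤ_p[Γ / Γ^(p^m)]`. -/
def Lam : Type := lamSubalgebra p l

noncomputable instance : CommRing (Lam p l) := inferInstanceAs (CommRing (lamSubalgebra p l))

noncomputable instance : Algebra ℤ_[p] (Lam p l) :=
  inferInstanceAs (Algebra ℤ_[p] (lamSubalgebra p l))

variable {p l} in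
/-- The element `σ ∈ Γ`, seen in `ℤ_p⟦Γ⟧`. -/
noncomputable def ofGroup (σ : Fin l → ℤ_[p]) : Lam p l :=
  ⟨fun m => AddMonoidAlgebra.single (red m σ) 1, fun m => by
    simp [AddMonoidAlgebra.mapDomainAlgHom_apply, AddMonoidAlgebra.mapDomain_single, proj_red]⟩

end Algebra

section Modules

/-- A module is pseudo-null if it is annihilated by two relatively prime ring elements. -/
def IsPseudoNull (R M : Type*) [CommRing R] [AddCommGroup M] [Module R M] : Prop :=
  ∃ a b : R, IsRelPrime a b ∧ ∀ x : M, a • x = 0 ∧ b • x = 0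

/-- A pseudo-isomorphism: kernel and cokernel are pseudo-null. -/
def IsPseudoIso {R M N : Type*} [CommRing R] [AddCommGroup M] [Module R M] [AddCommGroup N]
    [Module R N] (φ : M →ₗ[R] N) : Prop :=
  IsPseudoNull R (LinearMap.ker φ) ∧ IsPseudoNull R (N ⧸ LinearMap.range φ)

/-- The data of an elementary module `⨁ᵢ R/(q^(eᵢ)) ⊕ ⨁ⱼ R/(gⱼ)` with all `gⱼ` coprime to `q`.
(It is used for `R = Λ_l` and `q = p`.) -/
structure Elementary (R : Type*) [CommRing R] (q : R) where
  s : ℕ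
  t : ℕ
  e : Fin s → ℕ
  g : Fin t → R
  coprime : ∀ j, IsRelPrime q (g j)

namespace Elementary

variable {R : Type*} [CommRing R] {q : R} (D : Elementary R q)

/-- The elementary module itself. -/
abbrev Carrier : Type _ :=
  (∀ i : Fin D.s, R ⧸ Ideal.span {q ^ D.e i}) × (∀ j : Fin D.t, R ⧸ Ideal.span {D.g j})

/-- `∑ eᵢ`. -/
def m0 : ℕ := ∑ i, D.e i

/-- `∏ gⱼ`, the part of the characteristic power series which is coprime to `q`. -/
def G : R := ∏ j, D.g j

/-- The characteristic power series `F = q^(∑ eᵢ) ∏ gⱼ`. -/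
def charSeries : R := q ^ D.m0 * D.G

end Elementary

open Classical in
/-- An elementary module pseudo-isomorphic to `A`. (The structure theory of Iwasawa modules provides
one for every finitely generated torsion module over `R = Λ_l`, with `q = p`; it is unique enough
for the invariants below to be independent of the choice.  The value in the remaining cases is
irrelevant.) -/
noncomputable def elementaryOf {R : Type*} [CommRing R] (q : R) (A : Type*) [AddCommGroup A]
    [Module R A] : Elementary R q :=
  if h : ∃ D : Elementary R q, ∃ φ : A →ₗ[R] D.Carrier, IsPseudoIso φ then h.choose
  else ⟨0, 0, Fin.elim0, Fin.elim0, fun j => j.elim0⟩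

/-- The `P`-adic valuation of a non-zero element `x`, for a principal prime ideal `P` of a
noetherian domain. -/
noncomputable def idealVal {R : Type*} [CommRing R] (P : Ideal R) (x : R) : ℕ :=
  sSup {n : ℕ | x ∈ P ^ n}

end Modules

section Invariants

variable (p : ℕ) [Fact p.Prime] (l : ℕ)

/-- The generalised Iwasawa invariant `m_0(A)`. -/
noncomputable def m0 (A : Type*) [AddCommGroup A] [Module (Lam p l) A] : ℕ :=
  (elementaryOf (p : Lam p l) A).m0

/-- The quotient `Λ/(p)`. -/
abbrev LamBar : Type := Lam p l ⧸ Ideal.span {(p : Lam p l)}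

/-- The prime ideals of `Λ/(p)` of the form `(σ - 1)` with `σ ∈ Γ ∖ Γ^p`. -/
def groupPrimes : Set (Ideal (LamBar p l)) :=
  {P | P.IsPrime ∧ ∃ σ : Fin l → ℤ_[p], (¬ ∃ τ : Fin l → ℤ_[p], σ = p • τ) ∧
    P = Ideal.span {Ideal.Quotient.mk _ (ofGroup σ - 1)}}

/-- The generalised Iwasawa invariant `l_0(A)`: the sum of the valuations of the class of `G_A` in
`Λ/(p)` at the primes of the form `(σ - 1)`, where `F_A = p^(m_0(A)) G_A`. -/
noncomputable def l0 (A : Type*) [AddCommGroup A] [Module (Lam p l) A] : ℕ :=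
  ∑ᶠ P ∈ groupPrimes p l,
    idealVal P (Ideal.Quotient.mk (Ideal.span {(p : Lam p l)}) (elementaryOf (p : Lam p l) A).G)

/-- The classical invariant `μ(A)` of a module over `ℤ_p⟦ℤ_p⟧`. -/
noncomputable def mu (A : Type*) [AddCommGroup A] [Module (Lam p 1) A] : ℕ := m0 p 1 A

/-- The classical invariant `λ(A)` of a module over `ℤ_p⟦ℤ_p⟧ = ℤ_p⟦T⟧`, where `T = γ - 1` for the
topological generator `γ = 1` of `ℤ_p`: the degree of the distinguished polynomial `P` for which
the characteristic power series of `A` is associated with `p^μ(A) P(T)`. -/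
noncomputable def lambda (A : Type*) [AddCommGroup A] [Module (Lam p 1) A] : ℕ :=
  sInf {d | ∃ P : Polynomial ℤ_[p], P.IsDistinguishedAt (Ideal.span {(p : ℤ_[p])}) ∧
    P.natDegree = d ∧
    Associated (elementaryOf (p : Lam p 1) A).charSeries
      ((p : Lam p 1) ^ mu p A * Polynomial.aeval (ofGroup (fun _ : Fin 1 => (1 : ℤ_[p])) - 1) P)}

end Invariants

end Iwasawa

namespace Multigraph

open Iwasawa

section Covers

variable {V S : Type*} [Fintype S] (X : Multigraph V S) {p : ℕ} [Fact p.Prime] {l : ℕ}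
  (α : S → Fin l → ℤ_[p])

/-- The `m`-th layer `X_m` of the `ℤ_p^l`-cover of `X` given by the voltage assignment `α`: the
derived graph of `α mod p^m`. -/
noncomputable abbrev layer (m : ℕ) : Multigraph (V × Level p l m) (S × Level p l m) :=
  X.derived (fun s => red m (α s))

/-- The natural map `J(X_(m+1)) → J(X_m)`. -/
noncomputable def transition (m : ℕ) :
    (X.layer α (m + 1)).Jac ℤ_[p] →ₗ[ℤ_[p]] (X.layer α m).Jac ℤ_[p] :=
  (X.layer α (m + 1)).jacMap ℤ_[p] (X.layer α m) (Prod.map id (proj p l m))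
    (X.push_firing ℤ_[p] _ _ _ fun _ _ => by rw [map_add, proj_red])

/-- The action of `h ∈ (ℤ/p^m)^l` on `J(X_m)`, induced by `(x, g) ↦ (x, h + g)`. -/
noncomputable def translate (m : ℕ) (h : Level p l m) :
    (X.layer α m).Jac ℤ_[p] →ₗ[ℤ_[p]] (X.layer α m).Jac ℤ_[p] :=
  (X.layer α m).jacMap ℤ_[p] (X.layer α m) (Prod.map id (h + ·))
    (X.push_firing ℤ_[p] _ _ _ fun _ _ => (add_assoc _ _ _).symm)

theorem jacMap_mk {W E W' E' : Type*} [Fintype E] [Fintype E'] (Y : Multigraph W E)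
    (Y' : Multigraph W' E') (f : W → W')
    (hf : ∀ v, push ℤ_[p] f (Y.firing ℤ_[p] v) = Y'.firing ℤ_[p] (f v)) (d : div0 ℤ_[p] W) :
    Y.jacMap ℤ_[p] Y' f hf (Submodule.Quotient.mk d) =
      Submodule.Quotient.mk (pushDiv0 ℤ_[p] f d) := rfl

theorem pushDiv0_comp {W W' W'' : Type*} (f : W → W') (g : W' → W'') (d : div0 ℤ_[p] W) :
    pushDiv0 ℤ_[p] g (pushDiv0 ℤ_[p] f d) = pushDiv0 ℤ_[p] (g ∘ f) d :=
  Subtype.ext (push_push ℤ_[p] f g d)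

theorem pushDiv0_id {W : Type*} (d : div0 ℤ_[p] W) : pushDiv0 ℤ_[p] (id : W → W) d = d :=
  Subtype.ext (push_id ℤ_[p] _)

/-- The action of the group ring `ℤ_p[(ℤ/p^m)^l]` on `J(X_m)`. -/
noncomputable def jacAction (m : ℕ) :
    AddMonoidAlgebra ℤ_[p] (Level p l m) →ₐ[ℤ_[p]] Module.End ℤ_[p] ((X.layer α m).Jac ℤ_[p]) :=
  AddMonoidAlgebra.lift ℤ_[p] _ (Level p l m)
    { toFun := fun h => X.translate α m h.toAdd
      map_one' := by
        ext x
        simp only [translate, toAdd_one, LinearMap.comp_apply, Submodule.mkQ_apply, jacMap_mk,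
          Module.End.one_apply]
        have h : (Prod.map id (0 + ·) : V × Level p l m → V × Level p l m) = id := by
          funext ⟨v, g⟩
          simp
        rw [h, pushDiv0_id]
      map_mul' := by
        intro h k
        ext x
        simp only [translate, toAdd_mul, LinearMap.comp_apply, Submodule.mkQ_apply, jacMap_mk,
          Module.End.mul_apply, pushDiv0_comp]
        have hk : (Prod.map id (h.toAdd + k.toAdd + ·) : V × Level p l m → V × Level p l m) =
            Prod.map id (h.toAdd + ·) ∘ Prod.map id (k.toAdd + ·) := by
          funext ⟨v, g⟩
          simp [add_assoc]
        rw [hk] }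

theorem transition_translate (m : ℕ) (h : Level p l (m + 1))
    (x : (X.layer α (m + 1)).Jac ℤ_[p]) :
    X.transition α m (X.translate α (m + 1) h x) =
      X.translate α m (proj p l m h) (X.transition α m x) := by
  obtain ⟨d, rfl⟩ := Submodule.Quotient.mk_surjective _ x
  simp only [translate, transition, jacMap_mk, pushDiv0_comp]
  have hc : (Prod.map id (proj p l m) ∘ Prod.map id (h + ·) :
      V × Level p l (m + 1) → V × Level p l m) =
      Prod.map id (proj p l m h + ·) ∘ Prod.map id (proj p l m) := by
    funext ⟨v, g⟩
    simp
  rw [hc]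

theorem transition_jacAction (m : ℕ) (a : AddMonoidAlgebra ℤ_[p] (Level p l (m + 1)))
    (x : (X.layer α (m + 1)).Jac ℤ_[p]) :
    X.transition α m (X.jacAction α (m + 1) a x) =
      X.jacAction α m (AddMonoidAlgebra.mapDomainAlgHom ℤ_[p] ℤ_[p] (proj p l m) a)
        (X.transition α m x) := by
  induction a using AddMonoidAlgebra.induction_on with
  | of h =>
    simp [jacAction, AddMonoidAlgebra.mapDomainAlgHom_apply, AddMonoidAlgebra.mapDomain_single,
      transition_translate]
  | add a b ha hb => simp only [map_add, LinearMap.add_apply, ha, hb]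
  | smul r a ha => simp only [map_smul, LinearMap.smul_apply, ha]

/-- The underlying group of the inverse limit of the `J(X_m)`. -/
noncomputable def jInfGroup : AddSubgroup (∀ m : ℕ, (X.layer α m).Jac ℤ_[p]) where
  carrier := {x | ∀ m, X.transition α m (x (m + 1)) = x m}
  zero_mem' := fun m => by simp
  add_mem' := by
    intro x y hx hy m
    rw [Pi.add_apply, map_add, hx, hy, Pi.add_apply]
  neg_mem' := by
    intro x hx m
    rw [Pi.neg_apply, map_neg, hx, Pi.neg_apply]

/-- The Iwasawa module `J_∞ = lim J(X_m)` of the `ℤ_p^l`-cover given by `α`. -/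
def JInf : Type _ := X.jInfGroup α

noncomputable instance : AddCommGroup (X.JInf α) :=
  inferInstanceAs (AddCommGroup (X.jInfGroup α))

/-- The action of `Λ = lim ℤ_p[(ℤ/p^m)^l]` on `lim J(X_m)`, layer by layer. -/
noncomputable instance : Module (Lam p l) (X.JInf α) where
  smul a x := ⟨fun m => X.jacAction α m (a.1 m) (x.1 m), fun m => by
    rw [transition_jacAction, a.2 m, x.2 m]⟩
  one_smul x := Subtype.ext <| funext fun m => by
    change X.jacAction α m 1 (x.1 m) = x.1 m
    rw [map_one, Module.End.one_apply]
  mul_smul a b x := Subtype.ext <| funext fun m => by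
    change X.jacAction α m (a.1 m * b.1 m) (x.1 m) = _
    rw [map_mul, Module.End.mul_apply]
    rfl
  smul_zero a := Subtype.ext <| funext fun m => map_zero (X.jacAction α m (a.1 m))
  smul_add a x y := Subtype.ext <| funext fun m =>
    map_add (X.jacAction α m (a.1 m)) (x.1 m) (y.1 m)
  add_smul a b x := Subtype.ext <| funext fun m => by
    change X.jacAction α m (a.1 m + b.1 m) (x.1 m) = _
    rw [map_add, LinearMap.add_apply]
    rfl
  zero_smul x := Subtype.ext <| funext fun m => by
    change X.jacAction α m 0 (x.1 m) = _
    rw [map_zero]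
    rfl

end Covers

/-- The `ℤ_p`-cover of `X` with voltage assignment `β` is contained in the `ℤ_p^2`-cover with
voltage assignment `α`: it is the quotient of that cover by the kernel of a surjective (and
necessarily `ℤ_p`-linear) homomorphism `π : ℤ_p^2 → ℤ_p`, i.e. `β = π ∘ α`. -/
def IsSubcover {S : Type*} {p : ℕ} [Fact p.Prime] (α : S → Fin 2 → ℤ_[p])
    (β : S → Fin 1 → ℤ_[p]) : Prop :=
  ∃ π : (Fin 2 → ℤ_[p]) →ₗ[ℤ_[p]] (Fin 1 → ℤ_[p]), Function.Surjective π ∧ ∀ s, β s = π (α s)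

end Multigraph

/-! Let `F` be the determinant of the voltage Laplacian `L` over `Λ_2` and `n` the number of
vertices of `X`. For a surjection `π`, the image of `F` in `Λ_1` is the determinant belonging to the
subcover given by `π` (`lamMap_lamDet`), so every subcover is controlled by the single power series
`F`.

Determinant and Jacobian determine each other up to harmless factors. By Cramer's rule `F` kills
`J_∞` (`lamDet_smul`). Conversely, if `c` kills `J_∞` then `c (σ - 1)` carries every basis vector
into the image of `L`, because `(σ - 1) v` is a divisor of degree zero; taking determinants, `F`
divides `(c (σ - 1))^n` (`exists_level_pow_eq_of_smul_eq_zero`, `dvd_of_forall_level`). Applied to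
the characteristic series up to relatively prime factors, this shows that for the subcovers `Y₁`,
`Y₂` the condition `μ = 0` forces `p ∤ π₁(F)` and `μ > 0` forces `p ∣ π₂(F)`. In particular `p ∤ F`,
while `F` lies in `(p, σ - 1)`, where `σ` generates the kernel of `π₂`.

For the unboundedness of `λ`, complete `σ` to a basis `σ, τ` and tilt the kernel: let `π_N` have
kernel generated by `σ - p^N τ`. It sends `σ` to `γ^(p^N)`, so modulo `p` the series `π_N(F)` is a
multiple of `(1 + T)^(p^N) - 1 = T^(p^N)`. The kernels give distinct principal primes of the
noetherian domain `Λ_2/p`, and the non-zero class of `F` lies in only finitely many of these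
(`finite_setOf_dvd_lamMap`). For the other `N`, comparison of `F` with the characteristic series
gives `p^N ≤ (λ + 1) n` (`le_card_mul_lambda`), which forces `λ` to grow.

For `l_0`, the condition `p ∤ π₁(F)` makes `F` regular in suitable coordinates, so Weierstrass
preparation factors it into primes of `Λ_2` (`exists_primes_of_not_dvd_lamMap`). One prime factor
`r` has `p ∣ π₂(r)`. It divides the characteristic series times `σ' - 1` for every `σ'`, hence the
characteristic series itself; it is not associated with `p`, so it divides `G`. Thus `G` lies in
`(p, σ - 1)` and its valuation there is positive (`dvd_lamMap_G`, `l0_pos_of_dvd_lamMap`).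

The invariants are read from a chosen elementary module, so the existence of a pseudo-isomorphism
has to be proved as well. It follows from a factorization of the annihilator `F` into primes, by
localizing away from these primes and using the structure theorem over the resulting principal ideal
domain. -/

/-! ### Localization at finitely many principal primes -/

section PrimeLocalization

variable {R : Type*} [CommRing R] [IsDomain R]

/-- The submonoid of non-zero elements which are divisible by none of the primes in `s`. -/
def awayFrom (s : Multiset R) (hs : ∀ p ∈ s, Prime p) : Submonoid R where
  carrier := {x | x ≠ 0 ∧ ∀ p ∈ s, ¬ p ∣ x}
  one_mem' := ⟨one_ne_zero, fun p hp h => (hs p hp).not_isUnit (isUnit_of_dvd_one h)⟩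
  mul_mem' := fun ha hb => ⟨mul_ne_zero ha.1 hb.1, fun p hp h =>
    ((hs p hp).dvd_or_dvd h).elim (ha.2 p hp) (hb.2 p hp)⟩

/-- If `d * e = p * t.prod` with `d ∣ x`, then `p` must divide `e` and can be cancelled, so primes
are removed one at a time; no unique factorization is needed. -/
theorem isRelPrime_prod_of_not_dvd {x : R} {t : Multiset R} (ht : ∀ p ∈ t, Prime p)
    (hx : ∀ p ∈ t, ¬ p ∣ x) : IsRelPrime x t.prod := by
  induction t using Multiset.induction_on with
  | empty => intro d _ hd; exact isUnit_of_dvd_one (by simpa using hd)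
  | cons p t ih =>
    have hp := ht p (Multiset.mem_cons_self p t)
    intro d hdx hd
    rw [Multiset.prod_cons] at hd
    obtain ⟨e, he⟩ := hd
    refine ih (fun q hq => ht q (Multiset.mem_cons_of_mem hq))
      (fun q hq => hx q (Multiset.mem_cons_of_mem hq)) hdx ?_
    rcases hp.dvd_or_dvd (Dvd.intro _ he : p ∣ d * e) with h | ⟨c, rfl⟩
    · exact absurd (h.trans hdx) (hx p (Multiset.mem_cons_self p t))
    · refine ⟨c, mul_left_cancel₀ hp.ne_zero ?_⟩
      rw [he]; ring

variable {s : Multiset R} (hs : ∀ p ∈ s, Prime p)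

theorem awayFrom_le_nonZeroDivisors : awayFrom s hs ≤ nonZeroDivisors R :=
  fun _ hx => mem_nonZeroDivisors_of_ne_zero hx.1

theorem exists_prod_mul_awayFrom [WfDvdMonoid R] {a : R} (ha : a ≠ 0) :
    ∃ t : Multiset R, (∀ p ∈ t, p ∈ s) ∧ ∃ b ∈ awayFrom s hs, a = t.prod * b := by
  induction a using (wellFounded_dvdNotUnit (α := R)).induction with
  | _ a ih =>
    by_cases h : ∀ p ∈ s, ¬ p ∣ a
    · exact ⟨0, by simp, a, ⟨ha, h⟩, by simp⟩
    · push Not at h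
      obtain ⟨p, hp, c, rfl⟩ := h
      have hc := right_ne_zero_of_mul ha
      obtain ⟨t, ht, b, hb, rfl⟩ := ih c ⟨hc, p, (hs p hp).not_isUnit, mul_comm _ _⟩ hc
      exact ⟨p ::ₘ t, by simpa [hp] using ht, b, hb, by simp [mul_assoc]⟩

variable (A : Type*) [CommRing A] [Algebra R A] [IsLocalization (awayFrom s hs) A]

include hs in
theorem prime_algebraMap_awayFrom {p : R} (hp : p ∈ s) : Prime (algebraMap R A p) := by
  have hp0 : algebraMap R A p ≠ 0 := by
    rw [Ne, IsLocalization.to_map_eq_zero_iff A (awayFrom_le_nonZeroDivisors hs)]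
    exact (hs p hp).ne_zero
  rw [← Ideal.span_singleton_prime hp0, ← Set.image_singleton, ← Ideal.map_span]
  refine IsLocalization.isPrime_of_isPrime_disjoint (awayFrom s hs) A _
    ((Ideal.span_singleton_prime (hs p hp).ne_zero).2 (hs p hp)) ?_
  rw [Set.disjoint_left]
  intro x hx hx'
  exact hx.2 p hp (Ideal.mem_span_singleton.1 hx')

include hs in
-- It suffices to treat prime ideals. A non-zero prime contains some `p ∈ s`, since the rest of any
-- numerator becomes a unit; prime avoidance then shows that `p` generates it.
theorem isPrincipalIdealRing_awayFrom [IsNoetherianRing R] : IsPrincipalIdealRing A := by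
  classical
  refine IsPrincipalIdealRing.of_prime fun P hP => ?_
  by_cases hP0 : P = ⊥
  · subst hP0; infer_instance
  obtain ⟨x, hx, hx0⟩ := Submodule.exists_mem_ne_zero_of_ne_bot hP0
  obtain ⟨⟨a, b⟩, hab⟩ := IsLocalization.surj (awayFrom s hs) x
  have haP : algebraMap R A a ∈ P := by rw [← hab]; exact P.mul_mem_right _ hx
  have ha0 : a ≠ 0 := by
    rintro rfl
    rw [map_zero] at hab
    exact hx0 ((IsUnit.mul_left_eq_zero (IsLocalization.map_units A b)).1 hab)
  have hunit : ∀ c ∈ awayFrom s hs, algebraMap R A c ∉ P := fun c hc h =>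
    hP.ne_top (P.eq_top_of_isUnit_mem h (IsLocalization.map_units A ⟨c, hc⟩))
  obtain ⟨t, ht, c, hc, rfl⟩ := exists_prod_mul_awayFrom hs ha0
  rw [map_mul] at haP
  have hprod := (hP.mem_or_mem haP).resolve_right (hunit c hc)
  rw [map_multiset_prod, Ideal.IsPrime.multiset_prod_mem_iff_exists_mem hP] at hprod
  obtain ⟨_, hp, hpP⟩ := hprod
  obtain ⟨p, hpt, rfl⟩ := Multiset.mem_map.1 hp
  have hps := ht p hpt
  refine ⟨algebraMap R A p, le_antisymm (fun y hy => ?_)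
    ((Ideal.span_singleton_le_iff_mem _).2 hpP)⟩
  obtain ⟨⟨d, e⟩, hde⟩ := IsLocalization.surj (awayFrom s hs) y
  have hdP : algebraMap R A d ∈ P := by rw [← hde]; exact P.mul_mem_right _ hy
  have hpd : p ∣ d := by
    by_contra hpd
    -- Adding `r * p` makes `d` avoid all of `s`. If `q ∣ d`, then `q` divides neither `r` (by
    -- choice of `r`) nor `p` (as `p ∤ d`); if `q ∤ d`, then `q ∣ r`. So `d + r * p` becomes a unit,
    -- yet it lies in `P`.
    set r := (s.filter (fun q => ¬ q ∣ d)).prod with hr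
    have hdr : d + r * p ∈ awayFrom s hs := by
      have key : ∀ q ∈ s, ¬ q ∣ d + r * p := by
        intro q hq hqd
        by_cases h : q ∣ d
        · rcases (hs q hq).dvd_or_dvd ((dvd_add_right h).1 hqd) with h' | h'
          · obtain ⟨u, hu, hqu⟩ := (hs q hq).exists_mem_multiset_dvd h'
            rw [Multiset.mem_filter] at hu
            exact hu.2 ((((hs q hq).associated_of_dvd (hs u hu.1) hqu).symm.dvd).trans h)
          · exact hpd ((((hs q hq).associated_of_dvd (hs p hps) h').symm.dvd).trans h)
        · refine h ((dvd_add_left ?_).1 hqd)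
          exact (Multiset.dvd_prod (Multiset.mem_filter.2 ⟨hq, h⟩)).mul_right _
      exact ⟨fun h => key p hps (h ▸ dvd_zero _), key⟩
    refine hunit _ hdr ?_
    rw [map_add, map_mul]
    exact P.add_mem hdP (P.mul_mem_left _ hpP)
  obtain ⟨w, rfl⟩ := hpd
  rw [Ideal.submodule_span_eq, Ideal.mem_span_singleton]
  refine (IsUnit.dvd_mul_right (IsLocalization.map_units A e)).1 ?_
  rw [hde, map_mul]
  exact Dvd.intro _ rfl

include hs in
theorem exists_associated_of_irreducible_awayFrom [IsNoetherianRing R] {q : A}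
    (hq : Irreducible q) : ∃ p ∈ s, Associated (algebraMap R A p) q := by
  have : IsDomain A := IsLocalization.isDomain_of_le_nonZeroDivisors A
    (awayFrom_le_nonZeroDivisors hs)
  have := isPrincipalIdealRing_awayFrom hs A
  obtain ⟨⟨a, b⟩, hab⟩ := IsLocalization.surj (awayFrom s hs) q
  have ha0 : a ≠ 0 := by
    rintro rfl
    rw [map_zero] at hab
    exact hq.ne_zero ((IsUnit.mul_left_eq_zero (IsLocalization.map_units A b)).1 hab)
  obtain ⟨t, ht, c, hc, rfl⟩ := exists_prod_mul_awayFrom hs ha0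
  have h : q ∣ algebraMap R A t.prod * algebraMap R A c := by
    rw [← map_mul, ← hab]; exact Dvd.intro _ rfl
  rw [IsUnit.dvd_mul_right (IsLocalization.map_units A ⟨c, hc⟩), map_multiset_prod] at h
  obtain ⟨_, hp, hqp⟩ := hq.prime.exists_mem_multiset_dvd h
  obtain ⟨p, hpt, rfl⟩ := Multiset.mem_map.1 hp
  exact ⟨p, ht p hpt, (hq.prime.associated_of_dvd
    (prime_algebraMap_awayFrom hs A (ht p hpt)) hqp).symm⟩

end PrimeLocalization

/-! ### Maps that become isomorphisms after localization -/

section Lift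

variable {R M N L : Type*} [CommRing R] [AddCommGroup M] [Module R M] [AddCommGroup N] [Module R N]
  [AddCommGroup L] [Module R L] {S : Submonoid R} (f : N →ₗ[R] L) (g : M →ₗ[R] L)
  [IsLocalizedModule S f] [IsLocalizedModule S g] {h : M →ₗ[R] N} {s : S}

omit [IsLocalizedModule S f] in
include f g in
-- With `f` and `g` localizing into the same `L`, the relation `f ∘ h = s • g` says that `h` becomes
-- a unit times the identity. Hence its kernel, and below its cokernel, is `S`-torsion.
theorem exists_smul_eq_zero_of_comp_eq (hf : f ∘ₗ h = s • g) {x : M} (hx : h x = 0) :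
    ∃ t ∈ S, t • x = 0 := by
  have h1 : g (s • x) = g 0 := by
    rw [LinearMap.map_smul_of_tower, ← LinearMap.smul_apply, ← hf]; simp [hx]
  obtain ⟨t, ht⟩ := IsLocalizedModule.exists_of_eq (S := S) (f := g) h1
  exact ⟨t * s, (t * s).2, by simpa [mul_smul, Submonoid.smul_def] using ht⟩

include f g in
theorem exists_smul_eq_apply_of_comp_eq (hf : f ∘ₗ h = s • g) (y : N) :
    ∃ t ∈ S, ∃ x, t • y = h x := by
  obtain ⟨⟨x, t⟩, ht⟩ := IsLocalizedModule.surj S g (f y)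
  have h1 : f ((s * t) • y) = f (h x) := by
    rw [LinearMap.map_smul_of_tower, mul_smul, ht, ← LinearMap.smul_apply, ← hf]; rfl
  obtain ⟨c, hc⟩ := IsLocalizedModule.exists_of_eq (S := S) (f := f) h1
  refine ⟨c * (s * t), (c * (s * t)).2, c • x, ?_⟩
  rw [LinearMap.map_smul_of_tower, ← hc, smul_smul]; rfl

theorem exists_smul_eq_zero_of_finite [Module.Finite R M] (H : ∀ x : M, ∃ t ∈ S, t • x = 0) :
    ∃ t ∈ S, ∀ x : M, t • x = 0 := by
  obtain ⟨G, hG⟩ := Module.Finite.fg_top (R := R) (M := M)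
  choose t htS ht using H
  refine ⟨∏ x ∈ G, t x, S.prod_mem fun x _ => htS x, fun x => ?_⟩
  have hx : x ∈ Submodule.span R (G : Set M) := hG ▸ Submodule.mem_top
  induction hx using Submodule.span_induction with
  | mem y hy =>
    obtain ⟨c, hc⟩ := Finset.dvd_prod_of_mem t (Finset.mem_coe.1 hy)
    rw [hc, mul_comm, mul_smul, ht, smul_zero]
  | zero => simp
  | add a b _ _ ha hb => rw [smul_add, ha, hb, add_zero]
  | smul r a _ ha => rw [smul_comm, ha, smul_zero]

end Lift

/-! ### The structure theorem up to pseudo-isomorphism -/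

section Elementary

open Iwasawa

variable {R : Type*} [CommRing R]

instance isLocalizedModule_piMap {ι : Type*} [Finite ι] {S : Submonoid R} {N L : ι → Type*}
    [∀ i, AddCommGroup (N i)] [∀ i, Module R (N i)] [∀ i, AddCommGroup (L i)]
    [∀ i, Module R (L i)] (f : ∀ i, N i →ₗ[R] L i) [∀ i, IsLocalizedModule S (f i)] :
    IsLocalizedModule S (LinearMap.pi fun i => f i ∘ₗ LinearMap.proj i :
      (∀ i, N i) →ₗ[R] ∀ i, L i) := by
  classical
  have := Fintype.ofFinite ι
  refine ⟨fun s => ?_, fun y => ?_, fun {x y} h => ?_⟩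
  · rw [Module.End.isUnit_iff]
    have H := fun i => (Module.End.isUnit_iff _).1 (IsLocalizedModule.map_units (f i) s)
    refine ⟨fun a b hab => funext fun i => (H i).1 (congrFun hab i), fun b => ?_⟩
    choose a ha using fun i => (H i).2 (b i)
    exact ⟨a, funext ha⟩
  · choose x hx using fun i => IsLocalizedModule.surj S (f i) (y i)
    refine ⟨⟨fun i => (∏ j ∈ Finset.univ.erase i, (x j).2) • (x i).1, ∏ j, (x j).2⟩,
      funext fun i => ?_⟩
    have := hx i
    simp only [Pi.smul_apply, LinearMap.pi_apply, LinearMap.comp_apply, LinearMap.proj_apply,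
      LinearMap.map_smul_of_tower]
    rw [← this, smul_smul, Finset.prod_erase_mul _ _ (Finset.mem_univ i)]
  · choose c hc using fun i =>
      IsLocalizedModule.exists_of_eq (S := S) (f := f i) (x₁ := x i) (x₂ := y i) (congrFun h i)
    refine ⟨∏ j, c j, funext fun i => ?_⟩
    rw [Pi.smul_apply, Pi.smul_apply, ← Finset.prod_erase_mul _ _ (Finset.mem_univ i), mul_smul,
      mul_smul, hc]

/-- A finitely generated module, killed by a product of primes, maps to a product of cyclic
modules of prime power order by an isomorphism up to elements divisible by none of the primes. -/
theorem exists_linearMap_pi_quotient [IsDomain R] [IsNoetherianRing R] {M : Type*}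
    [AddCommGroup M] [Module R M] [Module.Finite R M] {s : Multiset R} (hs : ∀ p ∈ s, Prime p)
    (hM : ∀ x : M, s.prod • x = 0) :
    ∃ (k : ℕ) (p : Fin k → R) (e : Fin k → ℕ) (h : M →ₗ[R] ∀ i, R ⧸ Ideal.span {p i ^ e i}),
      (∀ i, p i ∈ s) ∧ (∀ x, h x = 0 → ∃ t ∈ awayFrom s hs, t • x = 0) ∧
      ∀ y, ∃ t ∈ awayFrom s hs, ∃ x, t • y = h x := by
  classical
  set S := awayFrom s hs
  let A := Localization S
  have : IsDomain A := IsLocalization.isDomain_of_le_nonZeroDivisors A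
    (awayFrom_le_nonZeroDivisors hs)
  have : IsPrincipalIdealRing A := isPrincipalIdealRing_awayFrom hs A
  have hs0 : s.prod ≠ 0 := fun h0 => (hs 0 (Multiset.prod_eq_zero_iff.1 h0)).ne_zero rfl
  have htors : Module.IsTorsion A (LocalizedModule S M) := by
    intro x
    refine ⟨⟨algebraMap R A s.prod, mem_nonZeroDivisors_of_ne_zero ?_⟩, ?_⟩
    · rwa [Ne, IsLocalization.to_map_eq_zero_iff A (awayFrom_le_nonZeroDivisors hs)]
    · induction x using LocalizedModule.induction_on with
      | h m t =>
        rw [Submonoid.mk_smul, algebraMap_smul, LocalizedModule.smul'_mk, hM,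
          LocalizedModule.zero_mk]
  -- Over the principal ideal domain `A` the localized module is a sum of cyclic ones. Each
  -- irreducible `q i` is associated with some `p i ∈ s`, so every summand is the localization of `R
  -- ⧸ (p i ^ e i)`.
  obtain ⟨ι, _, q, hq, e, ⟨ψ⟩⟩ := Module.equiv_directSum_of_isTorsion htors
  choose p hps hpq using fun i => exists_associated_of_irreducible_awayFrom hs A (hq i)
  let loc := fun i => (Ideal.span {p i ^ e i}).toLocalizedQuotient' A S (Algebra.linearMap R A)
  have hloc : ∀ i, (Ideal.span {p i ^ e i}).localized' A S (Algebra.linearMap R A) =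
      Submodule.span A {q i ^ e i} := by
    intro i
    rw [Ideal.span, Submodule.localized'_span, Set.image_singleton, Algebra.linearMap_apply,
      map_pow]
    exact Ideal.span_singleton_eq_span_singleton.2 ((hpq i).pow_pow)
  let ε : Fin (Fintype.card ι) ≃ ι := (Fintype.equivFin ι).symm
  let θ : LocalizedModule S M ≃ₗ[A] ∀ j, A ⧸ (Ideal.span {p (ε j) ^ e (ε j)}).localized' A S
      (Algebra.linearMap R A) :=
    ψ ≪≫ₗ DirectSum.linearEquivFunOnFintype A ι _ ≪≫ₗ
      (LinearEquiv.piCongrRight fun i => Submodule.quotEquivOfEq _ _ (hloc i).symm) ≪≫ₗ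
      (LinearEquiv.piCongrLeft A (fun i => A ⧸ (Ideal.span {p i ^ e i}).localized' A S
        (Algebra.linearMap R A)) ε).symm
  let f : (∀ j, R ⧸ Ideal.span {p (ε j) ^ e (ε j)}) →ₗ[R] _ :=
    LinearMap.pi fun j => loc (ε j) ∘ₗ LinearMap.proj j
  let g : M →ₗ[R] _ := (θ.restrictScalars R).toLinearMap ∘ₗ LocalizedModule.mkLinearMap S M
  -- Finite presentation lets the localized isomorphism descend to a map over `R` after
  -- multiplication by one denominator `t`.
  have : Module.FinitePresentation R M := Module.finitePresentation_of_finite R M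
  obtain ⟨h, t, hh⟩ := Module.FinitePresentation.exists_lift_of_isLocalizedModule S f g
  exact ⟨_, fun j => p (ε j), fun j => e (ε j), h, fun j => hps _,
    fun x hx => exists_smul_eq_zero_of_comp_eq f g hh hx,
    fun y => exists_smul_eq_apply_of_comp_eq f g hh y⟩

/-- The two relatively prime annihilators are a common denominator, divisible by no prime of `s`,
and a product of primes from `s`. -/
theorem isPseudoNull_of_awayFrom [IsDomain R] {N : Type*} [AddCommGroup N] [Module R N]
    [Module.Finite R N] {s : Multiset R} (hs : ∀ p ∈ s, Prime p)
    (h1 : ∀ x : N, ∃ t ∈ awayFrom s hs, t • x = 0) {u : Multiset R} (hu : ∀ p ∈ u, p ∈ s)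
    (h2 : ∀ x : N, u.prod • x = 0) : IsPseudoNull R N := by
  obtain ⟨t, ht, htx⟩ := exists_smul_eq_zero_of_finite h1
  exact ⟨t, u.prod, isRelPrime_prod_of_not_dvd (fun p hp => hs p (hu p hp))
    fun p hp => ht.2 p (hu p hp), fun x => ⟨htx x, h2 x⟩⟩

/-- Each cyclic summand is filed either among the powers of `q` or among the factors coprime to `q`;
the other slot gets the zero module, as `R ⧸ (1)` or `R ⧸ (q ^ 0)`. Both lists of the elementary
data can then share one index set. -/
theorem exists_quotient_equiv_prod [IsDomain R] {q p : R} (hq : Prime q) (hp : Prime p) (e : ℕ) :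
    ∃ (e' : ℕ) (g : R), IsRelPrime q g ∧ Nonempty ((R ⧸ Ideal.span {p ^ e}) ≃ₗ[R]
      (R ⧸ Ideal.span {q ^ e'}) × (R ⧸ Ideal.span {g})) := by
  have htriv : Subsingleton (R ⧸ Ideal.span {(1 : R)}) :=
    Ideal.Quotient.subsingleton_iff.2 (by simp)
  have : Unique (R ⧸ Ideal.span {(1 : R)}) := uniqueOfSubsingleton 0
  by_cases h : Associated p q
  · refine ⟨e, 1, isRelPrime_one_right, ⟨?_⟩⟩
    have := Ideal.span_singleton_eq_span_singleton.2 (h.pow_pow (n := e))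
    rw [this]
    exact LinearEquiv.prodUnique.symm
  · refine ⟨0, p ^ e, ?_, ?_⟩
    · have hqp : ¬ q ∣ p := fun hd => h (hq.associated_of_dvd hp hd).symm
      have : ∀ d, d ∣ q → ¬ IsUnit d → Associated q d := fun d hd hu =>
        ((hq.irreducible.dvd_iff.1 hd).resolve_left hu)
      intro d hdq hdp
      by_contra hu
      exact hqp (hq.dvd_of_dvd_pow ((this d hdq hu).dvd.trans hdp))
    · rw [pow_zero]
      exact ⟨LinearEquiv.uniqueProd.symm⟩

/-- The structure theorem for finitely generated modules killed by a product of primes. -/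
theorem exists_elementary_isPseudoIso [IsDomain R] [IsNoetherianRing R] {q : R} (hq : Prime q)
    {M : Type*} [AddCommGroup M] [Module R M] [Module.Finite R M] {s : Multiset R}
    (hs : ∀ p ∈ s, Prime p) (hM : ∀ x : M, s.prod • x = 0) :
    ∃ D : Elementary R q, ∃ φ : M →ₗ[R] D.Carrier, IsPseudoIso φ := by
  obtain ⟨k, p, e, h, hps, h1, h2⟩ := exists_linearMap_pi_quotient hs hM
  choose e' g hg θ using fun i => exists_quotient_equiv_prod hq (hs _ (hps i)) (e i)
  let D : Elementary R q := ⟨k, k, e', g, hg⟩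
  let η : (∀ i, R ⧸ Ideal.span {p i ^ e i}) ≃ₗ[R] D.Carrier :=
    (LinearEquiv.piCongrRight fun i => (θ i).some) ≪≫ₗ
    { toFun := fun f => (fun i => (f i).1, fun i => (f i).2)
      invFun := fun f i => (f.1 i, f.2 i)
      map_add' := fun _ _ => rfl
      map_smul' := fun _ _ => rfl
      left_inv := fun _ => rfl
      right_inv := fun _ => rfl }
  have hfin : Module.Finite R D.Carrier := inferInstance
  -- The product of all `p i ^ e i` kills the target, hence the cokernel, and involves only primes
  -- from `s`.
  let u : Multiset R := ∑ i, Multiset.replicate (e i) (p i)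
  have hu : ∀ x ∈ u, x ∈ s := by
    intro x hx
    obtain ⟨i, -, hi⟩ := Multiset.mem_sum.1 hx
    rw [Multiset.eq_of_mem_replicate hi]
    exact hps i
  have hprod : u.prod = ∏ i, p i ^ e i := by
    simp [u, Multiset.prod_sum]
  have hukill : ∀ y : D.Carrier, u.prod • y = 0 := by
    intro y
    obtain ⟨z, rfl⟩ := η.surjective y
    rw [← map_smul, hprod]
    refine η.map_eq_zero_iff.2 (funext fun i => ?_)
    obtain ⟨r, hr⟩ := Ideal.Quotient.mk_surjective (z i)
    obtain ⟨c, hc⟩ := Finset.dvd_prod_of_mem (fun i => p i ^ e i) (Finset.mem_univ i)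
    rw [Pi.smul_apply, ← hr, hc, Pi.zero_apply]
    refine Ideal.Quotient.eq_zero_iff_mem.2 (Ideal.mem_span_singleton.2 ?_)
    exact (Dvd.intro _ rfl : _ ∣ p i ^ e i * c).mul_right r
  refine ⟨D, η.toLinearMap ∘ₗ h, ?_, ?_⟩
  · refine isPseudoNull_of_awayFrom hs (fun x => ?_) (fun _ h => h) fun x =>
      Subtype.ext (hM x.1)
    obtain ⟨t, ht, htx⟩ := h1 x.1 (η.map_eq_zero_iff.1 x.2)
    exact ⟨t, ht, Subtype.ext htx⟩
  · refine isPseudoNull_of_awayFrom hs (fun x => ?_) hu fun x => ?_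
    · obtain ⟨y, rfl⟩ := Submodule.Quotient.mk_surjective _ x
      obtain ⟨t, ht, z, hz⟩ := h2 (η.symm y)
      refine ⟨t, ht, (Submodule.Quotient.mk_eq_zero _).2 ⟨z, ?_⟩⟩
      rw [LinearMap.comp_apply, ← hz]
      simp
    · obtain ⟨y, rfl⟩ := Submodule.Quotient.mk_surjective _ x
      rw [← Submodule.Quotient.mk_smul, hukill, Submodule.Quotient.mk_zero]

theorem isPseudoIso_elementaryOf {q : R} {M : Type*} [AddCommGroup M] [Module R M]
    (h : ∃ D : Elementary R q, ∃ φ : M →ₗ[R] D.Carrier, IsPseudoIso φ) :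
    ∃ φ : M →ₗ[R] (elementaryOf q M).Carrier, IsPseudoIso φ := by
  rw [elementaryOf, dif_pos h]
  exact h.choose_spec

theorem Iwasawa.Elementary.charSeries_smul {q : R} (D : Elementary R q) (y : D.Carrier) :
    D.charSeries • y = 0 := by
  have key : ∀ (a : R) (z : R ⧸ Ideal.span {a}), a ∣ D.charSeries → D.charSeries • z = 0 := by
    intro a z ha
    obtain ⟨r, rfl⟩ := Ideal.Quotient.mk_surjective z
    exact Ideal.Quotient.eq_zero_iff_mem.2 (Ideal.mem_span_singleton.2 (ha.mul_right r))
  refine Prod.ext (funext fun i => key _ _ ?_) (funext fun j => key _ _ ?_)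
  · exact (pow_dvd_pow q (Finset.single_le_sum (fun _ _ => Nat.zero_le _)
      (Finset.mem_univ i))).mul_right _
  · exact (Finset.dvd_prod_of_mem D.g (Finset.mem_univ j)).mul_left _

/-- The characteristic series kills the module up to relatively prime factors. -/
theorem exists_charSeries_mul_smul {q : R} {D : Elementary R q} {M : Type*} [AddCommGroup M]
    [Module R M] {φ : M →ₗ[R] D.Carrier} (hφ : IsPseudoIso φ) :
    ∃ a b : R, IsRelPrime a b ∧
      ∀ x : M, (D.charSeries * a) • x = 0 ∧ (D.charSeries * b) • x = 0 := by
  obtain ⟨⟨a, b, hab, h⟩, -⟩ := hφ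
  refine ⟨a, b, hab, fun x => ?_⟩
  have hx : D.charSeries • x ∈ LinearMap.ker φ := by
    rw [LinearMap.mem_ker, map_smul, D.charSeries_smul]
  have := h ⟨_, hx⟩
  rw [mul_comm, mul_smul, mul_comm, mul_smul]
  exact ⟨congrArg Subtype.val this.1, congrArg Subtype.val this.2⟩

/-- If `a` kills the cokernel, then `a` times the `i`-th generator lies in the image, which is
killed by `c`; so `c * a` vanishes in `R ⧸ (q ^ e i)`. -/
theorem exists_relPrime_pow_dvd {q : R} {D : Elementary R q} {M : Type*} [AddCommGroup M]
    [Module R M] {φ : M →ₗ[R] D.Carrier} (hφ : IsPseudoIso φ) {c : R} (hc : ∀ x : M, c • x = 0) :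
    ∃ a b : R, IsRelPrime a b ∧ ∀ i, q ^ D.e i ∣ c * a ∧ q ^ D.e i ∣ c * b := by
  classical
  obtain ⟨-, a, b, hab, h⟩ := hφ
  have key : ∀ a : R, (∀ x : D.Carrier ⧸ LinearMap.range φ, a • x = 0) → ∀ i,
      q ^ D.e i ∣ c * a := by
    intro a ha i
    let y : D.Carrier := (Pi.single i (Ideal.Quotient.mk _ 1), 0)
    obtain ⟨x, hx⟩ := (Submodule.Quotient.mk_eq_zero _).1 (ha (Submodule.Quotient.mk y))
    have hx : φ x = a • y := hx
    have h0 : (c * a) • y = 0 := by rw [mul_smul, ← hx, ← map_smul, hc, map_zero]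
    have h1 := congrFun (congrArg Prod.fst h0) i
    simp only [y, Prod.smul_fst, Pi.smul_apply, Pi.single_eq_same, Prod.fst_zero,
      Pi.zero_apply] at h1
    have h2 : Ideal.Quotient.mk (Ideal.span {q ^ D.e i}) ((c * a) * 1) = 0 := h1
    rw [mul_one, Ideal.Quotient.eq_zero_iff_mem, Ideal.mem_span_singleton] at h2
    exact h2
  exact ⟨a, b, hab, fun i => ⟨key a (fun x => (h x).1) i, key b (fun x => (h x).2) i⟩⟩

end Elementary

/-! ### Principal primes and valuations in noetherian domains -/

section PrincipalPrimes

variable {R : Type*} [CommRing R] [IsDomain R] [IsNoetherianRing R]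

/-- A prime inside `(p)` that does not contain `p` lies in every power of `(p)`, so it is zero by
Krull's intersection theorem. -/
theorem mem_minimalPrimes_of_prime {p x : R} (hp : Prime p) (hx : x ≠ 0) (hpx : p ∣ x) :
    Ideal.span {p} ∈ (Ideal.span {x}).minimalPrimes := by
  have hP := (Ideal.span_singleton_prime hp.ne_zero).2 hp
  refine ⟨⟨hP, Ideal.span_singleton_le_span_singleton.2 hpx⟩, fun Q hQ hQP => ?_⟩
  obtain ⟨hQ, hxQ⟩ := hQ
  have hxQ := (Ideal.span_singleton_le_iff_mem _).1 hxQ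
  rw [Ideal.span_singleton_le_iff_mem]
  by_contra hpQ
  refine hx ?_
  have : ∀ n, ∀ y ∈ Q, y ∈ Ideal.span {p} ^ n := by
    intro n
    induction n with
    | zero => simp
    | succ n ih =>
      intro y hy
      obtain ⟨z, rfl⟩ := Ideal.mem_span_singleton.1 (hQP hy)
      rw [pow_succ']
      exact Ideal.mul_mem_mul (Ideal.mem_span_singleton_self p)
        (ih z ((hQ.mem_or_mem hy).resolve_left hpQ))
  have h := Ideal.iInf_pow_eq_bot_of_isDomain _ hP.ne_top
  rw [← Ideal.mem_bot, ← h, Ideal.mem_iInf]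
  exact fun n => this n x hxQ

/-- All these primes are minimal over `(x)`, and a noetherian ring has only finitely many minimal
primes over an ideal. -/
theorem finite_principal_primes {x : R} (hx : x ≠ 0) :
    {P : Ideal R | P.IsPrime ∧ (∃ p, P = Ideal.span {p}) ∧ x ∈ P}.Finite := by
  refine (Ideal.finite_minimalPrimes_of_isNoetherianRing R (Ideal.span {x})).subset ?_
  rintro _ ⟨hP, ⟨p, rfl⟩, hxP⟩
  have hpx := Ideal.mem_span_singleton.1 hxP
  have hp0 : p ≠ 0 := by rintro rfl; exact hx (zero_dvd_iff.1 hpx)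
  exact mem_minimalPrimes_of_prime ((Ideal.span_singleton_prime hp0).1 hP) hx hpx

/-- Krull's intersection theorem bounds the exponents. This matters because `sSup` of an unbounded
set of naturals is `0`. -/
theorem idealVal_pos {P : Ideal R} (hP : P ≠ ⊤) {x : R} (hx : x ≠ 0) (hxP : x ∈ P) :
    0 < Iwasawa.idealVal P x := by
  have h := Ideal.iInf_pow_eq_bot_of_isDomain P hP
  have : ∃ n, x ∉ P ^ n := by
    by_contra! hn
    exact hx (by rw [← Ideal.mem_bot, ← h, Ideal.mem_iInf]; exact hn)
  obtain ⟨n, hn⟩ := this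
  have hb : BddAbove {n : ℕ | x ∈ P ^ n} := ⟨n, fun m hm => by
    by_contra! hlt
    exact hn (Ideal.pow_le_pow_right hlt.le hm)⟩
  exact Nat.one_le_iff_ne_zero.1 (le_csSup hb (by simpa using hxP)) |> Nat.pos_of_ne_zero

omit [IsDomain R] [IsNoetherianRing R] in
theorem mem_of_idealVal_ne_zero {P : Ideal R} {x : R} (h : Iwasawa.idealVal P x ≠ 0) : x ∈ P := by
  by_contra hx
  refine h ?_
  have : {n : ℕ | x ∈ P ^ n} = {0} := by
    ext n
    rcases n with _ | n
    · simp
    · simp only [Set.mem_ofPred_eq, Set.mem_singleton_iff, Nat.succ_ne_zero, iff_false]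
      exact fun hn => hx (Ideal.pow_le_self (Nat.succ_ne_zero n) hn)
  rw [Iwasawa.idealVal, this, csSup_singleton]

end PrincipalPrimes

/-! ### Compact noetherian local rings as inverse limits -/

section CompactLocal

variable {R : Type*} [CommRing R] [IsNoetherianRing R]

/-- Ideals are closed here, so the cosets `f n + 𝔪 ^ n` of a Cauchy sequence form a decreasing chain
of non-empty compact sets and share a point. Separatedness is Krull's intersection theorem. -/
theorem isAdicComplete_of_compactSpace [TopologicalSpace R] [IsTopologicalRing R] [CompactSpace R]
    [T2Space R] [IsLocalRing R] :
    IsAdicComplete (IsLocalRing.maximalIdeal R) R where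
  haus' x hx := by
    have h := Ideal.iInf_pow_eq_bot_of_isLocalRing (IsLocalRing.maximalIdeal R)
      Ideal.IsPrime.ne_top'
    rw [← Ideal.mem_bot, ← h, Ideal.mem_iInf]
    intro n
    simpa [SModEq.sub_mem] using hx n
  prec' f hf := by
    have hf' : ∀ {m n}, m ≤ n → f m - f n ∈ IsLocalRing.maximalIdeal R ^ m := fun h => by
      simpa [SModEq.sub_mem] using hf h
    let t : ℕ → Set R := fun n => {x | f n - x ∈ IsLocalRing.maximalIdeal R ^ n}
    have hcl : ∀ n, IsClosed (t n) := fun n =>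
      (IsNoetherianRing.isClosed_ideal (IsLocalRing.maximalIdeal R ^ n)).preimage
        (continuous_const.sub continuous_id)
    obtain ⟨L, hL⟩ := IsCompact.nonempty_iInter_of_sequence_nonempty_isCompact_isClosed t
      (fun n x hx => by
        have := Ideal.add_mem _ (hf' n.le_succ) (Ideal.pow_le_pow_right n.le_succ hx)
        simpa [t] using this)
      (fun n => ⟨f n, by simp [t]⟩) (hcl 0).isCompact hcl
    refine ⟨L, fun n => ?_⟩
    have := Set.mem_iInter.1 hL n
    simpa [SModEq.sub_mem, t] using this

/-- A compatible family of surjections from a compact noetherian local ring, with kernels in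
the powers of the maximal ideal, identifies the ring with the inverse limit. -/
theorem existsUnique_of_compatible [TopologicalSpace R] [IsTopologicalRing R] [CompactSpace R]
    [T2Space R] [IsLocalRing R] {B : ℕ → Type*} [∀ m, CommRing (B m)]
    (τ : ∀ m, B (m + 1) →+* B m) (φ : ∀ m, R →+* B m) (hφ : ∀ m, (τ m).comp (φ (m + 1)) = φ m)
    (hsurj : ∀ m, Function.Surjective (φ m))
    (hker : ∀ m, RingHom.ker (φ m) ≤ IsLocalRing.maximalIdeal R ^ m)
    (b : ∀ m, B m) (hb : ∀ m, τ m (b (m + 1)) = b m) : ∃! r, ∀ m, φ m r = b m := by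
  let t : ℕ → Set R := fun m => {x | φ m x = b m}
  have hcl : ∀ m, IsClosed (t m) := by
    intro m
    obtain ⟨y, hy⟩ := hsurj m (b m)
    have : t m = (fun x => x - y) ⁻¹' (RingHom.ker (φ m) : Set R) := by
      ext x
      simp [t, RingHom.mem_ker, sub_eq_zero, hy]
    rw [this]
    exact (IsNoetherianRing.isClosed_ideal _).preimage (continuous_id.sub continuous_const)
  obtain ⟨L, hL⟩ := IsCompact.nonempty_iInter_of_sequence_nonempty_isCompact_isClosed t
    (fun m x hx => by
      change φ m x = b m
      rw [← hφ, ← hb, RingHom.comp_apply, show φ (m + 1) x = _ from hx])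
    (fun m => hsurj m (b m)) (hcl 0).isCompact hcl
  have hL : ∀ m, φ m L = b m := fun m => Set.mem_iInter.1 hL m
  refine ⟨L, hL, fun x hx => ?_⟩
  have h := Ideal.iInf_pow_eq_bot_of_isLocalRing (IsLocalRing.maximalIdeal R)
    Ideal.IsPrime.ne_top'
  rw [← sub_eq_zero, ← Ideal.mem_bot, ← h, Ideal.mem_iInf]
  intro m
  refine hker m ?_
  rw [RingHom.mem_ker, map_sub, hx, hL, sub_self]

omit [IsNoetherianRing R] in
-- Passing from `m` to `m + 1` multiplies by a sum of `p` terms congruent to `1` modulo `J`; this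
-- sum is congruent to `p`, hence lies in `J`.
theorem one_add_pow_sub_one_mem {J : Ideal R} {p : ℕ} (hp : (p : R) ∈ J) {T : R} (hT : T ∈ J)
    (m : ℕ) : (1 + T) ^ p ^ m - 1 ∈ J ^ (m + 1) := by
  induction m with
  | zero => simpa using hT
  | succ m ih =>
    have h1 : (1 + T) ^ p ^ m - 1 ∈ J := by
      simpa using Ideal.pow_le_pow_right (Nat.le_add_left 1 m) ih
    have h2 : ∑ i ∈ Finset.range p, ((1 + T) ^ p ^ m) ^ i ∈ J := by
      rw [← Ideal.Quotient.eq_zero_iff_mem, map_sum]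
      have h3 : Ideal.Quotient.mk J ((1 + T) ^ p ^ m) = 1 := by
        rw [← sub_eq_zero, ← map_one (Ideal.Quotient.mk J), ← map_sub]
        exact Ideal.Quotient.eq_zero_iff_mem.2 h1
      simp only [map_pow (Ideal.Quotient.mk J) _ _] at h3 ⊢
      simp only [h3, one_pow, Finset.sum_const, Finset.card_range, nsmul_eq_mul, mul_one]
      rw [← map_natCast (Ideal.Quotient.mk J)]
      exact Ideal.Quotient.eq_zero_iff_mem.2 hp
    rw [pow_succ p, pow_mul, ← geom_sum_mul, pow_succ' J]
    exact Ideal.mul_mem_mul h2 ih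

end CompactLocal

/-! ### Group rings of `ℤ/p^m` as quotients of power series rings -/

section GroupRing

open Polynomial

variable {A : Type*} [CommRing A]

/-- The intermediate binomial coefficients of `p ^ m` are divisible by `p`. Distinguishedness makes
Weierstrass division by this polynomial available. -/
theorem one_add_X_pow_sub_one_isDistinguishedAt [Nontrivial A] {I : Ideal A} {p : ℕ} [Fact p.Prime]
    (hp : (p : A) ∈ I) (m : ℕ) :
    ((1 + X) ^ p ^ m - 1 : A[X]).IsDistinguishedAt I := by
  have hpos : 0 < p ^ m := pow_pos (Fact.out : p.Prime).pos m
  have hmon : ((1 + X) ^ p ^ m : A[X]).Monic := by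
    rw [add_comm]; exact (monic_X_add_C (1 : A)).pow _
  have hdeg : ((1 + X) ^ p ^ m : A[X]).natDegree = p ^ m := by
    rw [add_comm]
    exact (natDegree_pow_X_add_C _ (1 : A))
  have hlt : degree (1 : A[X]) < degree ((1 + X) ^ p ^ m : A[X]) := by
    rw [degree_one, degree_eq_natDegree hmon.ne_zero, hdeg]
    exact_mod_cast hpos
  have hd : ((1 + X) ^ p ^ m - 1 : A[X]).natDegree = p ^ m := by
    rw [natDegree_eq_of_degree_eq (degree_sub_eq_left_of_degree_lt hlt), hdeg]
  refine ⟨⟨fun {n} hn => ?_⟩, hmon.sub_of_left hlt⟩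
  rw [hd] at hn
  rw [coeff_sub, coeff_one_add_X_pow, coeff_one]
  rcases Nat.eq_zero_or_pos n with rfl | h0
  · simp
  · rw [if_neg (by omega), sub_zero]
    have : p ∣ (p ^ m).choose n := by
      rcases Nat.eq_zero_or_pos m with rfl | hm
      · simp at hn; omega
      · exact (Fact.out : p.Prime).dvd_choose_pow h0.ne' hn.ne
    obtain ⟨c, hc⟩ := this
    rw [hc, Nat.cast_mul]
    exact I.mul_mem_right _ hp

theorem aeval_single_one_apply {q : ℕ} [NeZero q] {f : A[X]} (hf : f.natDegree < q) {i : ℕ}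
    (hi : i < q) :
    (aeval (AddMonoidAlgebra.single (1 : ZMod q) (1 : A)) f).coeff (i : ZMod q) = f.coeff i := by
  rw [aeval_eq_sum_range' hf]
  simp only [AddMonoidAlgebra.single_pow, one_pow, AddMonoidAlgebra.coeff_sum,
    AddMonoidAlgebra.coeff_smul, Finsupp.finsetSum_apply, Finsupp.smul_apply,
    AddMonoidAlgebra.coeff_single, nsmul_eq_mul, mul_one]
  rw [Finset.sum_eq_single i]
  · simp
  · intro j hj hji
    have : (j : ZMod q) ≠ i := by
      rw [Ne, ZMod.natCast_eq_natCast_iff', Nat.mod_eq_of_lt (Finset.mem_range.1 hj),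
        Nat.mod_eq_of_lt hi]
      exact hji
    rw [Finsupp.single_eq_of_ne this.symm, smul_zero]
  · intro h; exact absurd (Finset.mem_range.2 hi) h

/-- After the substitution `X ↦ X - 1`, which keeps the degree below `q`, distinct exponents are
distinct group elements, so the coefficients can be read off. -/
theorem aeval_single_sub_one_eq_zero {q : ℕ} [NeZero q] {f : A[X]} (hf : f.natDegree < q)
    (h : aeval (AddMonoidAlgebra.single (1 : ZMod q) (1 : A) - 1) f = 0) : f = 0 := by
  have h1 : f.comp (X - C 1) = 0 := by
    have hd : (f.comp (X - C 1)).natDegree < q := by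
      refine (natDegree_comp_le.trans ?_).trans_lt hf
      exact (Nat.mul_le_mul_left _ (natDegree_X_sub_C_le 1)).trans (mul_one _).le
    ext i
    by_cases hi : i < q
    · rw [← aeval_single_one_apply hd hi, aeval_comp]
      simp [h]
    · rw [coeff_eq_zero_of_natDegree_lt (by omega), coeff_zero]
  have h2 : (f.comp (X - C 1)).comp (X + C 1) = f := by
    rw [comp_assoc]; simp
  rw [← h2, h1, zero_comp]

/-- The power series ring over a `p`-adically complete ring maps onto the group ring of `ℤ/p^m`,
with kernel generated by `(1 + T)^(p^m) - 1`. -/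
theorem exists_ringHom_groupRing {I : Ideal A} [IsAdicComplete I A] [Nontrivial A] {p : ℕ}
    [Fact p.Prime] (hp : (p : A) ∈ I) (m : ℕ) :
    ∃ u : PowerSeries A →+* AddMonoidAlgebra A (ZMod (p ^ m)),
      (∀ a, u (PowerSeries.C a) = AddMonoidAlgebra.single 0 a) ∧
      u PowerSeries.X = AddMonoidAlgebra.single 1 1 - 1 ∧ Function.Surjective u ∧
      RingHom.ker u = Ideal.span {(1 + PowerSeries.X) ^ p ^ m - 1} := by
  set q := p ^ m with hq
  have : NeZero q := ⟨pow_ne_zero _ (Fact.out : p.Prime).ne_zero⟩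
  set g : A[X] := (1 + X) ^ q - 1 with hg
  have H : g.IsDistinguishedAt I := one_add_X_pow_sub_one_isDistinguishedAt hp m
  have hdeg : g.natDegree = q := by
    have h1 : ((1 + X) ^ q : A[X]).natDegree = q := by
      rw [add_comm]; exact (natDegree_pow_X_add_C _ (1 : A))
    rw [hg, natDegree_sub_eq_left_of_natDegree_lt, h1]
    rw [h1, natDegree_one]; exact Nat.pos_of_neZero q
  have hcoe : (g : PowerSeries A) = (1 + PowerSeries.X) ^ q - 1 := by simp [hg]
  let w : A[X] →ₐ[A] AddMonoidAlgebra A (ZMod q) :=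
    aeval (AddMonoidAlgebra.single (1 : ZMod q) (1 : A) - 1)
  have hone : ∀ k : ℕ, (AddMonoidAlgebra.single (1 : ZMod q) (1 : A)) ^ k =
      AddMonoidAlgebra.single (k : ZMod q) 1 := fun k => by
    rw [AddMonoidAlgebra.single_pow, one_pow, nsmul_one]
  have hwg : w g = 0 := by
    simp only [w, hg, map_sub, map_pow, map_add, map_one, aeval_X, add_sub_cancel, hone]
    rw [ZMod.natCast_self, AddMonoidAlgebra.one_def, sub_self]
  have hw : ∀ a ∈ Ideal.span {g}, w a = 0 := by
    intro a ha
    obtain ⟨c, rfl⟩ := Ideal.mem_span_singleton.1 ha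
    rw [map_mul, hwg, zero_mul]
  let w' := Ideal.Quotient.liftₐ (Ideal.span {g}) w hw
  have hinj : Function.Injective w' := by
    rw [injective_iff_map_eq_zero]
    intro x hx
    obtain ⟨f, rfl⟩ := Ideal.Quotient.mk_surjective x
    have hx : w f = 0 := hx
    -- The remainder modulo `g` has degree below `q`, where evaluation at `γ - 1` is injective.
    have hr : w (f %ₘ g) = 0 := by
      rw [modByMonic_eq_sub_mul_div, map_sub, map_mul, hwg, hx, zero_mul, sub_zero]
    have hgne : g ≠ 1 := fun h => by
      rw [h, natDegree_one] at hdeg; exact NeZero.ne q hdeg.symm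
    have h0 := aeval_single_sub_one_eq_zero
      (hdeg ▸ natDegree_modByMonic_lt f H.monic hgne) hr
    rw [Ideal.Quotient.eq_zero_iff_mem, Ideal.mem_span_singleton]
    exact (modByMonic_eq_zero_iff_dvd H.monic).1 h0
  have hwsurj : Function.Surjective w := by
    intro x
    induction x using AddMonoidAlgebra.induction_on with
    | of k =>
      refine ⟨(1 + X) ^ (ZMod.val (k : ZMod q)), ?_⟩
      simp only [w, map_pow, map_add, map_one, aeval_X, add_sub_cancel, hone]
      simp
    | add a b ha hb =>
      obtain ⟨a, rfl⟩ := ha; obtain ⟨b, rfl⟩ := hb; exact ⟨a + b, map_add _ _ _⟩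
    | smul r a ha => obtain ⟨a, rfl⟩ := ha; exact ⟨r • a, map_smul _ _ _⟩
  have hsymm : ∀ f : A[X], H.algEquivQuotient.symm (Ideal.Quotient.mk _ (f : PowerSeries A)) =
      Ideal.Quotient.mk _ f := by
    intro f
    rw [AlgEquiv.symm_apply_eq]
    simp [Polynomial.IsDistinguishedAt.algEquivQuotient_apply]
  -- As `g` is distinguished, `A⟦X⟧/(g) = A[X]/(g)`; this extends evaluation of polynomials at `γ -
  -- 1` to power series without any topology.
  let u : PowerSeries A →ₐ[A] AddMonoidAlgebra A (ZMod q) :=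
    (w'.comp H.algEquivQuotient.symm.toAlgHom).comp (Ideal.Quotient.mkₐ A _)
  have huf : ∀ f : A[X], u (f : PowerSeries A) = w f := by
    intro f
    change w' (H.algEquivQuotient.symm (Ideal.Quotient.mk _ (f : PowerSeries A))) = w f
    rw [hsymm]; rfl
  refine ⟨u.toRingHom, fun a => u.commutes a, ?_, fun x => ?_, ?_⟩
  · change u _ = _
    rw [← Polynomial.coe_X, huf, aeval_X]
  · obtain ⟨f, rfl⟩ := hwsurj x
    exact ⟨f, huf f⟩
  · ext x
    rw [RingHom.mem_ker, ← hcoe, ← Ideal.Quotient.eq_zero_iff_mem]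
    change w' (H.algEquivQuotient.symm (Ideal.Quotient.mk _ x)) = 0 ↔ _
    rw [map_eq_zero_iff _ hinj, EmbeddingLike.map_eq_zero_iff]

/-- Homomorphisms from the power series ring killing `(1 + T)^(p^m) - 1` are determined by their
values on constants and on `T`. -/
theorem powerSeries_ringHom_ext_of_pow_sub_one {I : Ideal A} [IsAdicComplete I A] [Nontrivial A]
    {p : ℕ} [Fact p.Prime] (hp : (p : A) ∈ I) (m : ℕ) {B : Type*} [CommRing B]
    {u v : PowerSeries A →+* B} (hC : ∀ a, u (PowerSeries.C a) = v (PowerSeries.C a))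
    (hX : u PowerSeries.X = v PowerSeries.X) (hu : u ((1 + PowerSeries.X) ^ p ^ m - 1) = 0) :
    u = v := by
  have H := one_add_X_pow_sub_one_isDistinguishedAt hp m
  have hv : v ((1 + PowerSeries.X) ^ p ^ m - 1) = 0 := by
    rw [← hu]; simp [hX]
  have hpoly : ∀ f : A[X], u (f : PowerSeries A) = v (f : PowerSeries A) := by
    intro f
    induction f using Polynomial.induction_on' with
    | add a b ha hb => simp [ha, hb]
    | monomial n a =>
      rw [← C_mul_X_pow_eq_monomial]
      simp [hC, hX]
  ext x
  -- Modulo the distinguished polynomial every power series is a polynomial, and on polynomials `u`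
  -- and `v` agree.
  obtain ⟨y, hy⟩ := H.algEquivQuotient.surjective (Ideal.Quotient.mk _ x)
  obtain ⟨f, rfl⟩ := Ideal.Quotient.mk_surjective y
  have h : x - (f : PowerSeries A) ∈ Ideal.span {((1 + PowerSeries.X) ^ p ^ m - 1 :
      PowerSeries A)} := by
    rw [← Ideal.Quotient.eq_zero_iff_mem, map_sub, sub_eq_zero]
    have hcoe : (((1 + X) ^ p ^ m - 1 : A[X]) : PowerSeries A) =
        (1 + PowerSeries.X) ^ p ^ m - 1 := by simp
    rw [← hcoe, ← hy, Polynomial.IsDistinguishedAt.algEquivQuotient_apply]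
    simp
  obtain ⟨c, hc⟩ := Ideal.mem_span_singleton.1 h
  rw [eq_add_of_sub_eq hc]
  rw [map_add, map_add, map_mul, map_mul, hu, hv, hpoly, zero_mul, zero_mul]

end GroupRing

/-! ### Serre's isomorphisms for `Λ_1` and `Λ_2` -/

section IwasawaAlgebra

open Iwasawa

variable (p : ℕ) [Fact p.Prime]

variable {p} in
/-- The projection of the Iwasawa algebra to the group ring of level `m`. -/
noncomputable def Iwasawa.level {l : ℕ} (m : ℕ) :
    Lam p l →ₐ[ℤ_[p]] AddMonoidAlgebra ℤ_[p] (Level p l m) :=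
  (Pi.evalAlgHom ℤ_[p] (fun m => AddMonoidAlgebra ℤ_[p] (Level p l m)) m).comp
    (lamSubalgebra p l).val

variable {p} in
theorem Iwasawa.level_ofGroup {l : ℕ} (m : ℕ) (σ : Fin l → ℤ_[p]) :
    level m (ofGroup σ) = AddMonoidAlgebra.single (red m σ) 1 := rfl

variable {p} in
theorem Iwasawa.lam_ext {l : ℕ} {x y : Lam p l} (h : ∀ m, level m x = level m y) : x = y :=
  Subtype.ext (funext h)

variable {p} in
theorem Iwasawa.mapDomain_level {l : ℕ} (m : ℕ) (x : Lam p l) :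
    AddMonoidAlgebra.mapDomainAlgHom ℤ_[p] ℤ_[p] (proj p l m) (level (m + 1) x) = level m x :=
  x.2 m

/-- Existence in `existsUnique_of_compatible` gives surjectivity onto the inverse limit, uniqueness
gives injectivity. -/
theorem exists_algEquiv_lam {l : ℕ} {R : Type*} [CommRing R] [Algebra ℤ_[p] R] [IsNoetherianRing R]
    [TopologicalSpace R] [IsTopologicalRing R] [CompactSpace R] [T2Space R] [IsLocalRing R]
    (φ : ∀ m, R →ₐ[ℤ_[p]] AddMonoidAlgebra ℤ_[p] (Level p l m))
    (hφ : ∀ m, (AddMonoidAlgebra.mapDomainAlgHom ℤ_[p] ℤ_[p] (proj p l m)).comp (φ (m + 1)) = φ m)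
    (hsurj : ∀ m, Function.Surjective (φ m))
    (hker : ∀ m, RingHom.ker (φ m) ≤ IsLocalRing.maximalIdeal R ^ m) :
    ∃ Φ : R ≃ₐ[ℤ_[p]] Lam p l, ∀ r m, level m (Φ r) = φ m r := by
  let Φ : R →ₐ[ℤ_[p]] Lam p l :=
    (AlgHom.pi φ).codRestrict (lamSubalgebra p l) fun r m => AlgHom.congr_fun (hφ m) r
  have hΦ : ∀ r m, level m (Φ r) = φ m r := fun _ _ => rfl
  have H := fun x : Lam p l => existsUnique_of_compatible
    (B := fun m => AddMonoidAlgebra ℤ_[p] (Level p l m))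
    (fun m => (AddMonoidAlgebra.mapDomainAlgHom ℤ_[p] ℤ_[p] (proj p l m)).toRingHom)
    (fun m => (φ m).toRingHom) (fun m => RingHom.ext fun r => AlgHom.congr_fun (hφ m) r)
    hsurj hker x.1 x.2
  refine ⟨AlgEquiv.ofBijective Φ ⟨fun r s hrs => ?_, fun x => ?_⟩, hΦ⟩
  · exact (H (Φ r)).unique (fun m => rfl) fun m => by rw [hrs]; rfl
  · obtain ⟨r, hr, -⟩ := H x
    exact ⟨r, Subtype.ext (funext hr)⟩

theorem natCast_mem_maximalIdeal_padicInt : (p : ℤ_[p]) ∈ IsLocalRing.maximalIdeal ℤ_[p] := by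
  rw [PadicInt.maximalIdeal_eq_span_p]; exact Ideal.mem_span_singleton_self _

theorem PowerSeries.mem_maximalIdeal_iff {A : Type*} [CommRing A] [IsLocalRing A]
    {f : PowerSeries A} : f ∈ IsLocalRing.maximalIdeal (PowerSeries A) ↔
      PowerSeries.constantCoeff f ∈ IsLocalRing.maximalIdeal A := by
  rw [IsLocalRing.mem_maximalIdeal, IsLocalRing.mem_maximalIdeal, mem_nonunits_iff,
    mem_nonunits_iff, PowerSeries.isUnit_iff_constantCoeff]

theorem PowerSeries.natCast_mem_maximalIdeal {A : Type*} [CommRing A] [IsLocalRing A] {n : ℕ}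
    (h : (n : A) ∈ IsLocalRing.maximalIdeal A) :
    (n : PowerSeries A) ∈ IsLocalRing.maximalIdeal (PowerSeries A) := by
  rw [PowerSeries.mem_maximalIdeal_iff, map_natCast]; exact h

theorem PowerSeries.X_mem_maximalIdeal {A : Type*} [CommRing A] [IsLocalRing A] :
    (PowerSeries.X : PowerSeries A) ∈ IsLocalRing.maximalIdeal (PowerSeries A) := by
  rw [PowerSeries.mem_maximalIdeal_iff, PowerSeries.constantCoeff_X]; exact Ideal.zero_mem _

open scoped PowerSeries.WithPiTopology in
theorem PowerSeries.compactSpace {A : Type*} [TopologicalSpace A] [CompactSpace A] :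
    CompactSpace (PowerSeries A) :=
  inferInstanceAs (CompactSpace ((Unit →₀ ℕ) → A))

open scoped PowerSeries.WithPiTopology in
instance isAdicComplete_powerSeries_padicInt :
    IsAdicComplete (IsLocalRing.maximalIdeal (PowerSeries ℤ_[p])) (PowerSeries ℤ_[p]) :=
  have := PowerSeries.compactSpace (A := ℤ_[p])
  isAdicComplete_of_compactSpace

theorem exists_algHom_level_one (m : ℕ) :
    ∃ φ : PowerSeries ℤ_[p] →ₐ[ℤ_[p]] AddMonoidAlgebra ℤ_[p] (Level p 1 m),
      φ PowerSeries.X = AddMonoidAlgebra.single (fun _ => 1) 1 - 1 ∧ Function.Surjective φ ∧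
      RingHom.ker φ ≤ IsLocalRing.maximalIdeal (PowerSeries ℤ_[p]) ^ m := by
  obtain ⟨u, hu, hX, hsurj, hker⟩ :=
    exists_ringHom_groupRing (natCast_mem_maximalIdeal_padicInt p) m
  let e : ZMod (p ^ m) ≃+ Level p 1 m :=
    { (Equiv.funUnique (Fin 1) (ZMod (p ^ m))).symm with map_add' := fun _ _ => rfl }
  let E := AddMonoidAlgebra.domCongr ℤ_[p] ℤ_[p] e
  refine ⟨E.toAlgHom.comp { u with commutes' := hu }, ?_, E.surjective.comp hsurj, ?_⟩
  · change E (u PowerSeries.X) = _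
    rw [hX, map_sub, map_one, AddMonoidAlgebra.domCongr_single]
    rfl
  · intro x hx
    have hx : E (u x) = 0 := hx
    rw [EmbeddingLike.map_eq_zero_iff] at hx
    have hx : x ∈ RingHom.ker u := hx
    rw [hker] at hx
    refine (Ideal.span_singleton_le_iff_mem _).2 ?_ hx
    exact Ideal.pow_le_pow_right m.le_succ (one_add_pow_sub_one_mem
      (PowerSeries.natCast_mem_maximalIdeal (natCast_mem_maximalIdeal_padicInt p))
      PowerSeries.X_mem_maximalIdeal m)

/-- The one-variable map is applied twice: first the outer variable is specialized, then the
coefficients, giving a group ring over a group ring. The kernel is generated by `(1 + T)^(p^m) - 1`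
for both variables. -/
theorem exists_algHom_level_two (m : ℕ) :
    ∃ φ : PowerSeries (PowerSeries ℤ_[p]) →ₐ[ℤ_[p]] AddMonoidAlgebra ℤ_[p] (Level p 2 m),
      φ (PowerSeries.C PowerSeries.X) = AddMonoidAlgebra.single (Pi.single 0 1) 1 - 1 ∧
      φ PowerSeries.X = AddMonoidAlgebra.single (Pi.single 1 1) 1 - 1 ∧ Function.Surjective φ ∧
      RingHom.ker φ ≤ IsLocalRing.maximalIdeal (PowerSeries (PowerSeries ℤ_[p])) ^ m := by
  have hp1 := natCast_mem_maximalIdeal_padicInt p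
  have hp2 := PowerSeries.natCast_mem_maximalIdeal hp1
  have hp3 := PowerSeries.natCast_mem_maximalIdeal hp2
  obtain ⟨u, hu, hX, hsurj, hker⟩ := exists_ringHom_groupRing hp1 m
  obtain ⟨v, hvC, hY, hsurj', hker'⟩ := exists_ringHom_groupRing hp2 m
  -- The swap is needed because uncurrying puts the exponent of the outer variable first, while that
  -- variable belongs to coordinate `1`.
  let e : ZMod (p ^ m) × ZMod (p ^ m) ≃+ Level p 2 m :=
    { toFun := fun x => ![x.2, x.1]
      invFun := fun x => (x 1, x 0)
      left_inv := fun _ => rfl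
      right_inv := fun x => by ext i; fin_cases i <;> rfl
      map_add' := fun x y => by ext i; fin_cases i <;> rfl }
  let E := AddMonoidAlgebra.domCongr ℤ_[p] ℤ_[p] e
  let K : AddMonoidAlgebra (AddMonoidAlgebra ℤ_[p] (ZMod (p ^ m))) (ZMod (p ^ m)) ≃+* _ :=
    (AddMonoidAlgebra.curryRingEquiv (R := ℤ_[p]) (M := ZMod (p ^ m)) (N := ZMod (p ^ m))).symm
  let w := AddMonoidAlgebra.mapRingHom (ZMod (p ^ m)) u
  let φ : PowerSeries (PowerSeries ℤ_[p]) →+* AddMonoidAlgebra ℤ_[p] (Level p 2 m) :=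
    (E.toRingEquiv.toRingHom.comp K.toRingHom).comp (w.comp v)
  have hφ : ∀ x, φ x = E (K (w (v x))) := fun _ => rfl
  have hC : ∀ a, φ (PowerSeries.C a) = E (K (AddMonoidAlgebra.single 0 (u a))) := by
    intro a
    rw [hφ, hvC]
    congr 2
    exact AddMonoidAlgebra.mapRingHom_single _ _ _
  refine ⟨{ φ with commutes' := fun r => ?_ }, ?_, ?_, ?_, ?_⟩
  · change φ (algebraMap _ _ r) = _
    rw [PowerSeries.algebraMap_apply, PowerSeries.algebraMap_apply, Algebra.algebraMap_self_apply,
      hC, hu]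
    simp only [K, AddMonoidAlgebra.curryRingEquiv_symm_single, E, AddMonoidAlgebra.domCongr_single]
    rw [show e (0, 0) = 0 from map_zero e]
    rfl
  · change φ _ = _
    rw [hC, hX, AddMonoidAlgebra.single_sub, map_sub, map_sub]
    rw [AddMonoidAlgebra.one_def]
    simp only [K, AddMonoidAlgebra.curryRingEquiv_symm_single, E, AddMonoidAlgebra.domCongr_single]
    rw [show e (0, 0) = 0 from map_zero e, ← AddMonoidAlgebra.one_def]
    congr 2
    ext i; fin_cases i <;> rfl
  · change φ _ = _
    rw [hφ, hY, map_sub, map_sub, map_sub, map_one, map_one, map_one]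
    congr 1
    have : w (AddMonoidAlgebra.single 1 1) = AddMonoidAlgebra.single 1 (AddMonoidAlgebra.single 0 1) :=
      (AddMonoidAlgebra.mapRingHom_single _ _ _).trans (by
        rw [← AddMonoidAlgebra.one_def]; congr 1; exact map_one u)
    rw [this]
    simp only [K, AddMonoidAlgebra.curryRingEquiv_symm_single, E, AddMonoidAlgebra.domCongr_single]
    congr 1
    ext i; fin_cases i <;> rfl
  · have hw : Function.Surjective w := by
      intro x
      induction x using AddMonoidAlgebra.induction_linear with
      | zero => exact ⟨0, map_zero _⟩
      | add a b ha hb =>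
        obtain ⟨a, rfl⟩ := ha; obtain ⟨b, rfl⟩ := hb; exact ⟨a + b, map_add _ _ _⟩
      | single k r =>
        obtain ⟨r, rfl⟩ := hsurj r
        exact ⟨AddMonoidAlgebra.single k r, AddMonoidAlgebra.mapRingHom_single _ _ _⟩
    exact E.surjective.comp (K.surjective.comp (hw.comp hsurj'))
  · intro x hx
    have hx : E (K (w (v x))) = 0 := hx
    rw [EmbeddingLike.map_eq_zero_iff, EmbeddingLike.map_eq_zero_iff] at hx
    have hcoeff : ∀ k, (v x).coeff k ∈ RingHom.ker u := by
      intro k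
      have := congrArg (fun y => AddMonoidAlgebra.coeff y k) hx
      simpa [w] using this
    rw [hker] at hcoeff
    choose c hc using fun k => Ideal.mem_span_singleton.1 (hcoeff k)
    set om : PowerSeries ℤ_[p] := (1 + PowerSeries.X) ^ p ^ m - 1 with hom
    -- All coefficients of `v x` are multiples `om * c k`; lifting the `c k` to `y` and subtracting
    -- `C om * y` leaves an element of the kernel of `v`.
    obtain ⟨y, hy⟩ := hsurj' (AddMonoidAlgebra.ofCoeff (Finsupp.equivFunOnFinite.symm c))
    have hv : v (x - PowerSeries.C om * y) = 0 := by
      rw [map_sub, map_mul, hvC, hy, sub_eq_zero]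
      ext k : 2
      rw [hc]
      simp
    have hv : x - PowerSeries.C om * y ∈ RingHom.ker v := hv
    rw [hker', Ideal.mem_span_singleton] at hv
    obtain ⟨z, hz⟩ := hv
    rw [eq_add_of_sub_eq hz]
    refine Ideal.pow_le_pow_right m.le_succ (Ideal.add_mem _ (Ideal.mul_mem_right _ _ ?_)
      (Ideal.mul_mem_right _ _ ?_))
    · exact one_add_pow_sub_one_mem hp3 PowerSeries.X_mem_maximalIdeal m
    · rw [hom, map_sub, map_pow, map_add, map_one]
      refine one_add_pow_sub_one_mem hp3 ?_ m
      rw [PowerSeries.mem_maximalIdeal_iff, PowerSeries.constantCoeff_C]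
      exact PowerSeries.X_mem_maximalIdeal

theorem one_add_single_sub_one_pow {l m : ℕ} (g : Level p l m) :
    (1 + (AddMonoidAlgebra.single g 1 - 1 : AddMonoidAlgebra ℤ_[p] (Level p l m))) ^ p ^ m - 1 =
      0 := by
  have : p ^ m • g = 0 := by
    ext i
    rw [Pi.smul_apply, nsmul_eq_mul, ZMod.natCast_self, zero_mul, Pi.zero_apply]
  rw [add_sub_cancel, AddMonoidAlgebra.single_pow, this, one_pow, AddMonoidAlgebra.one_def,
    sub_self]

open scoped PowerSeries.WithPiTopology in
/-- Serre's isomorphism `ℤ_p⟦T⟧ ≃ Λ_1`. -/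
theorem exists_algEquiv_lam_one : ∃ Φ : PowerSeries ℤ_[p] ≃ₐ[ℤ_[p]] Lam p 1,
    Φ PowerSeries.X = ofGroup (fun _ => 1) - 1 ∧
    ∀ m r, level m (Φ r) = 0 → r ∈ IsLocalRing.maximalIdeal _ ^ m := by
  have := PowerSeries.compactSpace (A := ℤ_[p])
  choose φ hX hsurj hker using exists_algHom_level_one p
  have hone : ∀ m, red m (fun _ : Fin 1 => (1 : ℤ_[p])) = fun _ => 1 := fun m =>
    funext fun i => map_one (PadicInt.toZModPow m)
  have hpr : ∀ m, proj p 1 m (fun _ => 1) = fun _ => 1 := fun m => by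
    rw [← hone, ← hone, proj_red]
  have hcomp : ∀ m, (AddMonoidAlgebra.mapDomainAlgHom ℤ_[p] ℤ_[p] (proj p 1 m)).comp
      (φ (m + 1)) = φ m := by
    intro m
    have hX' : AddMonoidAlgebra.mapDomainAlgHom ℤ_[p] ℤ_[p] (proj p 1 m)
        (φ (m + 1) PowerSeries.X) = φ m PowerSeries.X := by
      rw [hX, hX, map_sub, map_one, AddMonoidAlgebra.mapDomainAlgHom_apply,
        AddMonoidAlgebra.mapDomain_single, hpr]
    -- Both composites kill `(1 + T)^(p^m) - 1`, so agreement on constants and on `T` is enough; no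
    -- continuity enters.
    refine AlgHom.coe_ringHom_injective
      (powerSeries_ringHom_ext_of_pow_sub_one (natCast_mem_maximalIdeal_padicInt p) m
        (fun a => ?_) hX' ?_)
    · have h := (AlgHom.commutes (AlgHom.comp (AddMonoidAlgebra.mapDomainAlgHom ℤ_[p] ℤ_[p]
        (proj p 1 m)) (φ (m + 1))) a).trans ((φ m).commutes a).symm
      rw [PowerSeries.algebraMap_apply, Algebra.algebraMap_self_apply] at h
      exact h
    · have h1 : ∀ (u : PowerSeries ℤ_[p] →+* AddMonoidAlgebra ℤ_[p] (Level p 1 m)),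
          u PowerSeries.X = φ m PowerSeries.X → u ((1 + PowerSeries.X) ^ p ^ m - 1) = 0 := by
        intro u hu
        rw [map_sub, map_pow, map_add, map_one, hu, hX, one_add_single_sub_one_pow]
      exact h1 _ hX'
  obtain ⟨Φ, hΦ⟩ := exists_algEquiv_lam p φ hcomp hsurj hker
  refine ⟨Φ, lam_ext fun m => ?_, fun m r hr => hker m ((hΦ r m).symm.trans hr)⟩
  rw [hΦ, hX, map_sub, map_one, level_ofGroup, hone]

open scoped PowerSeries.WithPiTopology in
/-- Serre's isomorphism `ℤ_p⟦T₁⟧⟦T₂⟧ ≃ Λ_2`. -/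
theorem exists_algEquiv_lam_two : ∃ Φ : PowerSeries (PowerSeries ℤ_[p]) ≃ₐ[ℤ_[p]] Lam p 2,
    Φ (PowerSeries.C PowerSeries.X) = ofGroup (Pi.single 0 1) - 1 ∧
    Φ PowerSeries.X = ofGroup (Pi.single 1 1) - 1 ∧
    ∀ m r, level m (Φ r) = 0 → r ∈ IsLocalRing.maximalIdeal _ ^ m := by
  have := PowerSeries.compactSpace (A := ℤ_[p])
  have := PowerSeries.compactSpace (A := PowerSeries ℤ_[p])
  choose φ hX hY hsurj hker using exists_algHom_level_two p
  have hone : ∀ m i, red m (Pi.single i 1 : Fin 2 → ℤ_[p]) = Pi.single i 1 := fun m i => by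
    ext j
    change PadicInt.toZModPow m ((Pi.single i 1 : Fin 2 → ℤ_[p]) j) = _
    rw [Pi.single_apply, Pi.single_apply]
    split_ifs
    · exact map_one _
    · exact map_zero _
  have hpr : ∀ m i, proj p 2 m (Pi.single i 1) = Pi.single i 1 := fun m i => by
    rw [← hone, ← hone, proj_red]
  have hcomp : ∀ m, (AddMonoidAlgebra.mapDomainAlgHom ℤ_[p] ℤ_[p] (proj p 2 m)).comp
      (φ (m + 1)) = φ m := by
    intro m
    set τ := AddMonoidAlgebra.mapDomainAlgHom ℤ_[p] ℤ_[p] (proj p 2 m)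
    have hs : ∀ i, τ (AddMonoidAlgebra.single (Pi.single i 1) 1 - 1) =
        AddMonoidAlgebra.single (Pi.single i 1) 1 - 1 := by
      intro i
      rw [map_sub, map_one, AddMonoidAlgebra.mapDomainAlgHom_apply,
        AddMonoidAlgebra.mapDomain_single, hpr]
    have hX' : τ (φ (m + 1) (PowerSeries.C PowerSeries.X)) = φ m (PowerSeries.C PowerSeries.X) := by
      rw [hX, hX, hs]
    have hY' : τ (φ (m + 1) PowerSeries.X) = φ m PowerSeries.X := by
      rw [hY, hY, hs]
    have hp1 := natCast_mem_maximalIdeal_padicInt p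
    have h1 : ((τ.comp (φ (m + 1))).toRingHom.comp PowerSeries.C :
        PowerSeries ℤ_[p] →+* _) = (φ m).toRingHom.comp PowerSeries.C := by
      refine powerSeries_ringHom_ext_of_pow_sub_one hp1 m (fun a => ?_) hX' ?_
      · have h := (AlgHom.commutes (τ.comp (φ (m + 1))) a).trans ((φ m).commutes a).symm
        rw [PowerSeries.algebraMap_apply, PowerSeries.algebraMap_apply,
          Algebra.algebraMap_self_apply] at h
        exact h
      · have h1 : ∀ (u : PowerSeries ℤ_[p] →+* AddMonoidAlgebra ℤ_[p] (Level p 2 m)),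
            u PowerSeries.X = φ m (PowerSeries.C PowerSeries.X) →
              u ((1 + PowerSeries.X) ^ p ^ m - 1) = 0 := by
          intro u hu
          rw [map_sub, map_pow, map_add, map_one, hu, hX, one_add_single_sub_one_pow]
        exact h1 _ hX'
    refine AlgHom.coe_ringHom_injective
      (powerSeries_ringHom_ext_of_pow_sub_one (PowerSeries.natCast_mem_maximalIdeal hp1) m
        (fun a => RingHom.congr_fun h1 a) hY' ?_)
    · have h1 : ∀ (u : PowerSeries (PowerSeries ℤ_[p]) →+* AddMonoidAlgebra ℤ_[p] (Level p 2 m)),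
          u PowerSeries.X = φ m PowerSeries.X → u ((1 + PowerSeries.X) ^ p ^ m - 1) = 0 := by
        intro u hu
        rw [map_sub, map_pow, map_add, map_one, hu, hY, one_add_single_sub_one_pow]
      exact h1 _ hY'
  obtain ⟨Φ, hΦ⟩ := exists_algEquiv_lam p φ hcomp hsurj hker
  refine ⟨Φ, lam_ext fun m => ?_, lam_ext fun m => ?_, fun m r hr => hker m ((hΦ r m).symm.trans hr)⟩
  · rw [hΦ, hX, map_sub, map_one, level_ofGroup, hone]
  · rw [hΦ, hY, map_sub, map_one, level_ofGroup, hone]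

end IwasawaAlgebra

/-! ### Prime factorization by Weierstrass preparation -/

section Factorization

open Polynomial

variable {A : Type*} [CommRing A]

theorem PowerSeries.C_dvd_iff {a : A} {f : PowerSeries A} :
    PowerSeries.C a ∣ f ↔ ∀ n, a ∣ PowerSeries.coeff n f := by
  constructor
  · rintro ⟨g, rfl⟩ n
    rw [PowerSeries.coeff_C_mul]
    exact Dvd.intro _ rfl
  · intro h
    choose c hc using h
    exact ⟨PowerSeries.mk c, by ext n; rw [PowerSeries.coeff_C_mul, PowerSeries.coeff_mk, hc]⟩

theorem PowerSeries.map_mk_eq_zero_iff {a : A} {f : PowerSeries A} :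
    f.map (Ideal.Quotient.mk (Ideal.span {a})) = 0 ↔ PowerSeries.C a ∣ f := by
  rw [PowerSeries.C_dvd_iff, PowerSeries.ext_iff]
  refine forall_congr' fun n => ?_
  rw [PowerSeries.coeff_map, map_zero, Ideal.Quotient.eq_zero_iff_mem,
    Ideal.mem_span_singleton]

/-- `C a` generates the kernel of coefficientwise reduction to power series over the domain `A ⧸
(a)`. -/
theorem PowerSeries.prime_C_of_prime [IsDomain A] {a : A} (ha : Prime a) :
    Prime (PowerSeries.C a) := by
  have := (Ideal.span_singleton_prime ha.ne_zero).2 ha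
  have hker : RingHom.ker (PowerSeries.map (Ideal.Quotient.mk (Ideal.span {a}))) =
      Ideal.span {PowerSeries.C a} := by
    ext f
    rw [RingHom.mem_ker, PowerSeries.map_mk_eq_zero_iff, Ideal.mem_span_singleton]
  have h0 : PowerSeries.C a ≠ 0 := by
    rw [Ne, map_eq_zero_iff _ PowerSeries.C_injective]; exact ha.ne_zero
  rw [← Ideal.span_singleton_prime h0, ← hker]
  exact RingHom.ker_isPrime _

/-- Modulo `I` the product is a power of `X`, whose monic divisors are again powers of `X`. -/
theorem Polynomial.Monic.isDistinguishedAt_of_mul {I : Ideal A} [I.IsPrime] {q r : A[X]}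
    (hq : q.Monic) (h : (q * r).IsDistinguishedAt I) : q.IsDistinguishedAt I := by
  have h1 := h.map_eq_X_pow
  rw [Polynomial.map_mul] at h1
  obtain ⟨i, -, hi⟩ := (dvd_prime_pow prime_X _).1 (Dvd.intro _ h1)
  have hm := hq.map (Ideal.Quotient.mk I)
  have hqi := eq_of_monic_of_associated hm (monic_X_pow i) hi
  have hdeg : q.natDegree = i := by
    rw [← hq.natDegree_map (Ideal.Quotient.mk I), hqi, natDegree_X_pow]
  refine ⟨⟨fun {n} hn => ?_⟩, hq⟩
  rw [← Ideal.Quotient.eq_zero_iff_mem, ← coeff_map, hqi, coeff_X_pow, if_neg (by omega)]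

/-- By Weierstrass division the quotients of `A⟦X⟧` and `A[X]` by `q` are isomorphic, so primality
carries over. -/
theorem Polynomial.IsDistinguishedAt.prime_coe [IsDomain A] {I : Ideal A} [IsAdicComplete I A]
    {q : A[X]} (hq : q.IsDistinguishedAt I) (hp : Prime q) : Prime (q : PowerSeries A) := by
  have h0 : (q : PowerSeries A) ≠ 0 := by
    rw [Ne, Polynomial.coe_eq_zero_iff]; exact hp.ne_zero
  have := (Ideal.span_singleton_prime hp.ne_zero).2 hp
  rw [← Ideal.span_singleton_prime h0, ← Ideal.Quotient.isDomain_iff_prime]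
  exact hq.algEquivQuotient.symm.toMulEquiv.isDomain _

/-- Factor in `A[X]`, which is factorial, with monic factors; these stay distinguished, and the
irreducible ones are prime in `A⟦X⟧`. Induction is on the degree. -/
theorem Polynomial.IsDistinguishedAt.exists_primes [IsDomain A] [UniqueFactorizationMonoid A]
    {I : Ideal A} [I.IsPrime] [IsAdicComplete I A] {f : A[X]} (hf : f.IsDistinguishedAt I) :
    ∃ s : Multiset (PowerSeries A), (∀ q ∈ s, Prime q) ∧ s.prod = (f : PowerSeries A) := by
  induction hn : f.natDegree using Nat.strong_induction_on generalizing f with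
  | _ n ih =>
    by_cases h1 : f = 1
    · exact ⟨0, by simp, by simp [h1]⟩
    · have hu : ¬ IsUnit f := fun hu => h1 (hf.monic.eq_one_of_isUnit hu)
      obtain ⟨q, hq, r, rfl⟩ := WfDvdMonoid.exists_irreducible_factor hu hf.monic.ne_zero
      have hlc : q.leadingCoeff * r.leadingCoeff = 1 := by
        rw [← leadingCoeff_mul]; exact hf.monic
      have hlc' : r.leadingCoeff * q.leadingCoeff = 1 := by rw [mul_comm]; exact hlc
      have hCu : IsUnit (C r.leadingCoeff) := isUnit_C.2 (IsUnit.of_mul_eq_one _ hlc')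
      have hmul : q * r = (C r.leadingCoeff * q) * (C q.leadingCoeff * r) := by
        calc q * r = C (q.leadingCoeff * r.leadingCoeff) * (q * r) := by rw [hlc]; simp
          _ = _ := by rw [C_mul]; ring
      have hmq : (C r.leadingCoeff * q).Monic := by
        rw [Monic, leadingCoeff_mul, leadingCoeff_C, hlc']
      have hmr : (C q.leadingCoeff * r).Monic := by
        rw [Monic, leadingCoeff_mul, leadingCoeff_C, hlc]
      rw [hmul] at hf hn ⊢
      have hdq := hmq.isDistinguishedAt_of_mul hf
      have hdr := hmr.isDistinguishedAt_of_mul (mul_comm _ (C q.leadingCoeff * r) ▸ hf)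
      have hirr : Irreducible (C r.leadingCoeff * q) := (irreducible_isUnit_mul hCu).2 hq
      have hpos : 0 < (C r.leadingCoeff * q).natDegree := by
        rw [Nat.pos_iff_ne_zero]
        intro h0
        exact hirr.not_isUnit (((Monic.natDegree_eq_zero hmq).1 h0) ▸ isUnit_one)
      rw [hmq.natDegree_mul hmr] at hn
      obtain ⟨s, hs, hprod⟩ := ih _ (by omega) hdr rfl
      refine ⟨((C r.leadingCoeff * q : A[X]) : PowerSeries A) ::ₘ s, ?_, ?_⟩
      · intro x hx
        rcases Multiset.mem_cons.1 hx with rfl | hx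
        · exact hdq.prime_coe hirr.prime
        · exact hs x hx
      · rw [Multiset.prod_cons, hprod, Polynomial.coe_mul (C r.leadingCoeff * q)]

theorem PowerSeries.exists_primes_of_map_residue_ne_zero [IsDomain A] [UniqueFactorizationMonoid A]
    [IsLocalRing A] [IsAdicComplete (IsLocalRing.maximalIdeal A) A] {f : PowerSeries A}
    (hf : f.map (IsLocalRing.residue A) ≠ 0) :
    ∃ s : Multiset (PowerSeries A), (∀ q ∈ s, Prime q) ∧ Associated s.prod f := by
  obtain ⟨P, h, H⟩ := PowerSeries.exists_isWeierstrassFactorization hf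
  obtain ⟨s, hs, hprod⟩ := H.isDistinguishedAt.exists_primes
  refine ⟨s, hs, ?_⟩
  rw [hprod, H.eq_mul]
  exact (associated_mul_unit_right _ _ H.isUnit)

/-- Continuity is replaced by Krull's intersection theorem: splitting off constant terms repeatedly
puts `u f - v f` into every power of the proper ideal `(u X)`. -/
theorem powerSeries_ringHom_ext {B : Type*} [CommRing B] [IsDomain B] [IsNoetherianRing B]
    {u v : PowerSeries A →+* B} (hC : ∀ a, u (PowerSeries.C a) = v (PowerSeries.C a))
    (hX : u PowerSeries.X = v PowerSeries.X) (hu : ¬ IsUnit (u PowerSeries.X)) : u = v := by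
  have key : ∀ n f, u f - v f ∈ Ideal.span {u PowerSeries.X} ^ n := by
    intro n
    induction n with
    | zero => simp
    | succ n ih =>
      intro f
      have : u f - v f = u PowerSeries.X * (u (PowerSeries.mk fun k => PowerSeries.coeff (k + 1) f)
          - v (PowerSeries.mk fun k => PowerSeries.coeff (k + 1) f)) := by
        conv_lhs => rw [PowerSeries.eq_X_mul_shift_add_const f]
        rw [map_add, map_add, map_mul, map_mul, hC, ← hX]
        ring
      rw [this, pow_succ']
      exact Ideal.mul_mem_mul (Ideal.mem_span_singleton_self _) (ih _)
  have h := Ideal.iInf_pow_eq_bot_of_isDomain (Ideal.span {u PowerSeries.X})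
    (fun h => hu (Ideal.span_singleton_eq_top.1 h))
  ext f
  rw [← sub_eq_zero, ← Ideal.mem_bot, ← h, Ideal.mem_iInf]
  exact fun n => key n f

end Factorization

/-! ### Ring structure and functoriality of the Iwasawa algebras -/

section LamRings

open Iwasawa

variable (p : ℕ) [Fact p.Prime]

instance : IsDomain (Lam p 1) :=
  (exists_algEquiv_lam_one p).choose.symm.toMulEquiv.isDomain _

instance : IsNoetherianRing (Lam p 1) :=
  isNoetherianRing_of_ringEquiv _ (exists_algEquiv_lam_one p).choose.toRingEquiv

instance : UniqueFactorizationMonoid (Lam p 1) :=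
  (exists_algEquiv_lam_one p).choose.toMulEquiv.uniqueFactorizationMonoid inferInstance

instance : IsLocalRing (Lam p 1) :=
  (exists_algEquiv_lam_one p).choose.toRingEquiv.isLocalRing

instance : IsDomain (Lam p 2) :=
  (exists_algEquiv_lam_two p).choose.symm.toMulEquiv.isDomain _

instance : IsNoetherianRing (Lam p 2) :=
  isNoetherianRing_of_ringEquiv _ (exists_algEquiv_lam_two p).choose.toRingEquiv

instance : IsLocalRing (Lam p 2) :=
  (exists_algEquiv_lam_two p).choose.toRingEquiv.isLocalRing

theorem prime_natCast_powerSeries : Prime (p : PowerSeries ℤ_[p]) := by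
  have := PowerSeries.prime_C_of_prime (PadicInt.prime_p (p := p))
  rwa [map_natCast] at this

theorem prime_natCast_lam_one : Prime (p : Lam p 1) := by
  have := (MulEquiv.prime_iff (exists_algEquiv_lam_one p).choose.toMulEquiv).2
    (prime_natCast_powerSeries p)
  simpa using this

theorem prime_natCast_lam_two : Prime (p : Lam p 2) := by
  have h := PowerSeries.prime_C_of_prime (prime_natCast_powerSeries p)
  rw [map_natCast] at h
  have := (MulEquiv.prime_iff (exists_algEquiv_lam_two p).choose.toMulEquiv).2 h
  simpa using this

variable {p}

theorem Iwasawa.ofGroup_add {l : ℕ} (σ τ : Fin l → ℤ_[p]) :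
    ofGroup (σ + τ) = ofGroup σ * ofGroup τ := by
  refine lam_ext fun m => ?_
  rw [map_mul, level_ofGroup, level_ofGroup, level_ofGroup, AddMonoidAlgebra.single_mul_single,
    map_add, one_mul]

theorem Iwasawa.ofGroup_zero {l : ℕ} : ofGroup (0 : Fin l → ℤ_[p]) = 1 := by
  refine lam_ext fun m => ?_
  rw [map_one, level_ofGroup, map_zero, AddMonoidAlgebra.one_def]

theorem Iwasawa.ofGroup_nsmul {l : ℕ} (n : ℕ) (σ : Fin l → ℤ_[p]) :
    ofGroup (n • σ) = ofGroup σ ^ n := by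
  induction n with
  | zero => rw [zero_smul, pow_zero, ofGroup_zero]
  | succ n ih => rw [succ_nsmul, ofGroup_add, ih, pow_succ]

/-- Reduction modulo `p^m` of a linear map `ℤ_p^l → ℤ_p^l'`. -/
noncomputable def Iwasawa.levelLinear {l l' : ℕ} (π : (Fin l → ℤ_[p]) →ₗ[ℤ_[p]] (Fin l' → ℤ_[p]))
    (m : ℕ) : Level p l m →+ Level p l' m :=
  (Matrix.mulVecLin ((LinearMap.toMatrix' π).map (PadicInt.toZModPow m))).toAddMonoidHom

theorem Iwasawa.levelLinear_red {l l' : ℕ} (π : (Fin l → ℤ_[p]) →ₗ[ℤ_[p]] (Fin l' → ℤ_[p]))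
    (m : ℕ) (x : Fin l → ℤ_[p]) : levelLinear π m (red m x) = red m (π x) := by
  ext i
  change ((LinearMap.toMatrix' π).map (PadicInt.toZModPow m)).mulVec
    (PadicInt.toZModPow m ∘ x) i = PadicInt.toZModPow m (π x i)
  rw [← RingHom.map_mulVec, ← Matrix.toLin'_apply, Matrix.toLin'_toMatrix']

theorem Iwasawa.red_surjective {l : ℕ} (m : ℕ) :
    Function.Surjective (red (p := p) (l := l) m) := by
  intro y
  choose x hx using fun i => ZMod.ringHom_surjective (PadicInt.toZModPow (p := p) m) (y i)
  exact ⟨x, funext hx⟩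

theorem Iwasawa.levelLinear_surjective {l l' : ℕ}
    {π : (Fin l → ℤ_[p]) →ₗ[ℤ_[p]] (Fin l' → ℤ_[p])} (hπ : Function.Surjective π) (m : ℕ) :
    Function.Surjective (levelLinear π m) := by
  intro y
  obtain ⟨y, rfl⟩ := red_surjective m y
  obtain ⟨x, rfl⟩ := hπ y
  exact ⟨red m x, levelLinear_red π m x⟩

theorem AddMonoidAlgebra.mapDomain_mapDomain {R M N O : Type*} [Semiring R] (f : M → N) (g : N → O)
    (x : AddMonoidAlgebra R M) : mapDomain g (mapDomain f x) = mapDomain (g ∘ f) x := by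
  ext; simp [Finsupp.mapDomain_comp]

/-- The homomorphism of Iwasawa algebras induced by a linear map of groups. -/
noncomputable def Iwasawa.lamMap {l l' : ℕ} (π : (Fin l → ℤ_[p]) →ₗ[ℤ_[p]] (Fin l' → ℤ_[p])) :
    Lam p l →ₐ[ℤ_[p]] Lam p l' :=
  (AlgHom.pi fun m => (AddMonoidAlgebra.mapDomainAlgHom ℤ_[p] ℤ_[p] (levelLinear π m)).comp
    (level m)).codRestrict (lamSubalgebra p l') fun x m => by
      have h : (proj p l' m).comp (levelLinear π (m + 1)) = (levelLinear π m).comp (proj p l m) := by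
        refine AddMonoidHom.ext fun y => ?_
        obtain ⟨y, rfl⟩ := red_surjective (p := p) (m + 1) y
        simp only [AddMonoidHom.comp_apply, levelLinear_red, proj_red]
      have h1 := mapDomain_level m x
      simp only [AddMonoidAlgebra.mapDomainAlgHom_apply] at h1
      simp only [AlgHom.pi_apply, AlgHom.comp_apply, AddMonoidAlgebra.mapDomainAlgHom_apply]
      rw [← h1, AddMonoidAlgebra.mapDomain_mapDomain, AddMonoidAlgebra.mapDomain_mapDomain,
        ← AddMonoidHom.coe_comp, h, AddMonoidHom.coe_comp]

theorem Iwasawa.level_lamMap {l l' : ℕ} (π : (Fin l → ℤ_[p]) →ₗ[ℤ_[p]] (Fin l' → ℤ_[p])) (m : ℕ)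
    (x : Lam p l) : level m (lamMap π x) =
      AddMonoidAlgebra.mapDomain (levelLinear π m) (level m x) := rfl

theorem Iwasawa.lamMap_ofGroup {l l' : ℕ} (π : (Fin l → ℤ_[p]) →ₗ[ℤ_[p]] (Fin l' → ℤ_[p]))
    (σ : Fin l → ℤ_[p]) : lamMap π (ofGroup σ) = ofGroup (π σ) :=
  lam_ext fun m => by
    rw [level_lamMap, level_ofGroup, level_ofGroup, AddMonoidAlgebra.mapDomain_single,
      levelLinear_red]

theorem Iwasawa.lamMap_comp {l l' l'' : ℕ} (π : (Fin l → ℤ_[p]) →ₗ[ℤ_[p]] (Fin l' → ℤ_[p]))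
    (ρ : (Fin l' → ℤ_[p]) →ₗ[ℤ_[p]] (Fin l'' → ℤ_[p])) (x : Lam p l) :
    lamMap (ρ ∘ₗ π) x = lamMap ρ (lamMap π x) :=
  lam_ext fun m => by
    have h : (levelLinear (ρ ∘ₗ π) m) = (levelLinear ρ m).comp (levelLinear π m) := by
      refine AddMonoidHom.ext fun y => ?_
      obtain ⟨y, rfl⟩ := red_surjective (p := p) m y
      simp only [AddMonoidHom.comp_apply, levelLinear_red, LinearMap.comp_apply]
    rw [level_lamMap, level_lamMap, level_lamMap, h, AddMonoidHom.coe_comp,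
      AddMonoidAlgebra.mapDomain_mapDomain]

theorem Iwasawa.lamMap_id {l : ℕ} (x : Lam p l) : lamMap LinearMap.id x = x :=
  lam_ext fun m => by
    have h : levelLinear (LinearMap.id : (Fin l → ℤ_[p]) →ₗ[ℤ_[p]] _) m = AddMonoidHom.id _ := by
      refine AddMonoidHom.ext fun y => ?_
      obtain ⟨y, rfl⟩ := red_surjective (p := p) m y
      rw [levelLinear_red]; rfl
    rw [level_lamMap, h]
    ext; simp

/-- The automorphism of the Iwasawa algebra induced by an automorphism of the group. -/
noncomputable def Iwasawa.lamEquiv {l : ℕ} (θ : (Fin l → ℤ_[p]) ≃ₗ[ℤ_[p]] (Fin l → ℤ_[p])) :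
    Lam p l ≃ₐ[ℤ_[p]] Lam p l :=
  AlgEquiv.ofAlgHom (lamMap θ.toLinearMap) (lamMap θ.symm.toLinearMap)
    (AlgHom.ext fun x => by
      rw [AlgHom.comp_apply, ← lamMap_comp, LinearEquiv.comp_symm, lamMap_id]; rfl)
    (AlgHom.ext fun x => by
      rw [AlgHom.comp_apply, ← lamMap_comp, LinearEquiv.symm_comp, lamMap_id]; rfl)

theorem Iwasawa.lamEquiv_apply {l : ℕ} (θ : (Fin l → ℤ_[p]) ≃ₗ[ℤ_[p]] (Fin l → ℤ_[p]))
    (x : Lam p l) : lamEquiv θ x = lamMap θ.toLinearMap x := rfl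

variable (p) in
/-- The projection of `ℤ_p^2` to its last coordinate. -/
noncomputable def Iwasawa.lastCoord : (Fin 2 → ℤ_[p]) →ₗ[ℤ_[p]] (Fin 1 → ℤ_[p]) :=
  LinearMap.pi fun _ => LinearMap.proj 1

theorem Iwasawa.lastCoord_apply (x : Fin 2 → ℤ_[p]) : lastCoord p x = fun _ => x 1 := rfl

theorem Iwasawa.not_isUnit_ofGroup_one_sub_one :
    ¬ IsUnit (ofGroup (fun _ : Fin 1 => (1 : ℤ_[p])) - 1) := by
  obtain ⟨Φ, hΦ, -⟩ := exists_algEquiv_lam_one p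
  rw [← hΦ, MulEquiv.isUnit_map]
  exact PowerSeries.X_prime.not_isUnit

/-- In terms of power series, projecting to the last coordinate puts the first variable to `0`. -/
theorem lamMap_lastCoord_apply {Φ₁ : PowerSeries ℤ_[p] ≃ₐ[ℤ_[p]] Lam p 1}
    {Φ₂ : PowerSeries (PowerSeries ℤ_[p]) ≃ₐ[ℤ_[p]] Lam p 2}
    (h : Φ₁ PowerSeries.X = ofGroup (fun _ => 1) - 1)
    (h0 : Φ₂ (PowerSeries.C PowerSeries.X) = ofGroup (Pi.single 0 1) - 1)
    (h1 : Φ₂ PowerSeries.X = ofGroup (Pi.single 1 1) - 1) (F : PowerSeries (PowerSeries ℤ_[p])) :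
    lamMap (lastCoord p) (Φ₂ F) = Φ₁ (F.map PowerSeries.constantCoeff) := by
  have e0 : lastCoord p (Pi.single 0 1) = 0 := by
    rw [lastCoord_apply]; funext _; simp
  have e1 : lastCoord p (Pi.single 1 1) = fun _ => 1 := by
    rw [lastCoord_apply]; funext _; simp
  let u : PowerSeries (PowerSeries ℤ_[p]) →+* Lam p 1 :=
    (lamMap (lastCoord p)).toRingHom.comp Φ₂.toRingEquiv.toRingHom
  let v : PowerSeries (PowerSeries ℤ_[p]) →+* Lam p 1 :=
    Φ₁.toRingEquiv.toRingHom.comp (PowerSeries.map PowerSeries.constantCoeff)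
  have hu : ∀ F, u F = lamMap (lastCoord p) (Φ₂ F) := fun _ => rfl
  have hv : ∀ F, v F = Φ₁ (F.map PowerSeries.constantCoeff) := fun _ => rfl
  have huX : u PowerSeries.X = ofGroup (fun _ => 1) - 1 := by
    rw [hu, h1, map_sub, map_one, lamMap_ofGroup, e1]
  have huCX : (u.comp PowerSeries.C) PowerSeries.X = 0 := by
    rw [RingHom.comp_apply, hu, h0, map_sub, map_one, lamMap_ofGroup, e0, ofGroup_zero, sub_self]
  have hC : u.comp PowerSeries.C = v.comp PowerSeries.C := by
    refine powerSeries_ringHom_ext (fun a => ?_) ?_ ?_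
    · have hC : PowerSeries.C (PowerSeries.C a) =
          algebraMap ℤ_[p] (PowerSeries (PowerSeries ℤ_[p])) a := by
        rw [PowerSeries.algebraMap_apply, PowerSeries.algebraMap_apply,
          Algebra.algebraMap_self_apply]
      have hC' : PowerSeries.C a = algebraMap ℤ_[p] (PowerSeries ℤ_[p]) a := by
        rw [PowerSeries.algebraMap_apply, Algebra.algebraMap_self_apply]
      change u (PowerSeries.C (PowerSeries.C a)) = v (PowerSeries.C (PowerSeries.C a))
      rw [hu, hv, PowerSeries.map_C, PowerSeries.constantCoeff_C, hC, hC', AlgEquiv.commutes,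
        AlgHom.commutes, AlgEquiv.commutes]
    · rw [huCX, RingHom.comp_apply, hv]
      simp
    · rw [huCX]; exact not_isUnit_zero
  have huv : u = v := by
    refine powerSeries_ringHom_ext (fun a => RingHom.congr_fun hC a) ?_ ?_
    · rw [huX, hv, PowerSeries.map_X, h]
    · rw [huX]; exact not_isUnit_ofGroup_one_sub_one
  rw [← hu, ← hv, huv]

/-- In power series this map sets the inner variable to `0`, and a series is killed exactly when all
its coefficients are divisible by that variable. -/
theorem ker_lamMap_lastCoord :
    RingHom.ker (lamMap (lastCoord p)) = Ideal.span {ofGroup (Pi.single 0 1) - 1} := by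
  obtain ⟨Φ₁, h, -⟩ := exists_algEquiv_lam_one p
  obtain ⟨Φ₂, h0, h1, -⟩ := exists_algEquiv_lam_two p
  refine le_antisymm (fun x hx => ?_) ?_
  · obtain ⟨F, rfl⟩ := Φ₂.surjective x
    rw [RingHom.mem_ker, lamMap_lastCoord_apply h h0 h1, EmbeddingLike.map_eq_zero_iff] at hx
    have : PowerSeries.C PowerSeries.X ∣ F := by
      rw [PowerSeries.C_dvd_iff]
      intro n
      rw [PowerSeries.X_dvd_iff, ← PowerSeries.coeff_map, hx, map_zero]
    rw [Ideal.mem_span_singleton, ← h0]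
    exact map_dvd Φ₂ this
  · rw [Ideal.span_singleton_le_iff_mem, RingHom.mem_ker, map_sub, map_one, lamMap_ofGroup]
    have : lastCoord p (Pi.single 0 1) = 0 := by
      rw [lastCoord_apply]; funext _; simp
    rw [this, ofGroup_zero, sub_self]

/-- A surjection onto a free module splits, and the splitting induces a section of `lamMap π`. -/
theorem lamMap_surjective {l l' : ℕ}
    {π : (Fin l → ℤ_[p]) →ₗ[ℤ_[p]] (Fin l' → ℤ_[p])} (hπ : Function.Surjective π) :
    Function.Surjective (lamMap π) := by
  obtain ⟨ρ, hρ⟩ := Module.projective_lifting_property π LinearMap.id hπ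
  intro y
  exact ⟨lamMap ρ y, by rw [← lamMap_comp, hρ, lamMap_id]⟩

/-- The change of basis `θ` reduces this to the last coordinate; `θ (Pi.single 0 1)` generates the
kernel of `π`. -/
theorem ker_lamMap {π : (Fin 2 → ℤ_[p]) →ₗ[ℤ_[p]] (Fin 1 → ℤ_[p])}
    (θ : (Fin 2 → ℤ_[p]) ≃ₗ[ℤ_[p]] (Fin 2 → ℤ_[p])) (h : π ∘ₗ θ.toLinearMap = lastCoord p) :
    RingHom.ker (lamMap π) = Ideal.span {ofGroup (θ (Pi.single 0 1)) - 1} := by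
  have h1 : ∀ x, lamMap π (lamEquiv θ x) = lamMap (lastCoord p) x := by
    intro x; rw [← h, lamMap_comp, lamEquiv_apply]
  have h2 : ofGroup (θ (Pi.single 0 1)) - 1 = lamEquiv θ (ofGroup (Pi.single 0 1) - 1) := by
    rw [map_sub, map_one, lamEquiv_apply, lamMap_ofGroup]; rfl
  ext x
  obtain ⟨y, rfl⟩ := (lamEquiv θ).surjective x
  rw [RingHom.mem_ker, h1, ← RingHom.mem_ker, ker_lamMap_lastCoord, h2, Ideal.mem_span_singleton,
    Ideal.mem_span_singleton, map_dvd_iff]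

theorem exists_comp_eq_lastCoord {π : (Fin 2 → ℤ_[p]) →ₗ[ℤ_[p]] (Fin 1 → ℤ_[p])}
    (hπ : Function.Surjective π) : ∃ θ : (Fin 2 → ℤ_[p]) ≃ₗ[ℤ_[p]] (Fin 2 → ℤ_[p]),
      π ∘ₗ θ.toLinearMap = lastCoord p := by
  set u := π (Pi.single 0 1) 0 with hu
  set v := π (Pi.single 1 1) 0 with hv
  have happ : ∀ x, π x = fun _ => x 0 * u + x 1 * v := by
    intro x
    have hx : x = x 0 • Pi.single 0 1 + x 1 • Pi.single 1 1 := by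
      ext i; fin_cases i <;> simp
    funext i
    rw [Subsingleton.elim i 0]
    conv_lhs => rw [hx]
    simp [hu, hv]
  obtain ⟨y, hy⟩ := hπ 1
  have hy : y 0 * u + y 1 * v = 1 := by
    rw [happ] at hy; exact congrFun hy 0
  -- Since `ℤ_p` is local, one of the two entries `u`, `v` of `π` is a unit; the corresponding
  -- coordinate can be solved for, which gives the basis explicitly.
  rcases IsLocalRing.isUnit_or_isUnit_of_add_one hy with h | h
  · obtain ⟨c, hc⟩ := (isUnit_of_mul_isUnit_right h).exists_right_inv
    refine ⟨LinearEquiv.ofLinearMap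
      (LinearMap.pi ![c • (LinearMap.proj 1 - v • LinearMap.proj 0), LinearMap.proj 0])
      (LinearMap.pi ![LinearMap.proj 1, u • LinearMap.proj 0 + v • LinearMap.proj 1]) ?_ ?_, ?_⟩
    · refine LinearMap.ext fun x => funext fun i => ?_
      fin_cases i
      · simp; linear_combination (x 0) * hc
      · simp
    · refine LinearMap.ext fun x => funext fun i => ?_
      fin_cases i
      · simp
      · simp; linear_combination (x 1 - v * x 0) * hc
    · refine LinearMap.ext fun x => ?_
      rw [LinearMap.comp_apply, happ, lastCoord_apply]
      funext _
      simp; linear_combination (x 1 - v * x 0) * hc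
  · obtain ⟨c, hc⟩ := (isUnit_of_mul_isUnit_right h).exists_right_inv
    refine ⟨LinearEquiv.ofLinearMap
      (LinearMap.pi ![LinearMap.proj 0, c • (LinearMap.proj 1 - u • LinearMap.proj 0)])
      (LinearMap.pi ![LinearMap.proj 0, u • LinearMap.proj 0 + v • LinearMap.proj 1]) ?_ ?_, ?_⟩
    · refine LinearMap.ext fun x => funext fun i => ?_
      fin_cases i
      · simp
      · simp; linear_combination (x 1) * hc
    · refine LinearMap.ext fun x => funext fun i => ?_
      fin_cases i
      · simp
      · simp; linear_combination (x 1 - u * x 0) * hc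
    · refine LinearMap.ext fun x => ?_
      rw [LinearMap.comp_apply, happ, lastCoord_apply]
      funext _
      simp; linear_combination (x 1 - u * x 0) * hc

/-- Elements of `Λ_2` with an image in `Λ_1` which is not divisible by `p` are products of
primes. -/
theorem exists_primes_of_not_dvd_lamMap {π : (Fin 2 → ℤ_[p]) →ₗ[ℤ_[p]] (Fin 1 → ℤ_[p])}
    (hπ : Function.Surjective π) {x : Lam p 2} (hx : ¬ (p : Lam p 1) ∣ lamMap π x) :
    ∃ s : Multiset (Lam p 2), (∀ q ∈ s, Prime q) ∧ Associated s.prod x := by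
  obtain ⟨θ, hθ⟩ := exists_comp_eq_lastCoord hπ
  obtain ⟨Φ₁, h, -⟩ := exists_algEquiv_lam_one p
  obtain ⟨Φ₂, h0, h1, -⟩ := exists_algEquiv_lam_two p
  let E : PowerSeries (PowerSeries ℤ_[p]) ≃* Lam p 2 := (Φ₂.trans (lamEquiv θ)).toMulEquiv
  obtain ⟨F, rfl⟩ := E.surjective x
  have hF : lamMap π (E F) = Φ₁ (F.map PowerSeries.constantCoeff) := by
    rw [← lamMap_lastCoord_apply h h0 h1, ← hθ, lamMap_comp]; rfl
  -- In these coordinates `π` sets the inner variable to `0`. If every coefficient of `F` were a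
  -- non-unit of `ℤ_p⟦T⟧`, all constant terms would be divisible by `p`, and so would the image
  -- under `π`.
  have hres : F.map (IsLocalRing.residue (PowerSeries ℤ_[p])) ≠ 0 := by
    intro h0
    refine hx ?_
    rw [hF]
    have : (p : PowerSeries ℤ_[p]) ∣ F.map PowerSeries.constantCoeff := by
      rw [← map_natCast PowerSeries.C, PowerSeries.C_dvd_iff]
      intro n
      have hn := PowerSeries.ext_iff.1 h0 n
      rw [PowerSeries.coeff_map, map_zero, IsLocalRing.residue_eq_zero_iff,
        PowerSeries.mem_maximalIdeal_iff, PadicInt.maximalIdeal_eq_span_p,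
        Ideal.mem_span_singleton] at hn
      rwa [PowerSeries.coeff_map]
    simpa using map_dvd Φ₁ this
  obtain ⟨s, hs, hprod⟩ := PowerSeries.exists_primes_of_map_residue_ne_zero hres
  refine ⟨s.map E, ?_, ?_⟩
  · intro q hq
    obtain ⟨r, hr, rfl⟩ := Multiset.mem_map.1 hq
    exact (MulEquiv.prime_iff E).2 (hs r hr)
  · rw [← map_multiset_prod]
    exact hprod.map E

end LamRings

namespace Multigraph

open Iwasawa

/-! ### Voltage Laplacians, principal divisors and harmonic functions -/

section Laplacian

variable {W E : Type*} [Fintype E]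

open Classical in
/-- The Laplacian of a graph with voltages `u` on the edges and `u'` on their inverses. -/
noncomputable def voltageLaplacian {R : Type*} [CommRing R] (Y : Multigraph W E) (u u' : E → R) :
    Matrix W W R :=
  Matrix.of fun w v => ∑ e : E, ((if w = Y.src e ∧ v = Y.src e then 1 else 0) -
    (if w = Y.tgt e ∧ v = Y.src e then u e else 0) +
    (if w = Y.tgt e ∧ v = Y.tgt e then 1 else 0) -
    (if w = Y.src e ∧ v = Y.tgt e then u' e else 0))

variable {R : Type*} [CommRing R] (Y : Multigraph W E) (u u' : E → R)

theorem voltageLaplacian_map {R' : Type*} [CommRing R'] (f : R →+* R') :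
    (Y.voltageLaplacian u u').map f = Y.voltageLaplacian (f ∘ u) (f ∘ u') := by
  ext w v
  simp only [voltageLaplacian, Matrix.map_apply, Matrix.of_apply, map_sum, map_sub, map_add,
    apply_ite f, map_zero, map_one, Function.comp_apply]

open Classical in
theorem voltageLaplacian_mulVec [Fintype W] (x : W → R) (w : W) :
    (Y.voltageLaplacian u u').mulVec x w = ∑ e : E, ((if w = Y.src e then x (Y.src e) else 0) -
      (if w = Y.tgt e then u e * x (Y.src e) else 0) +
      (if w = Y.tgt e then x (Y.tgt e) else 0) -
      (if w = Y.src e then u' e * x (Y.tgt e) else 0)) := by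
  have key : ∀ (a b : W) (c : R), ∑ v, (if w = a ∧ v = b then c else 0) * x v =
      if w = a then c * x b else 0 := by
    intro a b c
    rw [Finset.sum_eq_single b]
    · simp
    · intro v _ hv
      simp [hv]
    · simp
  simp only [Matrix.mulVec, dotProduct, voltageLaplacian, Matrix.of_apply, Finset.sum_mul]
  rw [Finset.sum_comm]
  refine Finset.sum_congr rfl fun e _ => ?_
  simp only [sub_mul, add_mul, Finset.sum_sub_distrib, Finset.sum_add_distrib, key, one_mul]

variable (R) in
/-- The coefficient of a divisor at a vertex. -/
noncomputable def divCoeff (w : W) : Divisor R W →ₗ[R] R := Finsupp.lapply w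

omit [Fintype E] in
theorem divisor_ext {d d' : Divisor R W} (h : ∀ w, divCoeff R w d = divCoeff R w d') : d = d' :=
  Finsupp.ext h

open Classical in
omit [Fintype E] in
theorem divCoeff_point (v w : W) : divCoeff R w (point R v) = if w = v then 1 else 0 := by
  refine (Finsupp.single_apply (a := v) (a' := w) (b := (1 : R))).trans ?_
  simp only [eq_comm]

theorem divCoeff_firing (v w : W) : divCoeff R w (Y.firing R v) =
    Y.voltageLaplacian (fun _ => 1) (fun _ => 1) w v := by
  classical
  rw [firing, map_sum]
  simp only [voltageLaplacian, Matrix.of_apply]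
  refine Finset.sum_congr rfl fun e _ => ?_
  simp only [map_add, apply_ite (divCoeff R w), map_sub, map_zero, divCoeff_point]
  by_cases h1 : Y.src e = v <;> by_cases h2 : Y.tgt e = v
  · subst h1; simp [h2]
  · subst h1; simp [h2, Ne.symm h2]
  · subst h2; simp [h1, Ne.symm h1]
  · simp [h1, h2, Ne.symm h1, Ne.symm h2]

/-- The columns of the Laplacian are the divisors `p_v`, so principal divisors are its image. -/
theorem mem_principal_iff [Fintype W] (d : Divisor R W) : d ∈ Y.principal R ↔
    ∃ x : W → R, ∀ w, divCoeff R w d =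
      (Y.voltageLaplacian (fun _ => 1) (fun _ => 1)).mulVec x w := by
  classical
  let ev : Divisor R W ≃ₗ[R] (W → R) := Finsupp.linearEquivFunOnFinite R R W
  have h1 : (Y.principal R).map ev.toLinearMap =
      LinearMap.range (Y.voltageLaplacian (fun _ => (1 : R)) (fun _ => 1)).mulVecLin := by
    rw [principal, Submodule.map_span, Matrix.range_mulVecLin, ← Set.range_comp]
    congr 2
    funext v w
    exact Y.divCoeff_firing v w
  have h2 : d ∈ Y.principal R ↔ ev d ∈ (Y.principal R).map ev.toLinearMap := by
    constructor
    · exact fun h => Submodule.mem_map_of_mem h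
    · rintro ⟨d', hd', h⟩
      rwa [← ev.injective h]
  rw [h2, h1]
  constructor
  · rintro ⟨x, hx⟩
    exact ⟨x, fun w => (congrFun hx w).symm⟩
  · rintro ⟨x, hx⟩
    exact ⟨x, funext fun w => (hx w).symm⟩

theorem dotProduct_voltageLaplacian_mulVec [Fintype W] (x : W → R) :
    dotProduct x ((Y.voltageLaplacian (fun _ => 1) (fun _ => 1)).mulVec x) =
      ∑ e : E, (x (Y.src e) - x (Y.tgt e)) ^ 2 := by
  classical
  simp only [dotProduct, voltageLaplacian_mulVec, Finset.mul_sum]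
  rw [Finset.sum_comm]
  refine Finset.sum_congr rfl fun e _ => ?_
  simp only [mul_sub, mul_add, Finset.sum_sub_distrib, Finset.sum_add_distrib, mul_ite, mul_zero,
    Finset.sum_ite_eq', Finset.mem_univ, if_true]
  ring

theorem voltageLaplacian_mulVec_const [Fintype W] (c : R) :
    (Y.voltageLaplacian (fun _ => 1) (fun _ => 1)).mulVec (fun _ => c) = 0 := by
  classical
  funext w
  rw [voltageLaplacian_mulVec]
  refine Finset.sum_eq_zero fun e _ => ?_
  split_ifs <;> ring

variable {Y} in
/-- Harmonic functions on a finite connected graph are constant. -/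
theorem Connected.eq_of_voltageLaplacian_mulVec_eq_zero [Fintype W] [IsDomain R] [CharZero R]
    (hY : Y.Connected) {x : W → R}
    (hx : (Y.voltageLaplacian (fun _ => 1) (fun _ => 1)).mulVec x = 0) (v w : W) : x v = x w := by
  classical
  obtain ⟨w₀⟩ := hY.1
  have hconst : ∀ z : W → ℤ, (∀ e, z (Y.src e) = z (Y.tgt e)) → ∀ w, z w = z w₀ := by
    intro z hz w
    induction hY.2 w w₀ with
    | rel a b h => obtain ⟨e, rfl, rfl⟩ := h; exact hz e
    | refl => rfl
    | symm _ _ _ ih => exact ih.symm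
    | trans _ _ _ _ _ h1 h2 => exact h1.trans h2
  -- Positivity is available over `ℤ` but not over `R`. Adding `1` at `w₀` gives the form `∑ (z(src)
  -- - z(tgt))² + z(w₀)²`, which is definite by connectedness. Its non-zero determinant survives in
  -- characteristic zero and kills `x - x w₀`.
  let M : Matrix W W ℤ := Y.voltageLaplacian (fun _ => 1) (fun _ => 1) +
    Matrix.diagonal (Pi.single w₀ 1)
  have hdet : M.det ≠ 0 := by
    rw [Ne, ← Matrix.exists_mulVec_eq_zero_iff]
    rintro ⟨z, hz0, hz⟩
    refine hz0 ?_
    have h1 : dotProduct z (M.mulVec z) =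
        ∑ e : E, (z (Y.src e) - z (Y.tgt e)) ^ 2 + z w₀ ^ 2 := by
      rw [Matrix.add_mulVec, dotProduct_add, dotProduct_voltageLaplacian_mulVec]
      congr 1
      simp only [dotProduct, Matrix.mulVec_diagonal]
      rw [Finset.sum_eq_single w₀]
      · simp; ring
      · intro b _ hb; simp [hb]
      · simp
    rw [hz, dotProduct_zero] at h1
    have h2 : 0 ≤ ∑ e : E, (z (Y.src e) - z (Y.tgt e)) ^ 2 :=
      Finset.sum_nonneg fun e _ => sq_nonneg _
    have h3 : z w₀ = 0 := by nlinarith [sq_nonneg (z w₀)]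
    have h4 : ∑ e : E, (z (Y.src e) - z (Y.tgt e)) ^ 2 = 0 := by rw [h3] at h1; linarith
    rw [Finset.sum_eq_zero_iff_of_nonneg fun e _ => sq_nonneg _] at h4
    funext w
    rw [hconst z (fun e => by
      have := h4 e (Finset.mem_univ e)
      rwa [sq_eq_zero_iff, sub_eq_zero] at this) w, h3]
    rfl
  have hdet' : (M.map (Int.castRingHom R)).det ≠ 0 := by
    rw [← RingHom.mapMatrix_apply, ← RingHom.map_det]
    simpa using hdet
  have hM : M.map (Int.castRingHom R) = Y.voltageLaplacian (fun _ => 1) (fun _ => 1) +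
      Matrix.diagonal (Pi.single w₀ 1) := by
    have h1 := Y.voltageLaplacian_map (fun _ => 1) (fun _ => 1) (Int.castRingHom R)
    have h2 : (Matrix.diagonal (Pi.single w₀ (1 : ℤ))).map (Int.castRingHom R) =
        Matrix.diagonal (Pi.single w₀ 1) := by
      rw [Matrix.diagonal_map (map_zero _)]
      congr 1
      funext a
      rw [Pi.single_apply, Pi.single_apply]
      split_ifs <;> simp
    rw [Matrix.map_add _ (map_add _), h1, h2]
    simp only [Function.comp_def, map_one]
  have hker : (M.map (Int.castRingHom R)).mulVec (x - fun _ => x w₀) = 0 := by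
    rw [hM, Matrix.add_mulVec, Matrix.mulVec_sub, hx, voltageLaplacian_mulVec_const]
    funext a
    rw [Pi.add_apply, Matrix.mulVec_diagonal, Pi.single_apply]
    by_cases ha : a = w₀
    · simp [ha]
    · simp [ha]
  have h0 := Matrix.eq_zero_of_mulVec_eq_zero hdet' hker
  have : ∀ w, x w = x w₀ := fun w => sub_eq_zero.1 (congrFun h0 w)
  rw [this v, this w]

end Laplacian

/-! ### Derived graphs over the group ring of the voltage group -/

section Level

variable {V S : Type*} [Fintype V] [Fintype S] (X : Multigraph V S) {G : Type*} [AddCommGroup G]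
  [Fintype G] {k : Type*} [CommRing k]

/-- Divisors on a derived graph, as vectors over the group ring. -/
noncomputable def divEquiv (V G k : Type*) [Fintype V] [Fintype G] [CommRing k] :
    (V → AddMonoidAlgebra k G) ≃ₗ[k] Divisor k (V × G) where
  toFun y := Finsupp.equivFunOnFinite.symm fun w => (y w.1).coeff w.2
  invFun d := fun v => .ofCoeff (Finsupp.equivFunOnFinite.symm fun g => divCoeff k (v, g) d)
  map_add' _ _ := by
    refine Finsupp.ext fun w => ?_
    rfl
  map_smul' _ _ := by
    refine Finsupp.ext fun w => ?_
    rfl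
  left_inv y := by
    funext v
    ext g
    rfl
  right_inv d := by
    refine Finsupp.ext fun w => ?_
    rfl

omit [AddCommGroup G] in
theorem divCoeff_divEquiv (y : V → AddMonoidAlgebra k G) (w : V × G) :
    divCoeff k w (divEquiv V G k y) = (y w.1).coeff w.2 := rfl

theorem divEquiv_single [DecidableEq V] (v : V) (g : G) (r : k) :
    divEquiv V G k (Pi.single v (AddMonoidAlgebra.single g r)) = r • point k (v, g) := by
  classical
  refine divisor_ext fun w => ?_
  rw [divCoeff_divEquiv, map_smul, divCoeff_point]
  obtain ⟨a, b⟩ := w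
  by_cases h : a = v
  · subst h
    simp [Finsupp.single_apply, eq_comm]
  · simp [h]

omit [Fintype G] in
theorem divEquiv_linearMap_ext [DecidableEq V] {P : Type*} [AddCommGroup P] [Module k P]
    {f f' : (V → AddMonoidAlgebra k G) →ₗ[k] P}
    (h : ∀ v g, f (Pi.single v (AddMonoidAlgebra.single g 1)) =
      f' (Pi.single v (AddMonoidAlgebra.single g 1))) : f = f' := by
  refine LinearMap.pi_ext fun v x => ?_
  induction x using AddMonoidAlgebra.induction_on with
  | of g => exact h v g
  | add a b ha hb => rw [Pi.single_add, map_add, map_add, ha, hb]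
  | smul r a ha => rw [Pi.single_smul, map_smul, map_smul, ha]

theorem push_divEquiv_mapDomain {G' : Type*} [AddCommGroup G'] [Fintype G'] (φ : G → G')
    (y : V → AddMonoidAlgebra k G) :
    push k (Prod.map id φ) (divEquiv V G k y) =
      divEquiv V G' k (fun v => AddMonoidAlgebra.mapDomain φ (y v)) := by
  classical
  let f' : (V → AddMonoidAlgebra k G) →ₗ[k] (V → AddMonoidAlgebra k G') :=
    { toFun := fun y v => AddMonoidAlgebra.mapDomain φ (y v)
      map_add' := fun a b => funext fun v => AddMonoidAlgebra.mapDomain_add _ _ _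
      map_smul' := fun r a => funext fun v => by
        ext; simp }
  refine LinearMap.congr_fun (f := (push k (Prod.map id φ)).comp (divEquiv V G k).toLinearMap)
    (g := (divEquiv V G' k).toLinearMap.comp f') (divEquiv_linearMap_ext fun v g => ?_) y
  have h1 : f' (Pi.single v (AddMonoidAlgebra.single g 1)) =
      Pi.single v (AddMonoidAlgebra.single (φ g) 1) := by
    funext w
    change AddMonoidAlgebra.mapDomain φ _ = _
    by_cases h : w = v
    · subst h; simp
    · simp [h]
  rw [LinearMap.comp_apply, LinearMap.comp_apply, h1, LinearEquiv.coe_coe, LinearEquiv.coe_coe,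
    divEquiv_single, divEquiv_single, one_smul, one_smul, push_point]
  rfl

theorem push_divEquiv_add (h : G) (y : V → AddMonoidAlgebra k G) :
    push k (Prod.map id (h + ·)) (divEquiv V G k y) =
      divEquiv V G k (AddMonoidAlgebra.single h (1 : k) • y) := by
  rw [push_divEquiv_mapDomain]
  congr 1
  funext v
  rw [Pi.smul_apply, smul_eq_mul]
  induction y v using AddMonoidAlgebra.induction_on with
  | of g => simp
  | add a b ha hb => rw [AddMonoidAlgebra.mapDomain_add, ha, hb, mul_add]
  | smul r a ha =>
    rw [mul_smul_comm, ← ha]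
    ext; simp

/-- The Laplacian of the derived graph, in terms of the voltage Laplacian over the group ring. -/
theorem coeff_voltageLaplacian_mulVec (a : S → G) (y : V → AddMonoidAlgebra k G) (w : V × G) :
    ((X.voltageLaplacian (fun e => AddMonoidAlgebra.single (a e) (1 : k))
      (fun e => AddMonoidAlgebra.single (-a e) 1)).mulVec y w.1).coeff w.2 =
    ((X.derived a).voltageLaplacian (fun _ => (1 : k)) (fun _ => 1)).mulVec
      (fun w => (y w.1).coeff w.2) w := by
  classical
  obtain ⟨v, g⟩ := w
  rw [voltageLaplacian_mulVec, voltageLaplacian_mulVec, Fintype.sum_prod_type]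
  simp only [AddMonoidAlgebra.coeff_sum, Finsupp.finsetSum_apply]
  refine Finset.sum_congr rfl fun e _ => ?_
  have hmul : ∀ (h : G) (z : AddMonoidAlgebra k G), (AddMonoidAlgebra.single h (1 : k) * z).coeff g
      = z.coeff (g - h) := by
    intro h z
    induction z using AddMonoidAlgebra.induction_on with
    | of b => simp [Finsupp.single_apply, eq_sub_iff_add_eq, add_comm]
    | add a b ha hb => simp [mul_add, ha, hb]
    | smul r a ha => rw [mul_smul_comm]; simp [ha]
  have h1 : ∀ (P : Prop) [Decidable P] (z : AddMonoidAlgebra k G),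
      (if P then z else 0).coeff g = if P then z.coeff g else 0 := by
    intro P _ z; split_ifs <;> rfl
  simp only [AddMonoidAlgebra.coeff_sub, AddMonoidAlgebra.coeff_add, Finsupp.sub_apply,
    Finsupp.add_apply, h1, hmul, Finset.sum_sub_distrib, Finset.sum_add_distrib, derived,
    Prod.mk.injEq, one_mul, ite_and, sub_neg_eq_add]
  have hs : ∀ (P : Prop) [Decidable P] (f : G → k), (∑ h : G, if P then (if g = h then f h else 0)
      else 0) = if P then f g else 0 := by
    intro P _ f; split_ifs <;> simp
  have ht : ∀ (P : Prop) [Decidable P] (f : G → k), (∑ h : G, if P then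
      (if g = h + a e then f h else 0) else 0) = if P then f (g - a e) else 0 := by
    intro P _ f
    split_ifs
    · simp only [← sub_eq_iff_eq_add]; simp
    · simp
  rw [hs, ht, ht, hs]
  simp

/-- This turns the Jacobian of a layer into linear algebra over the group ring, with a matrix
indexed by the vertices of the base graph only. -/
theorem divEquiv_mem_principal_iff (a : S → G) (y : V → AddMonoidAlgebra k G) :
    divEquiv V G k y ∈ (X.derived a).principal k ↔
      ∃ z, y = (X.voltageLaplacian (fun e => AddMonoidAlgebra.single (a e) (1 : k))
        (fun e => AddMonoidAlgebra.single (-a e) 1)).mulVec z := by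
  rw [mem_principal_iff]
  constructor
  · rintro ⟨x, hx⟩
    refine ⟨(divEquiv V G k).symm (Finsupp.equivFunOnFinite.symm x), ?_⟩
    funext v
    ext g
    rw [coeff_voltageLaplacian_mulVec X a _ (v, g)]
    exact hx (v, g)
  · rintro ⟨z, rfl⟩
    exact ⟨fun w => (z w.1).coeff w.2, fun w => X.coeff_voltageLaplacian_mulVec a z w⟩

end Level

end Multigraph

namespace Multigraph

open Iwasawa

/-! ### The Iwasawa module and the determinant of the Laplacian -/

section JInf

variable {V S : Type*} [Fintype S] (X : Multigraph V S) {p : ℕ} [Fact p.Prime] {l : ℕ}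
  (α : S → Fin l → ℤ_[p])

/-- The voltage Laplacian over the Iwasawa algebra. -/
noncomputable def lamLaplacian : Matrix V V (Lam p l) :=
  X.voltageLaplacian (fun e => ofGroup (α e)) (fun e => ofGroup (-α e))

/-- The voltage Laplacian over the group ring of level `m`. -/
noncomputable def levelLaplacian (m : ℕ) : Matrix V V (AddMonoidAlgebra ℤ_[p] (Level p l m)) :=
  X.voltageLaplacian (fun e => AddMonoidAlgebra.single (red m (α e)) 1)
    (fun e => AddMonoidAlgebra.single (-red m (α e)) 1)

theorem lamLaplacian_map_level (m : ℕ) :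
    (X.lamLaplacian α).map (level m) = X.levelLaplacian α m := by
  refine (X.voltageLaplacian_map _ _ (level m).toRingHom).trans ?_
  rw [levelLaplacian]
  congr 1
  funext e
  change level m (ofGroup (-α e)) = _
  rw [level_ofGroup, map_neg]

theorem levelLaplacian_map_proj (m : ℕ) : (X.levelLaplacian α (m + 1)).map
    (AddMonoidAlgebra.mapDomainAlgHom ℤ_[p] ℤ_[p] (proj p l m)) = X.levelLaplacian α m := by
  rw [← lamLaplacian_map_level, ← lamLaplacian_map_level]
  ext1 v w
  exact mapDomain_level m _

theorem lamLaplacian_map_lamMap {l' : ℕ} (π : (Fin l → ℤ_[p]) →ₗ[ℤ_[p]] (Fin l' → ℤ_[p])) :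
    (X.lamLaplacian α).map (lamMap π) = X.lamLaplacian (fun e => π (α e)) := by
  refine (X.voltageLaplacian_map _ _ (lamMap π).toRingHom).trans ?_
  rw [lamLaplacian]
  congr 1 <;> funext e
  · exact lamMap_ofGroup π _
  · refine (lamMap_ofGroup π _).trans ?_
    rw [map_neg]

variable [Fintype V]

open Classical in
/-- The determinant of the voltage Laplacian. -/
noncomputable def lamDet : Lam p l := (X.lamLaplacian α).det

theorem lamMap_lamDet {l' : ℕ} (π : (Fin l → ℤ_[p]) →ₗ[ℤ_[p]] (Fin l' → ℤ_[p])) :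
    lamMap π (X.lamDet α) = X.lamDet (fun e => π (α e)) := by
  classical
  rw [lamDet, lamDet, ← lamLaplacian_map_lamMap]
  exact RingHom.map_det (lamMap π).toRingHom _

open Classical in
theorem level_lamDet (m : ℕ) : level m (X.lamDet α) = (X.levelLaplacian α m).det := by
  rw [lamDet, ← lamLaplacian_map_level]
  exact RingHom.map_det (level m).toRingHom _

/-- The divisor of level `m` attached to a vector over the group ring. -/
noncomputable abbrev levelDiv (V : Type*) [Fintype V] (m : ℕ) :
    (V → AddMonoidAlgebra ℤ_[p] (Level p l m)) ≃ₗ[ℤ_[p]] Divisor ℤ_[p] (V × Level p l m) :=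
  divEquiv V (Level p l m) ℤ_[p]

/-- The class in the Jacobian of level `m` of a vector over the group ring. -/
noncomputable def jacClass {m : ℕ} (y : V → AddMonoidAlgebra ℤ_[p] (Level p l m))
    (h : levelDiv V m y ∈ div0 ℤ_[p] (V × Level p l m)) : (X.layer α m).Jac ℤ_[p] :=
  Submodule.Quotient.mk ⟨levelDiv V m y, h⟩

theorem exists_jacClass_eq {m : ℕ} (x : (X.layer α m).Jac ℤ_[p]) :
    ∃ y h, X.jacClass α y h = x := by
  obtain ⟨⟨d, hd⟩, rfl⟩ := Submodule.Quotient.mk_surjective _ x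
  obtain ⟨y, rfl⟩ := (levelDiv V m).surjective d
  exact ⟨y, hd, rfl⟩

theorem jacClass_eq_zero_iff {m : ℕ} {y : V → AddMonoidAlgebra ℤ_[p] (Level p l m)} {h} :
    X.jacClass α y h = 0 ↔ ∃ z, y = (X.levelLaplacian α m).mulVec z := by
  rw [jacClass, Submodule.Quotient.mk_eq_zero]
  exact X.divEquiv_mem_principal_iff (fun s => red m (α s)) y

theorem jacClass_sub {m : ℕ} {y y' : V → AddMonoidAlgebra ℤ_[p] (Level p l m)} {h h'} :
    ∃ h'', X.jacClass α y h - X.jacClass α y' h' = X.jacClass α (y - y') h'' := by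
  refine ⟨by rw [map_sub]; exact Submodule.sub_mem _ h h', ?_⟩
  rw [jacClass, jacClass, ← Submodule.Quotient.mk_sub, jacClass]
  congr 1
  exact Subtype.ext (map_sub (levelDiv V m) y y').symm

theorem jacClass_eq_iff {m : ℕ} {y y' : V → AddMonoidAlgebra ℤ_[p] (Level p l m)} {h h'} :
    X.jacClass α y h = X.jacClass α y' h' ↔ ∃ z, y - y' = (X.levelLaplacian α m).mulVec z := by
  obtain ⟨h'', hs⟩ := X.jacClass_sub α (h := h) (h' := h')
  rw [← sub_eq_zero, hs, jacClass_eq_zero_iff]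

theorem jacAction_jacClass {m : ℕ} (a : AddMonoidAlgebra ℤ_[p] (Level p l m))
    {y : V → AddMonoidAlgebra ℤ_[p] (Level p l m)} {h} :
    ∃ h', X.jacAction α m a (X.jacClass α y h) = X.jacClass α (a • y) h' := by
  induction a using AddMonoidAlgebra.induction_on with
  | of g =>
    refine ⟨?_, ?_⟩
    · change levelDiv V m (AddMonoidAlgebra.single g 1 • y) ∈ _
      rw [← push_divEquiv_add, div0, LinearMap.mem_ker, degree_push]
      exact h
    · rw [jacAction, AddMonoidAlgebra.lift_of]
      change X.translate α m g _ = _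
      rw [translate, jacClass, jacMap_mk, jacClass]
      congr 1
      exact Subtype.ext (push_divEquiv_add g y)
  | add a b ha hb =>
    obtain ⟨h1, ha⟩ := ha
    obtain ⟨h2, hb⟩ := hb
    refine ⟨by rw [add_smul, map_add]; exact Submodule.add_mem _ h1 h2, ?_⟩
    rw [map_add, LinearMap.add_apply, ha, hb, jacClass, jacClass, ← Submodule.Quotient.mk_add,
      jacClass]
    congr 1
    refine Subtype.ext ?_
    change levelDiv V m (a • y) + levelDiv V m (b • y) = levelDiv V m ((a + b) • y)
    rw [add_smul, map_add]
  | smul r a ha =>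
    obtain ⟨h1, ha⟩ := ha
    refine ⟨by rw [smul_assoc, map_smul]; exact Submodule.smul_mem _ r h1, ?_⟩
    rw [map_smul, LinearMap.smul_apply, ha, jacClass, ← Submodule.Quotient.mk_smul, jacClass]
    congr 1
    refine Subtype.ext ?_
    change r • levelDiv V m (a • y) = levelDiv V m ((r • a) • y)
    rw [smul_assoc]
    exact ((levelDiv V m).map_smul r (a • y)).symm

theorem transition_jacClass {m : ℕ} {y : V → AddMonoidAlgebra ℤ_[p] (Level p l (m + 1))} {h} :
    ∃ h', X.transition α m (X.jacClass α y h) = X.jacClass α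
      (fun v => AddMonoidAlgebra.mapDomainAlgHom ℤ_[p] ℤ_[p] (proj p l m) (y v)) h' := by
  have key := push_divEquiv_mapDomain (k := ℤ_[p]) (proj p l m) y
  refine ⟨?_, ?_⟩
  · change levelDiv V m (fun v => AddMonoidAlgebra.mapDomain (proj p l m) (y v)) ∈ _
    rw [← key, div0, LinearMap.mem_ker, degree_push]
    exact h
  · rw [transition, jacClass, jacMap_mk, jacClass]
    congr 1
    exact Subtype.ext key

theorem proj_surjective (m : ℕ) : Function.Surjective (proj p l m) := by
  intro y
  obtain ⟨y, rfl⟩ := red_surjective (p := p) m y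
  exact ⟨red (m + 1) y, proj_red p l m y⟩

/-- An arbitrary representative upstairs projects to `y` up to a principal divisor; that divisor
lifts and is subtracted. This makes representatives compatible along the tower. -/
theorem exists_jacClass_lift {m : ℕ} {y : V → AddMonoidAlgebra ℤ_[p] (Level p l m)} {h}
    {x : (X.layer α (m + 1)).Jac ℤ_[p]} (hx : X.transition α m x = X.jacClass α y h) :
    ∃ y' h', X.jacClass α y' h' = x ∧
      ∀ v, AddMonoidAlgebra.mapDomainAlgHom ℤ_[p] ℤ_[p] (proj p l m) (y' v) = y v := by
  set τ := AddMonoidAlgebra.mapDomainAlgHom ℤ_[p] ℤ_[p] (proj p l m)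
  obtain ⟨w, hw, rfl⟩ := X.exists_jacClass_eq α x
  obtain ⟨h1, ht⟩ := X.transition_jacClass α (h := hw)
  rw [ht, jacClass_eq_iff] at hx
  obtain ⟨z, hz⟩ := hx
  have hsurj : Function.Surjective τ := by
    intro a
    induction a using AddMonoidAlgebra.induction_on with
    | of g =>
      obtain ⟨g', hg⟩ := proj_surjective m g
      exact ⟨AddMonoidAlgebra.single g' 1, by
        rw [AddMonoidAlgebra.mapDomainAlgHom_apply, AddMonoidAlgebra.mapDomain_single, hg]; rfl⟩
    | add a b ha hb =>
      obtain ⟨a, rfl⟩ := ha; obtain ⟨b, rfl⟩ := hb; exact ⟨a + b, map_add _ _ _⟩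
    | smul r a ha => obtain ⟨a, rfl⟩ := ha; exact ⟨r • a, map_smul _ _ _⟩
  choose z' hz' using fun v => hsurj (z v)
  have hmem : levelDiv V (m + 1) (w - (X.levelLaplacian α (m + 1)).mulVec z') ∈
      div0 ℤ_[p] (V × Level p l (m + 1)) := by
    rw [map_sub]
    refine Submodule.sub_mem _ hw ((X.layer α (m + 1)).principal_le_div0 ℤ_[p] ?_)
    exact (X.divEquiv_mem_principal_iff (fun s => red (m + 1) (α s)) _).2 ⟨z', rfl⟩
  refine ⟨_, hmem, ?_, fun v => ?_⟩
  · rw [jacClass_eq_iff]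
    exact ⟨-z', by rw [Matrix.mulVec_neg]; abel⟩
  · have h2 : τ ((X.levelLaplacian α (m + 1)).mulVec z' v) =
        (X.levelLaplacian α m).mulVec z v := by
      have := RingHom.map_mulVec τ.toRingHom (X.levelLaplacian α (m + 1)) z' v
      have hzz : τ.toRingHom ∘ z' = z := funext hz'
      rw [hzz] at this
      exact this.trans (congrArg (fun M => Matrix.mulVec M z v) (X.levelLaplacian_map_proj α m))
    have h3 := congrFun hz v
    rw [Pi.sub_apply, map_sub, h2, ← h3, Pi.sub_apply]
    exact sub_sub_cancel _ _

omit [Fintype V] in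
theorem smul_val (a : Lam p l) (x : X.JInf α) (m : ℕ) :
    (a • x).1 m = X.jacAction α m (level m a) (x.1 m) := rfl

omit [Fintype V] in
theorem jInf_ext {x y : X.JInf α} (h : ∀ m, x.1 m = y.1 m) : x = y := Subtype.ext (funext h)

/-- The vectors over the Iwasawa algebra of degree zero in every level. -/
noncomputable def lamDiv0 : Submodule (Lam p l) (V → Lam p l) where
  carrier := {y | ∀ m, levelDiv V m (fun v => level m (y v)) ∈ div0 ℤ_[p] (V × Level p l m)}
  zero_mem' := fun m => by
    have : levelDiv V m (fun v => level m ((0 : V → Lam p l) v)) = 0 :=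
      (congrArg (levelDiv V m) (funext fun v => map_zero (level m))).trans (map_zero _)
    exact Eq.subst (motive := fun d => d ∈ div0 ℤ_[p] (V × Level p l m)) this.symm
      (Submodule.zero_mem _)
  add_mem' := fun {a b} ha hb m => by
    have : levelDiv V m (fun v => level m ((a + b) v)) = levelDiv V m (fun v => level m (a v)) +
        levelDiv V m (fun v => level m (b v)) := by
      rw [← map_add]
      exact congrArg (levelDiv V m) (funext fun v => map_add (level m) _ _)
    rw [this]; exact Submodule.add_mem _ (ha m) (hb m)
  smul_mem' := fun a y hy m => by
    obtain ⟨h, -⟩ := X.jacAction_jacClass α (level m a) (h := hy m)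
    have : (fun v => level m ((a • y) v)) = level m a • fun v => level m (y v) := by
      funext v; exact map_mul _ _ _
    rw [this]; exact h

/-- `J_∞` is a quotient of a submodule of `Λ^V`: representatives chosen successively by
`exists_jacClass_lift` assemble to a vector over `Λ`. -/
theorem module_finite_jInf [IsNoetherianRing (Lam p l)] : Module.Finite (Lam p l) (X.JInf α) := by
  let N := X.lamDiv0 α
  let Ψ : N →ₗ[Lam p l] X.JInf α :=
    { toFun := fun y => ⟨fun m => X.jacClass α _ (y.2 m), fun m => by
        obtain ⟨h, ht⟩ := X.transition_jacClass α (h := y.2 (m + 1))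
        rw [ht, jacClass_eq_iff]
        refine ⟨0, ?_⟩
        rw [Matrix.mulVec_zero, sub_eq_zero]
        exact funext fun v => mapDomain_level m (y.1 v)⟩
      map_add' := fun a b => X.jInf_ext α fun m => by
        change X.jacClass α _ _ = X.jacClass α _ _ + X.jacClass α _ _
        rw [← sub_eq_iff_eq_add]
        obtain ⟨h, hs⟩ := X.jacClass_sub α (h := (a + b).2 m) (h' := b.2 m)
        rw [hs, jacClass_eq_iff]
        refine ⟨0, ?_⟩
        rw [Matrix.mulVec_zero, sub_eq_zero]
        funext v
        rw [Pi.sub_apply, ← map_sub]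
        congr 1
        exact add_sub_cancel_right _ _
      map_smul' := fun a y => X.jInf_ext α fun m => by
        change X.jacClass α _ _ = X.jacAction α m (level m a) (X.jacClass α _ _)
        obtain ⟨h, hs⟩ := X.jacAction_jacClass α (level m a) (h := y.2 m)
        rw [hs, jacClass_eq_iff]
        refine ⟨0, ?_⟩
        rw [Matrix.mulVec_zero, sub_eq_zero]
        funext v
        exact map_mul _ _ _ }
  have hΨ : Function.Surjective Ψ := by
    intro x
    let P : ℕ → Type _ := fun m => {y : V → AddMonoidAlgebra ℤ_[p] (Level p l m) //
      ∃ h, X.jacClass α y h = x.1 m}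
    let start : P 0 := ⟨_, (X.exists_jacClass_eq α (x.1 0)).choose_spec⟩
    have hstep : ∀ m (y : P m), ∃ y' : P (m + 1), ∀ v,
        AddMonoidAlgebra.mapDomainAlgHom ℤ_[p] ℤ_[p] (proj p l m) (y'.1 v) = y.1 v := by
      intro m y
      obtain ⟨h, hy⟩ := y.2
      obtain ⟨y', h', hy', hv⟩ := X.exists_jacClass_lift α ((x.2 m).trans hy.symm)
      exact ⟨⟨y', h', hy'⟩, hv⟩
    choose step hs using hstep
    let f : ∀ m, P m := fun m => Nat.rec start step m
    have hf : ∀ m v, AddMonoidAlgebra.mapDomainAlgHom ℤ_[p] ℤ_[p] (proj p l m) ((f (m + 1)).1 v) =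
        (f m).1 v := fun m => hs m (f m)
    let y : V → Lam p l := fun v => ⟨fun m => (f m).1 v, fun m => hf m v⟩
    refine ⟨⟨y, fun m => (f m).2.choose⟩, X.jInf_ext α fun m => (f m).2.choose_spec⟩
  exact Module.Finite.of_surjective Ψ hΨ

/-- Cramer's rule at each level: `det L • y = L (adj L y)` is principal. -/
theorem lamDet_smul (x : X.JInf α) : X.lamDet α • x = 0 := by
  classical
  refine X.jInf_ext α fun m => ?_
  rw [smul_val]
  obtain ⟨y, h, hy⟩ := X.exists_jacClass_eq α (x.1 m)
  obtain ⟨h', hs⟩ := X.jacAction_jacClass α (level m (X.lamDet α)) (h := h)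
  rw [← hy, hs]
  refine (X.jacClass_eq_zero_iff α).2 ⟨(X.levelLaplacian α m).adjugate.mulVec y, ?_⟩
  rw [Matrix.mulVec_mulVec, Matrix.mul_adjugate, level_lamDet, Matrix.smul_mulVec,
    Matrix.one_mulVec]

theorem level_surjective (m : ℕ) : Function.Surjective (level (p := p) (l := l) m) := by
  intro a
  induction a using AddMonoidAlgebra.induction_on with
  | of g =>
    obtain ⟨σ, hσ⟩ := red_surjective (p := p) m g
    exact ⟨ofGroup σ, by rw [level_ofGroup, hσ]; rfl⟩
  | add a b ha hb =>
    obtain ⟨a, rfl⟩ := ha; obtain ⟨b, rfl⟩ := hb; exact ⟨a + b, map_add _ _ _⟩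
  | smul r a ha => obtain ⟨a, rfl⟩ := ha; exact ⟨r • a, map_smul _ _ _⟩

/-- If `c` kills the Jacobian of the cover, then `det L` divides `(c (σ - 1))^n` in every level. -/
theorem exists_level_pow_eq_of_smul_eq_zero {c : Lam p l} (hc : ∀ x : X.JInf α, c • x = 0)
    (σ : Fin l → ℤ_[p]) (m : ℕ) :
    ∃ w, level m ((c * (ofGroup σ - 1)) ^ Fintype.card V - X.lamDet α * w) = 0 := by
  classical
  set t : Lam p l := ofGroup σ - 1 with ht
  -- The factor `σ - 1` is what turns the divisor of a single vertex into one of degree zero, and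
  -- hence into an element of the Jacobian.
  have hdeg : ∀ (v : V) m, levelDiv V m (fun w => level m ((Pi.single v t : V → Lam p l) w)) ∈
      div0 ℤ_[p] (V × Level p l m) := by
    intro v m
    have h1 : (fun w => level m ((Pi.single v t : V → Lam p l) w)) =
        Pi.single v (AddMonoidAlgebra.single (red m σ) 1) -
          Pi.single v (AddMonoidAlgebra.single 0 1) := by
      funext w
      rw [← Pi.single_sub]
      by_cases h : w = v
      · subst h
        rw [Pi.single_eq_same, Pi.single_eq_same, ht, map_sub, map_one, level_ofGroup]
        rfl
      · simp [h]
    have hpt : ∀ w : V × Level p l m, degree ℤ_[p] _ (point ℤ_[p] w) = 1 := fun w =>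
      (Finsupp.linearCombination_single ℤ_[p] (1 : ℤ_[p]) w).trans (one_smul _ 1)
    rw [h1, map_sub, divEquiv_single, divEquiv_single, one_smul, one_smul, div0,
      LinearMap.mem_ker, map_sub, hpt, hpt, sub_self]
  have hex : ∀ v : V, ∃ z, level m (c * t) • (Pi.single v 1) =
      (X.levelLaplacian α m).mulVec z := by
    intro v
    let x : X.JInf α := ⟨fun m => X.jacClass α _ (hdeg v m), fun m => by
      obtain ⟨h, ht⟩ := X.transition_jacClass α (h := hdeg v (m + 1))
      rw [ht, jacClass_eq_iff]
      refine ⟨0, ?_⟩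
      rw [Matrix.mulVec_zero, sub_eq_zero]
      exact funext fun w => mapDomain_level m _⟩
    have h0 : X.jacAction α m (level m c) (X.jacClass α _ (hdeg v m)) = 0 :=
      congrArg (fun y : X.JInf α => y.1 m) (hc x)
    obtain ⟨h', hs⟩ := X.jacAction_jacClass α (level m c) (h := hdeg v m)
    rw [hs, jacClass_eq_zero_iff] at h0
    obtain ⟨z, hz⟩ := h0
    refine ⟨z, ?_⟩
    rw [← hz]
    funext w
    by_cases h : w = v
    · subst h; simp
    · simp [h]
  choose z hz using hex
  -- The columns `z v` express `c (σ - 1)` times the identity as a multiple of the Laplacian;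
  -- determinants produce the exponent, the number of vertices.
  have hmat : level m (c * t) • (1 : Matrix V V _) =
      X.levelLaplacian α m * Matrix.of (fun w v => z v w) := by
    ext1 w v
    have := congrFun (hz v) w
    rw [Matrix.smul_apply, Matrix.one_apply, Matrix.mul_apply]
    rw [Pi.smul_apply, Pi.single_apply] at this
    exact this
  obtain ⟨w, hw⟩ := level_surjective m (Matrix.of (fun w v => z v w)).det
  refine ⟨w, ?_⟩
  have hdet := congrArg Matrix.det hmat
  rw [Matrix.det_smul, Matrix.det_one, mul_one, Matrix.det_mul] at hdet
  rw [map_sub, map_pow, hdet, map_mul, level_lamDet, hw, sub_self]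

/-- Krull's intersection theorem for the finite module `Λ ⧸ (a)`: divisibility modulo all powers of
the maximal ideal is divisibility. -/
theorem dvd_of_forall_level [IsNoetherianRing (Lam p l)] [IsLocalRing (Lam p l)]
    (hker : ∀ m, RingHom.ker (level (p := p) (l := l) m) ≤ IsLocalRing.maximalIdeal (Lam p l) ^ m)
    {a x : Lam p l} (h : ∀ m, ∃ w, level m (x - a * w) = 0) : a ∣ x := by
  have hK := Ideal.iInf_pow_smul_eq_bot_of_isLocalRing (M := Lam p l ⧸ Ideal.span {a})
    (IsLocalRing.maximalIdeal (Lam p l)) Ideal.IsPrime.ne_top'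
  rw [← Ideal.mem_span_singleton, ← Ideal.Quotient.eq_zero_iff_mem, ← Submodule.mem_bot (Lam p l),
    ← hK, Submodule.mem_iInf]
  intro m
  obtain ⟨w, hw⟩ := h m
  have h1 : Ideal.Quotient.mk (Ideal.span {a}) x =
      (x - a * w) • (1 : Lam p l ⧸ Ideal.span {a}) := by
    rw [Algebra.smul_def, mul_one, Ideal.Quotient.algebraMap_eq, Ideal.Quotient.eq,
      Ideal.mem_span_singleton]
    exact ⟨w, by ring⟩
  rw [h1]
  exact Submodule.smul_mem_smul (hker m hw) Submodule.mem_top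

/-- The determinant of the voltage Laplacian is non-zero if all layers are connected. -/
theorem lamDet_ne_zero [IsDomain (Lam p l)] (hl : l ≠ 0) (hconn : ∀ m, (X.layer α m).Connected) :
    X.lamDet α ≠ 0 := by
  classical
  rw [lamDet, Ne, ← Matrix.exists_mulVec_eq_zero_iff]
  rintro ⟨y, hy0, hy⟩
  refine hy0 (funext fun v => lam_ext fun m => ?_)
  have hlev : ∀ m, (X.levelLaplacian α m).mulVec (fun v => level m (y v)) = 0 := by
    intro m
    funext w
    have := RingHom.map_mulVec (level m).toRingHom (X.lamLaplacian α) y w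
    rw [hy] at this
    rw [← lamLaplacian_map_level]
    exact this.symm.trans (map_zero (level m))
  -- A kernel vector is harmonic on each connected layer, so the coefficients at a fixed vertex are
  -- all equal.
  have hconst : ∀ m (v : V) (g g' : Level p l m),
      (level m (y v)).coeff g = (level m (y v)).coeff g' := by
    intro m v g g'
    refine (hconn m).eq_of_voltageLaplacian_mulVec_eq_zero
      (x := fun w => (level m (y w.1)).coeff w.2) ?_ (v, g) (v, g')
    funext w
    have := X.coeff_voltageLaplacian_mulVec (k := ℤ_[p]) (fun s => red m (α s))
      (fun v => level m (y v)) w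
    rw [← this]
    have h2 := congrFun (hlev m) w.1
    exact congrArg (fun z => AddMonoidAlgebra.coeff z w.2) h2
  have hsum : ∀ m (x : AddMonoidAlgebra ℤ_[p] (Level p l (m + 1))),
      ∑ g, (AddMonoidAlgebra.mapDomainAlgHom ℤ_[p] ℤ_[p] (proj p l m) x).coeff g =
        ∑ g, x.coeff g := by
    intro m x
    induction x using AddMonoidAlgebra.induction_on with
    | of g =>
      simp [AddMonoidAlgebra.mapDomainAlgHom_apply, Finsupp.single_apply]
    | add a b ha hb =>
      rw [map_add]
      simp only [AddMonoidAlgebra.coeff_add, Finsupp.add_apply, Finset.sum_add_distrib, ha, hb]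
    | smul r a ha =>
      rw [map_smul]
      simp only [AddMonoidAlgebra.coeff_smul, Finsupp.smul_apply, smul_eq_mul, ← Finset.mul_sum,
        ha]
  have htot : ∀ m, ∑ g, (level m (y v)).coeff g = ∑ g, (level 0 (y v)).coeff g := by
    intro m
    induction m with
    | zero => rfl
    | succ m ih => rw [← ih, ← mapDomain_level m, hsum]
  have hcard : ∀ m, Fintype.card (Level p l m) = p ^ (m * l) := by
    intro m
    rw [Fintype.card_fun, ZMod.card, Fintype.card_fin, pow_mul]
  -- The coefficient sum is the same at all levels, but at level `m` it is `p ^ (m * l)` times the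
  -- common coefficient. For `l ≠ 0` it is divisible by every power of `p`, hence zero.
  have hmul : ∀ m g, (p : ℤ_[p]) ^ (m * l) * (level m (y v)).coeff g =
      ∑ g, (level 0 (y v)).coeff g := by
    intro m g
    rw [← htot m, Finset.sum_congr rfl fun g' _ => hconst m v g' g, Finset.sum_const,
      Finset.card_univ, hcard, nsmul_eq_mul, Nat.cast_pow]
  have hzero : ∑ g, (level 0 (y v)).coeff g = 0 := by
    by_contra hne
    have hdvd : ∀ m, (p : ℤ_[p]) ^ m ∣ ∑ g, (level 0 (y v)).coeff g := by
      intro m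
      rw [← hmul m 0]
      exact (pow_dvd_pow _ (Nat.le_mul_of_pos_right m (Nat.pos_of_ne_zero hl))).mul_right _
    exact hne ((FiniteMultiplicity.not_iff_forall.mpr hdvd |> fun h => by_contra fun h0 =>
      h (FiniteMultiplicity.of_not_isUnit PadicInt.prime_p.not_isUnit h0)))
  rw [Pi.zero_apply, map_zero]
  ext g
  have := hmul m g
  rw [hzero, mul_eq_zero] at this
  exact this.resolve_left (pow_ne_zero _ PadicInt.prime_p.ne_zero)

end JInf

/-! ### Connectedness of subcovers -/

section Subcover

variable {V S : Type*} {X : Multigraph V S} {p : ℕ} [Fact p.Prime] {l l' : ℕ}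
  {α : S → Fin l → ℤ_[p]}

theorem layer_connected_of_surjective (m : ℕ) (h : (X.layer α m).Connected)
    {π : (Fin l → ℤ_[p]) →ₗ[ℤ_[p]] (Fin l' → ℤ_[p])} (hπ : Function.Surjective π) :
    (X.layer (fun s => π (α s)) m).Connected := by
  obtain ⟨⟨w⟩, hc⟩ := h
  let f : V × Level p l m → V × Level p l' m := Prod.map id (levelLinear π m)
  have hf : Function.Surjective f :=
    Function.Surjective.prodMap Function.surjective_id (levelLinear_surjective hπ m)
  refine ⟨⟨f w⟩, fun a b => ?_⟩
  obtain ⟨a, rfl⟩ := hf a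
  obtain ⟨b, rfl⟩ := hf b
  induction hc a b with
  | rel a b h =>
    obtain ⟨⟨e, g⟩, rfl, rfl⟩ := h
    refine Relation.EqvGen.rel _ _ ⟨(e, levelLinear π m g), rfl, ?_⟩
    refine Prod.ext rfl ?_
    change levelLinear π m g + red m (π (α e)) = levelLinear π m (g + red m (α e))
    rw [map_add, levelLinear_red]
  | refl => exact Relation.EqvGen.refl _
  | symm _ _ _ ih => exact ih.symm
  | trans _ _ _ _ _ h1 h2 => exact h1.trans _ _ _ h2

end Subcover

end Multigraph

open Iwasawa

/-! ### Divisibility up to relatively prime factors -/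

section Preliminaries

theorem dvd_of_dvd_mul_of_isRelPrime {R : Type*} [CommRing R] [IsDomain R]
    [UniqueFactorizationMonoid R] {f u a b : R} (h : IsRelPrime a b) (ha : f ∣ u * a)
    (hb : f ∣ u * b) : f ∣ u := by
  classical
  let _ : GCDMonoid R := UniqueFactorizationMonoid.toGCDMonoid R
  have h1 : f ∣ u * gcd a b := (dvd_gcd ha hb).trans (gcd_mul_left' u a b).dvd
  exact h1.trans ((h (gcd_dvd_left a b) (gcd_dvd_right a b)).mul_right_dvd.2 dvd_rfl)

/-- The version for a prime divisor needs no unique factorization and so can be used over `Λ_2`. -/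
theorem Prime.dvd_of_dvd_mul_of_isRelPrime {R : Type*} [CommRing R] {q u a b : R} (hq : Prime q)
    (h : IsRelPrime a b) (ha : q ∣ u * a) (hb : q ∣ u * b) : q ∣ u := by
  by_contra hu
  exact hq.not_isUnit (h ((hq.dvd_or_dvd ha).resolve_left hu) ((hq.dvd_or_dvd hb).resolve_left hu))

theorem Iwasawa.Elementary.not_dvd_G {R : Type*} [CommRing R] {q : R} (hq : Prime q)
    (D : Elementary R q) : ¬ q ∣ D.G := by
  intro h
  obtain ⟨j, -, hj⟩ := (Prime.dvd_finsetProd_iff hq _).1 h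
  exact hq.not_isUnit (D.coprime j dvd_rfl hj)

end Preliminaries

/-! ### Comparison of the determinant with the characteristic series -/

section JacobianDeterminant

variable {V S : Type*} [Fintype V] [Fintype S] {X : Multigraph V S} {p : ℕ} [Fact p.Prime] {l : ℕ}
  {α : S → Fin l → ℤ_[p]}

theorem ker_level_le_of_algEquiv {R : Type*} [CommRing R] [IsLocalRing R] [Algebra ℤ_[p] R]
    [IsLocalRing (Lam p l)] (Φ : R ≃ₐ[ℤ_[p]] Lam p l)
    (h : ∀ m r, level m (Φ r) = 0 → r ∈ IsLocalRing.maximalIdeal R ^ m) (m : ℕ) :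
    RingHom.ker (level (p := p) (l := l) m) ≤ IsLocalRing.maximalIdeal (Lam p l) ^ m := by
  intro x hx
  obtain ⟨r, rfl⟩ := Φ.surjective x
  have h1 := Ideal.mem_map_of_mem (Φ : R →+* Lam p l) (h m r hx)
  rw [Ideal.map_pow] at h1
  refine Ideal.pow_right_mono (Ideal.map_le_iff_le_comap.2 fun r hr => ?_) m h1
  rw [Ideal.mem_comap, IsLocalRing.mem_maximalIdeal, mem_nonunits_iff]
  rw [IsLocalRing.mem_maximalIdeal, mem_nonunits_iff] at hr
  exact fun hu => hr ((MulEquiv.isUnit_map Φ).1 hu)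

theorem ker_level_le_one (m : ℕ) :
    RingHom.ker (level (p := p) (l := 1) m) ≤ IsLocalRing.maximalIdeal (Lam p 1) ^ m := by
  obtain ⟨Φ, -, h⟩ := exists_algEquiv_lam_one p
  exact ker_level_le_of_algEquiv Φ h m

theorem ker_level_le_two (m : ℕ) :
    RingHom.ker (level (p := p) (l := 2) m) ≤ IsLocalRing.maximalIdeal (Lam p 2) ^ m := by
  obtain ⟨Φ, -, -, h⟩ := exists_algEquiv_lam_two p
  exact ker_level_le_of_algEquiv Φ h m

theorem Multigraph.exists_isPseudoIso_elementaryOf_jInf [IsDomain (Lam p l)]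
    [IsNoetherianRing (Lam p l)] (hp : Prime (p : Lam p l)) {s : Multiset (Lam p l)}
    (hs : ∀ q ∈ s, Prime q) (hprod : Associated s.prod (X.lamDet α)) :
    ∃ φ : X.JInf α →ₗ[Lam p l] (elementaryOf (p : Lam p l) (X.JInf α)).Carrier,
      IsPseudoIso φ := by
  have := X.module_finite_jInf α
  refine isPseudoIso_elementaryOf (exists_elementary_isPseudoIso hp hs fun x => ?_)
  obtain ⟨u, hu⟩ := hprod.symm
  rw [← hu, mul_comm, mul_smul, X.lamDet_smul, smul_zero]

theorem Multigraph.exists_isPseudoIso_elementaryOf_jInf_one {α : S → Fin 1 → ℤ_[p]}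
    (h : X.lamDet α ≠ 0) :
    ∃ φ : X.JInf α →ₗ[Lam p 1] (elementaryOf (p : Lam p 1) (X.JInf α)).Carrier,
      IsPseudoIso φ := by
  obtain ⟨s, hs, hprod⟩ := UniqueFactorizationMonoid.exists_prime_factors _ h
  exact exists_isPseudoIso_elementaryOf_jInf (prime_natCast_lam_one p) hs hprod

/-- The characteristic series times `a`, or times `b`, kills `J_∞`, so the determinant divides the
stated powers at each level and hence in `Λ`. -/
theorem Multigraph.exists_lamDet_dvd_pow [IsNoetherianRing (Lam p l)] [IsLocalRing (Lam p l)]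
    (hker : ∀ m, RingHom.ker (level (p := p) (l := l) m) ≤ IsLocalRing.maximalIdeal (Lam p l) ^ m)
    {D : Elementary (Lam p l) (p : Lam p l)} {φ : X.JInf α →ₗ[Lam p l] D.Carrier}
    (hφ : IsPseudoIso φ) : ∃ a b, IsRelPrime a b ∧ ∀ σ,
      X.lamDet α ∣ (D.charSeries * (ofGroup σ - 1) * a) ^ Fintype.card V ∧
      X.lamDet α ∣ (D.charSeries * (ofGroup σ - 1) * b) ^ Fintype.card V := by
  obtain ⟨a, b, hab, h⟩ := exists_charSeries_mul_smul hφ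
  refine ⟨a, b, hab, fun σ => ⟨?_, ?_⟩⟩
  · rw [mul_right_comm]
    exact dvd_of_forall_level hker
      (X.exists_level_pow_eq_of_smul_eq_zero α (fun x => (h x).1) σ)
  · rw [mul_right_comm]
    exact dvd_of_forall_level hker
      (X.exists_level_pow_eq_of_smul_eq_zero α (fun x => (h x).2) σ)

/-- Prime divisors of the determinant of the Laplacian divide `(σ - 1)` times the characteristic
power series. -/
theorem Multigraph.dvd_charSeries_mul_of_dvd_lamDet [IsNoetherianRing (Lam p l)]
    [IsLocalRing (Lam p l)]
    (hker : ∀ m, RingHom.ker (level (p := p) (l := l) m) ≤ IsLocalRing.maximalIdeal (Lam p l) ^ m)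
    {D : Elementary (Lam p l) (p : Lam p l)} {φ : X.JInf α →ₗ[Lam p l] D.Carrier}
    (hφ : IsPseudoIso φ) {q : Lam p l} (hq : Prime q) (h : q ∣ X.lamDet α) (σ : Fin l → ℤ_[p]) :
    q ∣ D.charSeries * (ofGroup σ - 1) := by
  obtain ⟨a, b, hab, hd⟩ := exists_lamDet_dvd_pow hker hφ
  exact hq.dvd_of_dvd_mul_of_isRelPrime hab (hq.dvd_of_dvd_pow (h.trans (hd σ).1))
    (hq.dvd_of_dvd_pow (h.trans (hd σ).2))

/-- The determinant kills `J_∞`, so a positive exponent `e i` forces `p` to divide it up to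
relatively prime factors. -/
theorem Multigraph.dvd_lamDet_of_m0_pos [IsDomain (Lam p l)] (hp : Prime (p : Lam p l))
    (h : 0 < m0 p l (X.JInf α)) : (p : Lam p l) ∣ X.lamDet α := by
  by_cases hex : ∃ D : Elementary (Lam p l) (p : Lam p l), ∃ φ : X.JInf α →ₗ[Lam p l] D.Carrier,
      IsPseudoIso φ
  · obtain ⟨φ, hφ⟩ := isPseudoIso_elementaryOf hex
    obtain ⟨a, b, hab, hd⟩ := exists_relPrime_pow_dvd hφ (X.lamDet_smul α)
    have hsum : ∑ i, (elementaryOf (p : Lam p l) (X.JInf α)).e i ≠ 0 := h.ne'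
    obtain ⟨i, -, hi⟩ := Finset.exists_ne_zero_of_sum_ne_zero hsum
    exact hp.dvd_of_dvd_mul_of_isRelPrime hab ((dvd_pow_self _ hi).trans (hd i).1)
      ((dvd_pow_self _ hi).trans (hd i).2)
  -- Without a pseudo-isomorphism the default elementary module has empty lists and `m0 = 0`,
  -- against the hypothesis.
  · rw [m0, elementaryOf, dif_neg hex] at h
    exact absurd h (lt_irrefl 0)

end JacobianDeterminant

/-! ### Reduction of `Λ_1` modulo `p` -/

section ReductionModP

variable (p : ℕ) [Fact p.Prime]

/-- The isomorphism `Λ_1 / p ≃ 𝔽_p⟦X⟧`, and the Weierstrass preparation theorem in `Λ_1`. -/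
theorem exists_reduction : ∃ ρ : Lam p 1 →+* PowerSeries (ZMod p),
    (∀ x, ρ x = 0 ↔ (p : Lam p 1) ∣ x) ∧
    ρ (ofGroup fun _ => 1) = 1 + PowerSeries.X ∧
    (∀ P : Polynomial ℤ_[p], P.IsDistinguishedAt (Ideal.span {(p : ℤ_[p])}) →
      ρ (Polynomial.aeval (ofGroup (fun _ : Fin 1 => (1 : ℤ_[p])) - 1) P) =
        PowerSeries.X ^ P.natDegree) ∧
    ∀ x, ¬ (p : Lam p 1) ∣ x → ∃ P : Polynomial ℤ_[p],
      P.IsDistinguishedAt (Ideal.span {(p : ℤ_[p])}) ∧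
      Associated x (Polynomial.aeval (ofGroup (fun _ : Fin 1 => (1 : ℤ_[p])) - 1) P) := by
  obtain ⟨Φ, hΦ, -⟩ := exists_algEquiv_lam_one p
  have hP : ∀ P : Polynomial ℤ_[p],
      Polynomial.aeval (ofGroup (fun _ : Fin 1 => (1 : ℤ_[p])) - 1) P = Φ P := by
    intro P
    have h1 : Polynomial.aeval (PowerSeries.X : PowerSeries ℤ_[p]) P = P := by
      induction P using Polynomial.induction_on' with
      | add f g hf hg => rw [map_add, hf, hg, Polynomial.coe_add]
      | monomial n a =>
        rw [Polynomial.aeval_monomial, Polynomial.coe_monomial, PowerSeries.monomial_eq_C_mul_X_pow]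
        rfl
    rw [← h1, ← hΦ]
    exact Polynomial.aeval_algHom_apply Φ.toAlgHom _ P
  have hX : Φ.symm (ofGroup (fun _ : Fin 1 => (1 : ℤ_[p])) - 1) = PowerSeries.X := by
    rw [← hΦ, AlgEquiv.symm_apply_apply]
  refine ⟨(PowerSeries.map PadicInt.toZMod).comp (Φ.symm : Lam p 1 →+* PowerSeries ℤ_[p]),
    fun x => ?_, ?_, fun P hd => ?_, fun x hx => ?_⟩
  · obtain ⟨f, rfl⟩ := Φ.surjective x
    have h1 : (p : Lam p 1) ∣ Φ f ↔ (p : PowerSeries ℤ_[p]) ∣ f := by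
      rw [← map_dvd_iff Φ, map_natCast]
    rw [h1, ← map_natCast PowerSeries.C, PowerSeries.C_dvd_iff, RingHom.comp_apply]
    have h2 : (Φ.symm : Lam p 1 →+* PowerSeries ℤ_[p]) (Φ f) = f := Φ.symm_apply_apply f
    rw [h2, PowerSeries.ext_iff]
    refine forall_congr' fun n => ?_
    rw [PowerSeries.coeff_map, map_zero, ← RingHom.mem_ker, PadicInt.ker_toZMod,
      PadicInt.maximalIdeal_eq_span_p, Ideal.mem_span_singleton]
  · have h3 : (Φ.symm : Lam p 1 →+* PowerSeries ℤ_[p]) (ofGroup fun _ => 1) =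
        1 + PowerSeries.X := by
      change Φ.symm _ = _
      rw [← hX, map_sub, map_one, add_sub_cancel]
    rw [RingHom.comp_apply, h3, map_add, map_one, PowerSeries.map_X]
  · rw [hP, RingHom.comp_apply]
    have h2 : (Φ.symm : Lam p 1 →+* PowerSeries ℤ_[p]) (Φ P) = P := Φ.symm_apply_apply _
    rw [h2]
    ext n
    rw [PowerSeries.coeff_map, Polynomial.coeff_coe, PowerSeries.coeff_X_pow]
    split_ifs with h
    · rw [h, hd.monic.coeff_natDegree, map_one]
    · rcases lt_or_gt_of_ne h with h | h
      · rw [← RingHom.mem_ker, PadicInt.ker_toZMod, PadicInt.maximalIdeal_eq_span_p]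
        exact hd.mem h
      · rw [Polynomial.coeff_eq_zero_of_natDegree_lt h, map_zero]
  · obtain ⟨f, rfl⟩ := Φ.surjective x
    have hf : f.map (IsLocalRing.residue ℤ_[p]) ≠ 0 := by
      intro h0
      refine hx ?_
      rw [← map_natCast Φ, map_dvd_iff Φ, ← map_natCast PowerSeries.C, PowerSeries.C_dvd_iff]
      intro n
      have hn := PowerSeries.ext_iff.1 h0 n
      rwa [PowerSeries.coeff_map, map_zero, IsLocalRing.residue_eq_zero_iff,
        PadicInt.maximalIdeal_eq_span_p, Ideal.mem_span_singleton] at hn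
    obtain ⟨P, h, hw⟩ := PowerSeries.exists_isWeierstrassFactorization hf
    refine ⟨P, ?_, ?_⟩
    · rw [← PadicInt.maximalIdeal_eq_span_p]; exact hw.isDistinguishedAt
    · rw [hP]
      refine Associated.map Φ ?_
      rw [hw.eq_mul]
      exact associated_mul_unit_left _ _ hw.isUnit

variable {p}

theorem one_add_X_pow_prime_pow (N : ℕ) :
    (1 + PowerSeries.X : PowerSeries (ZMod p)) ^ p ^ N = 1 + PowerSeries.X ^ p ^ N := by
  have : CharP (PowerSeries (ZMod p)) p :=
    charP_of_injective_ringHom (PowerSeries.C_injective (R := ZMod p)) p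
  rw [add_pow_char_pow, one_pow]

/-- Weierstrass preparation shows that the infimum defining `lambda` is over a non-empty set, so it
is attained. Cancelling `p ^ μ` leaves `G` associated with a distinguished polynomial, which reduces
to a power of `X`. -/
theorem associated_reduction_G {ρ : Lam p 1 →+* PowerSeries (ZMod p)}
    (hP : ∀ P : Polynomial ℤ_[p], P.IsDistinguishedAt (Ideal.span {(p : ℤ_[p])}) →
      ρ (Polynomial.aeval (ofGroup (fun _ : Fin 1 => (1 : ℤ_[p])) - 1) P) =
        PowerSeries.X ^ P.natDegree)
    (hW : ∀ x, ¬ (p : Lam p 1) ∣ x → ∃ P : Polynomial ℤ_[p],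
      P.IsDistinguishedAt (Ideal.span {(p : ℤ_[p])}) ∧
      Associated x (Polynomial.aeval (ofGroup (fun _ : Fin 1 => (1 : ℤ_[p])) - 1) P))
    (A : Type*) [AddCommGroup A] [Module (Lam p 1) A] :
    Associated (ρ (elementaryOf (p : Lam p 1) A).G) (PowerSeries.X ^ lambda p A) := by
  have hp := prime_natCast_lam_one p
  obtain ⟨P, hd, hA⟩ := hW _ ((elementaryOf (p : Lam p 1) A).not_dvd_G hp)
  have hmem := Nat.sInf_mem (s := {d | ∃ P : Polynomial ℤ_[p],
    P.IsDistinguishedAt (Ideal.span {(p : ℤ_[p])}) ∧ P.natDegree = d ∧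
    Associated (elementaryOf (p : Lam p 1) A).charSeries
      ((p : Lam p 1) ^ mu p A * Polynomial.aeval (ofGroup (fun _ : Fin 1 => (1 : ℤ_[p])) - 1) P)})
    ⟨_, P, hd, rfl, hA.mul_left _⟩
  obtain ⟨P', hd', hdeg, hA'⟩ := hmem
  have h1 : Associated (elementaryOf (p : Lam p 1) A).G
      (Polynomial.aeval (ofGroup (fun _ : Fin 1 => (1 : ℤ_[p])) - 1) P') :=
    Associated.of_mul_left hA' (Associated.refl _) (pow_ne_zero _ hp.ne_zero)
  have h2 := h1.map ρ
  rw [hP P' hd', hdeg] at h2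
  exact h2

end ReductionModP

/-! ### Projections to `ℤ_p` and the primes `(σ - 1)` of `Λ_2/p` -/

section Slopes

variable {p : ℕ} [Fact p.Prime]

instance : (Ideal.span {(p : Lam p 2)}).IsPrime :=
  (Ideal.span_singleton_prime (prime_natCast_lam_two p).ne_zero).2 (prime_natCast_lam_two p)

section Kernel

variable {π : (Fin 2 → ℤ_[p]) →ₗ[ℤ_[p]] (Fin 1 → ℤ_[p])}
  {θ : (Fin 2 → ℤ_[p]) ≃ₗ[ℤ_[p]] (Fin 2 → ℤ_[p])}

theorem surjective_of_comp_eq_lastCoord (h : π ∘ₗ θ.toLinearMap = lastCoord p) :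
    Function.Surjective π := by
  intro y
  refine ⟨θ (fun _ => y 0), ?_⟩
  have := LinearMap.congr_fun h (fun _ => y 0)
  rw [lastCoord_apply] at this
  refine this.trans (funext fun i => ?_)
  rw [Subsingleton.elim i 0]

theorem lamMap_ofGroup_sub_one_eq_zero (h : π ∘ₗ θ.toLinearMap = lastCoord p) :
    lamMap π (ofGroup (θ (Pi.single 0 1)) - 1) = 0 := by
  rw [← RingHom.mem_ker, ker_lamMap θ h]
  exact Ideal.mem_span_singleton_self _

theorem dvd_lamMap_iff (h : π ∘ₗ θ.toLinearMap = lastCoord p) (x : Lam p 2) :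
    (p : Lam p 1) ∣ lamMap π x ↔
      ∃ y z, x = (ofGroup (θ (Pi.single 0 1)) - 1) * y + p * z := by
  constructor
  · rintro ⟨w, hw⟩
    obtain ⟨z, rfl⟩ := lamMap_surjective (surjective_of_comp_eq_lastCoord h) w
    have h1 : x - p * z ∈ RingHom.ker (lamMap π) := by
      rw [RingHom.mem_ker, map_sub, map_mul, map_natCast, hw, sub_self]
    rw [ker_lamMap θ h, Ideal.mem_span_singleton] at h1
    obtain ⟨y, hy⟩ := h1
    exact ⟨y, z, by rw [← hy, sub_add_cancel]⟩
  · rintro ⟨y, z, rfl⟩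
    rw [map_add, map_mul, lamMap_ofGroup_sub_one_eq_zero h, zero_mul, zero_add, map_mul,
      map_natCast]
    exact dvd_mul_right _ _

/-- Both sides say that `x` lies in `(p, σ - 1)`, with `σ` the generator of the kernel of `π`. -/
theorem mk_mem_span_iff (h : π ∘ₗ θ.toLinearMap = lastCoord p) (x : Lam p 2) :
    (Ideal.Quotient.mk (Ideal.span {(p : Lam p 2)}) x ∈
      Ideal.span {Ideal.Quotient.mk (Ideal.span {(p : Lam p 2)})
        (ofGroup (θ (Pi.single 0 1)) - 1)}) ↔ (p : Lam p 1) ∣ lamMap π x := by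
  rw [dvd_lamMap_iff h, Ideal.mem_span_singleton]
  constructor
  · rintro ⟨y, hy⟩
    obtain ⟨y, rfl⟩ := Ideal.Quotient.mk_surjective y
    rw [← map_mul, Ideal.Quotient.eq, Ideal.mem_span_singleton] at hy
    obtain ⟨z, hz⟩ := hy
    exact ⟨y, z, by rw [← hz]; ring⟩
  · rintro ⟨y, z, rfl⟩
    refine ⟨Ideal.Quotient.mk _ y, ?_⟩
    rw [← map_mul, Ideal.Quotient.eq, Ideal.mem_span_singleton]
    exact ⟨z, by ring⟩

/-- Through `mk_mem_span_iff` primality is inherited from the prime `p` of `Λ_1`. -/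
theorem isPrime_span_mk (h : π ∘ₗ θ.toLinearMap = lastCoord p) :
    (Ideal.span {Ideal.Quotient.mk (Ideal.span {(p : Lam p 2)})
        (ofGroup (θ (Pi.single 0 1)) - 1)}).IsPrime where
  ne_top' := by
    rw [Ne, Ideal.eq_top_iff_one, ← map_one (Ideal.Quotient.mk _), mk_mem_span_iff h, map_one]
    exact fun hd => (prime_natCast_lam_one p).not_isUnit (isUnit_of_dvd_one hd)
  mem_or_mem' := by
    intro x y
    obtain ⟨x, rfl⟩ := Ideal.Quotient.mk_surjective x
    obtain ⟨y, rfl⟩ := Ideal.Quotient.mk_surjective y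
    rw [← map_mul, mk_mem_span_iff h, mk_mem_span_iff h, mk_mem_span_iff h, map_mul]
    exact (prime_natCast_lam_one p).dvd_or_dvd

/-- The generator is the image of a basis vector under an automorphism, so it is not divisible by
`p`. -/
theorem span_mk_mem_groupPrimes (h : π ∘ₗ θ.toLinearMap = lastCoord p) :
    Ideal.span {Ideal.Quotient.mk (Ideal.span {(p : Lam p 2)})
        (ofGroup (θ (Pi.single 0 1)) - 1)} ∈ groupPrimes p 2 := by
  refine ⟨isPrime_span_mk h, _, ?_, rfl⟩
  rintro ⟨τ, hτ⟩
  have h1 : (Pi.single 0 1 : Fin 2 → ℤ_[p]) = p • θ.symm τ := by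
    rw [← map_nsmul, ← hτ, LinearEquiv.symm_apply_apply]
  have h2 := congrFun h1 0
  rw [Pi.single_eq_same, Pi.smul_apply, nsmul_eq_mul] at h2
  exact PadicInt.prime_p.not_isUnit (IsUnit.of_mul_eq_one _ h2.symm)

theorem l0_pos_of_dvd_lamMap (h : π ∘ₗ θ.toLinearMap = lastCoord p) (A : Type*) [AddCommGroup A]
    [Module (Lam p 2) A]
    (hG : (p : Lam p 1) ∣ lamMap π (elementaryOf (p : Lam p 2) A).G) : 0 < l0 p 2 A := by
  classical
  set x := Ideal.Quotient.mk (Ideal.span {(p : Lam p 2)}) (elementaryOf (p : Lam p 2) A).G with hx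
  set P := Ideal.span {Ideal.Quotient.mk (Ideal.span {(p : Lam p 2)})
        (ofGroup (θ (Pi.single 0 1)) - 1)} with hP
  have hx0 : x ≠ 0 := by
    rw [hx, Ne, Ideal.Quotient.eq_zero_iff_mem, Ideal.mem_span_singleton]
    exact Elementary.not_dvd_G (prime_natCast_lam_two p) _
  have hpos : 0 < idealVal P x :=
    idealVal_pos (isPrime_span_mk h).ne_top hx0 ((mk_mem_span_iff h _).2 hG)
  refine hpos.trans_le ?_
  -- Finite support is essential: otherwise the `finsum` defining `l0` would take the value `0`.
  have hfin : (Function.support fun Q => ∑ᶠ (_ : Q ∈ groupPrimes p 2), idealVal Q x).Finite := by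
    refine (finite_principal_primes hx0).subset fun Q hQ => ?_
    by_cases hQm : Q ∈ groupPrimes p 2
    · rw [Function.mem_support, finsum_eq_dif] at hQ
      rw [dif_pos hQm] at hQ
      obtain ⟨h1, σ, -, h2⟩ := hQm
      exact ⟨h1, ⟨_, h2⟩, mem_of_idealVal_ne_zero hQ⟩
    · rw [Function.mem_support, finsum_eq_dif, dif_neg hQm] at hQ
      exact absurd rfl hQ
  have hle := single_le_finsum P hfin fun _ => Nat.zero_le _
  rw [finsum_eq_dif, dif_pos (span_mk_mem_groupPrimes h)] at hle
  exact hle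

end Kernel

/-- The projections with kernel generated by `σ - c τ`, where `σ, τ` is a basis of `ℤ_p^2`. -/
theorem exists_slope (θ : (Fin 2 → ℤ_[p]) ≃ₗ[ℤ_[p]] (Fin 2 → ℤ_[p])) (c : ℤ_[p]) :
    ∃ (π : (Fin 2 → ℤ_[p]) →ₗ[ℤ_[p]] (Fin 1 → ℤ_[p]))
      (θ' : (Fin 2 → ℤ_[p]) ≃ₗ[ℤ_[p]] (Fin 2 → ℤ_[p])),
      π ∘ₗ θ'.toLinearMap = lastCoord p ∧
      θ' (Pi.single 0 1) = θ (Pi.single 0 1) - c • θ (Pi.single 1 1) ∧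
      π (θ (Pi.single 0 1)) = (fun _ => c) ∧ π (θ (Pi.single 1 1)) = fun _ => 1 := by
  let sh : (Fin 2 → ℤ_[p]) ≃ₗ[ℤ_[p]] (Fin 2 → ℤ_[p]) := LinearEquiv.ofLinearMap
    (LinearMap.pi ![LinearMap.proj 0, LinearMap.proj 1 - c • LinearMap.proj 0])
    (LinearMap.pi ![LinearMap.proj 0, LinearMap.proj 1 + c • LinearMap.proj 0])
    (LinearMap.ext fun x => funext fun i => by fin_cases i <;> simp)
    (LinearMap.ext fun x => funext fun i => by fin_cases i <;> simp)
  refine ⟨lastCoord p ∘ₗ sh.symm.toLinearMap ∘ₗ θ.symm.toLinearMap, sh.trans θ, ?_, ?_, ?_, ?_⟩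
  · refine LinearMap.ext fun x => ?_
    simp
  · have : sh (Pi.single 0 1) = Pi.single 0 1 - c • Pi.single 1 1 := by
      funext i
      fin_cases i <;> simp [sh]
    rw [LinearEquiv.trans_apply, this, map_sub, map_smul]
  · simp [lastCoord_apply, sh]
  · simp [lastCoord_apply, sh]

theorem ofGroup_const_pow (N : ℕ) : (ofGroup fun _ : Fin 1 => (p : ℤ_[p]) ^ N) =
    (ofGroup fun _ : Fin 1 => (1 : ℤ_[p])) ^ p ^ N := by
  rw [← ofGroup_nsmul]
  congr 1
  funext _
  simp

/-- A non-zero element of `Λ_2 / p` is non-zero in all but finitely many of the quotients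
`Λ_2 / (p, σ - p^N τ)`. -/
theorem finite_setOf_dvd_lamMap {θ : (Fin 2 → ℤ_[p]) ≃ₗ[ℤ_[p]] (Fin 2 → ℤ_[p])}
    {π : ℕ → (Fin 2 → ℤ_[p]) →ₗ[ℤ_[p]] (Fin 1 → ℤ_[p])}
    {θ' : ℕ → (Fin 2 → ℤ_[p]) ≃ₗ[ℤ_[p]] (Fin 2 → ℤ_[p])}
    (h : ∀ N, π N ∘ₗ (θ' N).toLinearMap = lastCoord p)
    (hθ : ∀ N, θ' N (Pi.single 0 1) =
      θ (Pi.single 0 1) - (p : ℤ_[p]) ^ N • θ (Pi.single 1 1))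
    (h0 : ∀ N, π N (θ (Pi.single 0 1)) = fun _ => (p : ℤ_[p]) ^ N)
    (h1 : ∀ N, π N (θ (Pi.single 1 1)) = fun _ => 1)
    {x : Lam p 2} (hx : ¬ (p : Lam p 2) ∣ x) :
    {N | (p : Lam p 1) ∣ lamMap (π N) x}.Finite := by
  obtain ⟨ρ, hρ, hρ1, -⟩ := exists_reduction p
  let P : ℕ → Ideal (LamBar p 2) := fun N =>
    Ideal.span {Ideal.Quotient.mk _ (ofGroup (θ' N (Pi.single 0 1)) - 1)}
  -- If the ideals for `N` and `M` agree, `π N` sends the generator for `M` to a multiple of `p`.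
  -- Multiplied by `γ^(p^M)` this reads `γ^(p^N) ≡ γ^(p^M)`, that is `X^(p^N) = X^(p^M)` modulo `p`.
  have hinj : Function.Injective P := by
    intro N M hNM
    have hmem : Ideal.Quotient.mk (Ideal.span {(p : Lam p 2)})
        (ofGroup (θ' M (Pi.single 0 1)) - 1) ∈ P N := by
      rw [hNM]; exact Ideal.mem_span_singleton_self _
    rw [mk_mem_span_iff (h N), map_sub, map_one, lamMap_ofGroup, hθ, map_sub, map_smul, h0,
      h1] at hmem
    have h2 : (p : Lam p 1) ∣ (ofGroup fun _ : Fin 1 => (p : ℤ_[p]) ^ N) -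
        (ofGroup fun _ : Fin 1 => (p : ℤ_[p]) ^ M) := by
      have h3 : ((ofGroup fun _ : Fin 1 => (p : ℤ_[p]) ^ N) : Lam p 1) =
          ofGroup ((fun _ => (p : ℤ_[p]) ^ N) - (p : ℤ_[p]) ^ M • fun _ => 1) *
            ofGroup fun _ : Fin 1 => (p : ℤ_[p]) ^ M := by
        rw [← ofGroup_add]
        congr 1
        funext _
        simp
      rw [h3]
      nth_rewrite 2 [← one_mul (ofGroup fun _ : Fin 1 => (p : ℤ_[p]) ^ M)]
      rw [← sub_mul]
      exact hmem.mul_right _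
    rw [← hρ, map_sub, ofGroup_const_pow, ofGroup_const_pow, map_pow, map_pow, hρ1,
      one_add_X_pow_prime_pow, one_add_X_pow_prime_pow, add_sub_add_left_eq_sub, sub_eq_zero] at h2
    have h4 := congrArg PowerSeries.order h2
    rw [PowerSeries.order_X_pow, PowerSeries.order_X_pow, Nat.cast_inj] at h4
    exact Nat.pow_right_injective (Fact.out : p.Prime).two_le h4
  have hx0 : Ideal.Quotient.mk (Ideal.span {(p : Lam p 2)}) x ≠ 0 := by
    rwa [Ne, Ideal.Quotient.eq_zero_iff_mem, Ideal.mem_span_singleton]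
  refine ((finite_principal_primes hx0).preimage hinj.injOn).subset fun N hN => ?_
  exact ⟨isPrime_span_mk (h N), ⟨_, rfl⟩, (mk_mem_span_iff (h N) x).2 hN⟩

theorem PowerSeries.isRelPrime_C_X {A : Type*} [CommRing A] [IsDomain A] {a : A} (ha : a ≠ 0) :
    IsRelPrime (PowerSeries.C a) PowerSeries.X := by
  rintro d hd0 ⟨s, hs⟩
  rcases PowerSeries.X_prime.dvd_or_dvd hs.dvd with hX | ⟨t, rfl⟩
  · have h := hX.trans hd0
    rw [PowerSeries.X_dvd_iff, PowerSeries.constantCoeff_C] at h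
    exact absurd h ha
  · refine IsUnit.of_mul_eq_one t (mul_left_cancel₀ PowerSeries.X_ne_zero ?_)
    rw [mul_one, mul_left_comm]
    exact hs.symm

theorem isRelPrime_ofGroup_single_sub_one : IsRelPrime
    (ofGroup (Pi.single 0 1 : Fin 2 → ℤ_[p]) - 1) (ofGroup (Pi.single 1 1) - 1) := by
  obtain ⟨Φ, h0, h1, -⟩ := exists_algEquiv_lam_two p
  have key : IsRelPrime (PowerSeries.C (PowerSeries.X : PowerSeries ℤ_[p])) PowerSeries.X :=
    PowerSeries.isRelPrime_C_X PowerSeries.X_ne_zero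
  intro d hd0 hd1
  rw [← h0] at hd0
  rw [← h1] at hd1
  have e0 := map_dvd Φ.symm hd0
  have e1 := map_dvd Φ.symm hd1
  rw [AlgEquiv.symm_apply_apply] at e0 e1
  exact (MulEquiv.isUnit_map Φ.symm).1 (key e0 e1)

theorem not_dvd_ofGroup_one_sub_one :
    ¬ (p : Lam p 1) ∣ (ofGroup fun _ => (1 : ℤ_[p])) - 1 := by
  obtain ⟨ρ, hρ, hρ1, -⟩ := exists_reduction p
  rw [← hρ, map_sub, hρ1, map_one, add_sub_cancel_left]
  exact PowerSeries.X_ne_zero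

end Slopes

/-! ### Growth of `λ` and positivity of `l_0` -/

section Main

variable {V S : Type*} [Fintype V] [Fintype S] {X : Multigraph V S} {p : ℕ} [Fact p.Prime]

/-- A prime `p` dividing the determinant would divide the characteristic series times `γ - 1`; but
`p ∤ γ - 1`, and for `μ = 0` the characteristic series is `G`, which is prime to `p`. -/
theorem Multigraph.not_dvd_lamDet_of_mu_eq_zero {β : S → Fin 1 → ℤ_[p]}
    (hconn : ∀ m, (X.layer β m).Connected) (h : mu p (X.JInf β) = 0) :
    ¬ (p : Lam p 1) ∣ X.lamDet β := by
  intro hd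
  have hp := prime_natCast_lam_one p
  obtain ⟨φ, hφ⟩ := exists_isPseudoIso_elementaryOf_jInf_one (X.lamDet_ne_zero β one_ne_zero hconn)
  have h1 := dvd_charSeries_mul_of_dvd_lamDet ker_level_le_one hφ hp hd (fun _ => 1)
  have h2 := (hp.dvd_or_dvd h1).resolve_right not_dvd_ofGroup_one_sub_one
  have h3 : (elementaryOf (p : Lam p 1) (X.JInf β)).m0 = 0 := h
  rw [Elementary.charSeries, h3, pow_zero, one_mul] at h2
  exact Elementary.not_dvd_G hp _ h2

/-- A lower bound for `λ` in terms of the vanishing order modulo `p` of the determinant of the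
voltage Laplacian. -/
theorem Multigraph.le_card_mul_lambda {β : S → Fin 1 → ℤ_[p]} (hp : ¬ (p : Lam p 1) ∣ X.lamDet β)
    {k : ℕ} {y z : Lam p 1}
    (hF : X.lamDet β = ((ofGroup fun _ => (p : ℤ_[p]) ^ k) - 1) * y + (p : Lam p 1) * z) :
    p ^ k ≤ (lambda p (X.JInf β) + 1) * Fintype.card V := by
  have hpp := prime_natCast_lam_one p
  obtain ⟨ρ, hρ, hρ1, hP, hW⟩ := exists_reduction p
  obtain ⟨φ, hφ⟩ := exists_isPseudoIso_elementaryOf_jInf_one (X := X) (α := β)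
    (fun h => hp (h ▸ dvd_zero _))
  obtain ⟨a, b, hab, hd⟩ := exists_lamDet_dvd_pow ker_level_le_one hφ
  obtain ⟨h1, h2⟩ := hd (fun _ => 1)
  rw [mul_pow _ a] at h1
  rw [mul_pow _ b] at h2
  -- Unique factorization in `Λ_1` removes `a` and `b`. As the determinant is prime to `p`, the
  -- power of `p` in the characteristic series drops out as well.
  have h3 := dvd_of_dvd_mul_of_isRelPrime hab.pow h1 h2
  rw [Elementary.charSeries, mul_assoc, mul_pow, ← pow_mul] at h3
  have h4 : IsRelPrime (X.lamDet β) (p : Lam p 1) :=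
    (hpp.irreducible.isRelPrime_iff_not_dvd.2 hp).symm
  have h5 := map_dvd ρ (h4.pow_right.dvd_of_dvd_mul_left h3)
  have hp0 : ρ (p : Lam p 1) = 0 := (hρ _).2 dvd_rfl
  rw [hF, map_add, map_mul, map_mul ρ (p : Lam p 1), hp0, zero_mul, add_zero, map_sub,
    ofGroup_const_pow, map_pow, map_one, hρ1, one_add_X_pow_prime_pow, add_sub_cancel_left, map_pow,
    map_mul, map_sub, hρ1, map_one, add_sub_cancel_left] at h5
  -- Modulo `p`, the left side contributes `X^(p^k)` and the right side `(X^λ * X)^n` with `n` the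
  -- number of vertices. The extra `X`, the `+ 1` in the bound, is the reduction of `γ - 1`.
  have h6 := (dvd_of_mul_right_dvd h5).trans
    (((associated_reduction_G hP hW (X.JInf β)).mul_right PowerSeries.X).pow_pow
      (n := Fintype.card V)).dvd
  rw [← pow_succ, ← pow_mul] at h6
  exact (pow_dvd_pow_iff PowerSeries.X_ne_zero PowerSeries.X_prime.not_isUnit).1 h6

/-- If the determinant of the voltage Laplacian is in `(p, σ - 1)`, then so is `G`. -/
theorem Multigraph.dvd_lamMap_G {α : S → Fin 2 → ℤ_[p]}
    {π₁ π₂ : (Fin 2 → ℤ_[p]) →ₗ[ℤ_[p]] (Fin 1 → ℤ_[p])} (hπ₁ : Function.Surjective π₁)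
    (h₁ : ¬ (p : Lam p 1) ∣ lamMap π₁ (X.lamDet α))
    (h₂ : (p : Lam p 1) ∣ lamMap π₂ (X.lamDet α)) :
    (p : Lam p 1) ∣ lamMap π₂ (elementaryOf (p : Lam p 2) (X.JInf α)).G := by
  have hp1 := prime_natCast_lam_one p
  have hp2 := prime_natCast_lam_two p
  obtain ⟨s, hs, hprod⟩ := exists_primes_of_not_dvd_lamMap hπ₁ h₁
  obtain ⟨φ, hφ⟩ := exists_isPseudoIso_elementaryOf_jInf hp2 hs hprod
  have h3 := h₂.trans (map_dvd (lamMap π₂) hprod.symm.dvd)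
  rw [map_multiset_prod] at h3
  obtain ⟨r, hr, hpr⟩ := hp1.exists_mem_multiset_map_dvd h3
  have hrF : r ∣ X.lamDet α := (Multiset.dvd_prod hr).trans hprod.dvd
  have hdvd := dvd_charSeries_mul_of_dvd_lamDet ker_level_le_two hφ (hs r hr) hrF
  -- Two basis vectors of `ℤ_p^2` give relatively prime `σ - 1`, so the auxiliary factor disappears.
  -- With a single variable this would not be possible.
  have hc := (hs r hr).dvd_of_dvd_mul_of_isRelPrime isRelPrime_ofGroup_single_sub_one
    (hdvd _) (hdvd _)
  -- If `r` divided `p` it would be associated with `p`, and `p` would divide the determinant,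
  -- contrary to the behaviour under `π₁`.
  have hrp : ¬ r ∣ (p : Lam p 2) := by
    intro h
    have h4 := ((hs r hr).associated_of_dvd hp2 h).symm.dvd.trans hrF
    refine h₁ ?_
    have := map_dvd (lamMap π₁) h4
    rwa [map_natCast] at this
  have hrG := ((hs r hr).dvd_or_dvd hc).resolve_left fun h => hrp ((hs r hr).dvd_of_dvd_pow h)
  exact hpr.trans (map_dvd _ hrG)

end Main

theorem theorem9p1 (p : ℕ) [Fact p.Prime] {V S : Type*} [Fintype V] [Fintype S]
    (X : Multigraph V S) (α : S → Fin 2 → ℤ_[p])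
    (hconn : ∀ m : ℕ, (X.layer α m).Connected)
    (β₁ β₂ : S → Fin 1 → ℤ_[p])
    (hβ₁ : Multigraph.IsSubcover α β₁) (hβ₂ : Multigraph.IsSubcover α β₂)
    (hμ₁ : Iwasawa.mu p (X.JInf β₁) = 0) (hμ₂ : 0 < Iwasawa.mu p (X.JInf β₂)) :
    (∀ N : ℕ, ∃ β : S → Fin 1 → ℤ_[p],
      Multigraph.IsSubcover α β ∧ N < Iwasawa.lambda p (X.JInf β)) ∧
    0 < Iwasawa.l0 p 2 (X.JInf α) := by
  obtain ⟨π₁, hπ₁, h₁⟩ := hβ₁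
  obtain ⟨π₂, hπ₂, h₂⟩ := hβ₂
  obtain rfl : β₁ = fun s => π₁ (α s) := funext h₁
  obtain rfl : β₂ = fun s => π₂ (α s) := funext h₂
  have hd₁ : ¬ (p : Lam p 1) ∣ lamMap π₁ (X.lamDet α) := by
    rw [X.lamMap_lamDet α π₁]
    exact Multigraph.not_dvd_lamDet_of_mu_eq_zero
      (fun m => Multigraph.layer_connected_of_surjective m (hconn m) hπ₁) hμ₁
  have hd₂ : (p : Lam p 1) ∣ lamMap π₂ (X.lamDet α) := by
    rw [X.lamMap_lamDet α π₂]
    exact Multigraph.dvd_lamDet_of_m0_pos (prime_natCast_lam_one p) hμ₂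
  obtain ⟨θ, hθ⟩ := exists_comp_eq_lastCoord hπ₂
  refine ⟨fun B => ?_, l0_pos_of_dvd_lamMap hθ _ (Multigraph.dvd_lamMap_G hπ₁ hd₁ hd₂)⟩
  obtain ⟨y, z, hF⟩ := (dvd_lamMap_iff hθ _).1 hd₂
  -- These projections have kernels approaching that of `π₂` as `N` grows; this is where large `λ`
  -- comes from.
  choose π θ' hπθ hθ' h0 h1 using fun N : ℕ => exists_slope θ ((p : ℤ_[p]) ^ N)
  have hfin := finite_setOf_dvd_lamMap hπθ hθ' h0 h1 (x := X.lamDet α) fun h => hd₁ (by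
    have := map_dvd (lamMap π₁) h
    rwa [map_natCast] at this)
  -- Outside the finite exceptional set `N` may be taken above `(B + 1)` times the number of
  -- vertices; `N < p ^ N` then contradicts `λ ≤ B`.
  obtain ⟨N, hN, hBN⟩ := hfin.infinite_compl.exists_gt ((B + 1) * Fintype.card V)
  rw [Set.mem_compl_iff, Set.mem_ofPred_eq, X.lamMap_lamDet α (π N)] at hN
  refine ⟨_, ⟨π N, surjective_of_comp_eq_lastCoord (hπθ N), fun _ => rfl⟩, ?_⟩
  have hle := Multigraph.le_card_mul_lambda hN (k := N) (y := lamMap (π N) y)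
    (z := lamMap (π N) z) (by
      rw [← X.lamMap_lamDet α (π N), hF, map_add, map_mul, map_mul, map_natCast, map_sub, map_one,
        lamMap_ofGroup, h0])
  by_contra! hlam
  have h3 : N < p ^ N := Nat.lt_pow_self (Fact.out : p.Prime).one_lt
  have h4 := Nat.mul_le_mul_right (Fintype.card V) (Nat.add_le_add_right hlam 1)
  omega
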